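/- Let $\mathcal{A}$ be a Grothendieck abelian category with a closed symmetric monoidal structure $(\otimes,\mathbf 1)$. *Objects.* A complete graded object is a $\mathbb{Z}$-graded object $X$ of $\mathcal{A}$ with a decreasing filtration $X=F_0X\supseteq F_1X\supseteq\cdots$ by graded subobjects such that $X\to\lim_p X/F_pX$ is an isomorphism. Their tensor product is the completion of $\otimes$, with Koszul signs. A complete gr-dg object is such an $X$ with a filtration-preserving map $d:X\to X$ of degree $-1$ such that $d^2(F_pX)\subseteq F_{p+1}X$ for all $p$. Morphisms have degree $0$, preserve filtrations and commute with $d$. An $\mathbb{S}$-module is a functor from the groupoid of finite sets. A complete operad is an operad in complete graded objects. A complete gr-dg operad is a complete gr-dg $\mathbb{S}$-module with a complete operad structure for which $d$ is a derivation. For $\mu\in\mathcal{O}(1)$ of degree $k$ and $\nu\in\mathcal{O}(q)$, put $[\mu,\nu]=\mu\circ_1\nu-(-1)^{k|\nu|}\sum_{j=1}^q\nu\circ_j\mu$. A curved operad is a complete gr-dg operad $(\mathcal{O},d)$ with an element $\theta\in F_1\mathcal{O}(1)$ of degree $-2$ (a map $\mathbf 1\to F_1\mathcal{O}(1)_{-2}$)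 such that $d^2=[\theta,-]$ and $d(\theta)=0$. Its morphisms are the morphisms of operads which commute with $d$ and preserve $\theta$. Let $U$ be the forgetful functor from curved operads to complete gr-dg $\mathbb{S}$-modules. *Construction.* Let $\vartheta I$ be the $\mathbb{S}$-module spanned by a formal parameter $\vartheta$ of arity one, homological degree $-2$ and filtration degree $1$: it is $\mathbf 1$ in this arity and degree, with $F_0=F_1=\mathbf 1$ and $F_2=0$, and zero elsewhere. For a complete gr-dg $\mathbb{S}$-module $(M,d_M)$, let $\mathcal{T}(M\amalg\vartheta I)$ be the free complete operad on the complete graded $\mathbb{S}$-module $M\amalg\vartheta I$. Let $\tilde d_M$ be its derivation of degree $-1$ which extends $M\amalg\vartheta I\to M\xrightarrow{d_M}M\to\mathcal{T}(M\amalg\vartheta I)$. Let $(\mathrm{im}(d_M^2-[\vartheta,-]))$ be the operadic ideal generated by the image of $d_M^2-[\vartheta,-]:M\to\mathcal{T}(M\amalg\vartheta I)$. **Theorem.** For every complete gr-dg $\mathbb{S}$-module $(M,d_M)$, the free complete operad $\mathcal{T}(M\amalg\vartheta I)$ exists, there is exactly one derivation $\tilde d_M$ as above, and the quotient (taken in complete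 objects) $$\mathsf{c}\mathcal{T}(M,d_M)=\bigl(\mathcal{T}(M\amalg\vartheta I)/(\mathrm{im}(d_M^2-[\vartheta,-])),\ \bar d_M,\ \bar\vartheta\bigr)$$ exists and is a curved operad, where $\bar d_M$ is induced by $\tilde d_M$ and the curvature $\bar\vartheta$ is the class of $\vartheta$. This construction extends to a functor $\mathsf{c}\mathcal{T}$ from complete gr-dg $\mathbb{S}$-modules to curved operads which is left adjoint to $U$. The unit of the adjunction at $(M,d_M)$ is the canonical composite $\bar\jmath:M\to\mathcal{T}(M\amalg\vartheta I)\to\mathsf{c}\mathcal{T}(M,d_M)$. Thus $(\mathsf{c}\mathcal{T}(M,d_M),\bar\jmath)$ is the free curved operad on $(M,d_M)$: for every curved operad $\mathcal{O}$ and every morphism $f:M\to U\mathcal{O}$ of complete gr-dg $\mathbb{S}$-modules there is exactly one morphism $g:\mathsf{c}\mathcal{T}(M,d_M)\to\mathcal{O}$ of curved operads with $U(g)\circ\bar\jmath=f$. -/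

import Mathlib

open CategoryTheory CategoryTheory.Limits MonoidalCategory

universe w v u

noncomputable section

namespace FreeCurvedOperad

/-! ### Complete filtered graded objects -/

theorem factors_of_eq_top {A : Type u} [Category.{v} A] {V W : A} {P : Subobject W} (f : V ⟶ W) (hP : P = ⊤) :
    P.Factors f := by
  subst hP
  exact Subobject.top_factors f

section Objects

variable (A : Type u) [Category.{v} A] [Abelian A]

/-- A `ℤ`-graded object `X` of `A` with a decreasing `ℕ`-filtration `X = F 0 ⊇ F 1 ⊇ ⋯` by graded
subobjects (`F n p` is the degree `n` part of `F_p X`). -/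
structure FilteredGr where
  X : ℤ → A
  F : ∀ n : ℤ, ℕ → Subobject (X n)
  F_zero : ∀ n, F n 0 = ⊤
  anti : ∀ n, Antitone (F n)

variable {A}

/-- The tower of quotients `p ↦ coker (F_p X ⟶ X)`, in degree `n`. -/
def FilteredGr.tower (V : FilteredGr A) (n : ℤ) : ℕᵒᵖ ⥤ A where
  obj p := cokernel (V.F n p.unop).arrow
  map {p q} f := cokernel.desc _ (cokernel.π (V.F n q.unop).arrow) (by
    rw [← Subobject.ofLE_arrow (V.anti n (leOfHom f.unop)), Category.assoc, cokernel.condition,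
      comp_zero])
  map_id p := by
    apply coequalizer.hom_ext
    simp
  map_comp f g := by
    apply coequalizer.hom_ext
    simp

/-- The canonical cone from `X` to the tower of its quotients, in degree `n`. -/
def FilteredGr.towerCone (V : FilteredGr A) (n : ℤ) : Cone (V.tower n) where
  pt := V.X n
  π :=
    { app := fun p => cokernel.π (V.F n p.unop).arrow
      naturality := fun p q f => by simp [FilteredGr.tower] }

/-- `X ⟶ lim_p coker (F_p X ⟶ X)` is an isomorphism. -/
def FilteredGr.IsComplete (V : FilteredGr A) : Prop :=
  ∀ n, Nonempty (IsLimit (V.towerCone n))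

theorem factors_arrow_of_eq_bot {V W : A} (P : Subobject V) (Q : Subobject W) (hP : P = ⊥)
    (f : V ⟶ W) : Q.Factors (P.arrow ≫ f) := by
  subst hP
  rw [Subobject.bot_arrow, zero_comp]
  exact Subobject.factors_zero

/-- A filtration which vanishes from some stage on is complete. -/
theorem FilteredGr.isComplete_of_eq_bot (V : FilteredGr A) (N : ℕ)
    (h : ∀ n p, N ≤ p → V.F n p = ⊥) : V.IsComplete := by
  intro n
  have iso : ∀ p, N ≤ p → ∃ e : (V.tower n).obj (Opposite.op p) ⟶ (V.towerCone n).pt,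
      (V.towerCone n).π.app (Opposite.op p) ≫ e = 𝟙 _ ∧
        e ≫ (V.towerCone n).π.app (Opposite.op p) = 𝟙 _ := by
    intro p hp
    have h0 : (V.F n p).arrow = 0 := by
      rw [h n p hp]
      exact Subobject.bot_arrow
    refine ⟨cokernel.desc (V.F n p).arrow (𝟙 (V.X n)) ((Category.comp_id _).trans h0),
      cokernel.π_desc _ _ _, ?_⟩
    apply coequalizer.hom_ext
    exact (cokernel.π_desc_assoc _ _ _ _).trans
      ((Category.id_comp _).trans (Category.comp_id _).symm)
  obtain ⟨e, he, -⟩ := iso N le_rfl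
  refine ⟨{ lift := fun s => s.π.app (Opposite.op N) ≫ e, fac := ?_, uniq := ?_ }⟩
  · intro s p
    obtain ⟨f, -, hf⟩ := iso (max N p.unop) (le_max_left _ _)
    have hx : s.π.app (Opposite.op N) ≫ e = s.π.app (Opposite.op (max N p.unop)) ≫ f := by
      rw [← s.w (homOfLE (le_max_left N p.unop)).op, Category.assoc,
        ← Category.comp_id (s.π.app (Opposite.op (max N p.unop))), ← hf]
      simp only [Category.assoc]
      rw [← Category.assoc _ ((V.tower n).map _) e,
        (V.towerCone n).w (homOfLE (le_max_left N p.unop)).op, he, reassoc_of% hf]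
      exact congrArg (fun k => s.π.app _ ≫ k) (Category.comp_id f)
    rw [hx, ← (V.towerCone n).w (homOfLE (le_max_right N p.unop)).op, Category.assoc,
      reassoc_of% hf]
    exact s.w _
  · intro s m hm
    rw [← hm, Category.assoc, he]
    exact (Category.comp_id m).symm

variable (A)

/-- Complete filtered graded objects of `A`. -/
structure CompleteGr extends FilteredGr A where
  complete : toFilteredGr.IsComplete

variable {A}

/-- Morphisms of filtered graded objects: degree `0` maps which preserve the filtration. -/
@[ext]
structure CompleteGr.Hom (V W : CompleteGr A) where
  f : ∀ n, V.X n ⟶ W.X n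
  filt : ∀ n p, (W.F n p).Factors ((V.F n p).arrow ≫ f n)

instance : Category (CompleteGr A) where
  Hom := CompleteGr.Hom
  id V :=
    { f := fun n => 𝟙 _
      filt := fun n p => by
        rw [Category.comp_id]
        exact Subobject.factors_self _ }
  comp {U V W} g h :=
    { f := fun n => g.f n ≫ h.f n
      filt := fun n p => by
        obtain ⟨k, hk⟩ := (Subobject.factors_iff _ _).1 (g.filt n p)
        rw [← Category.assoc, ← Subobject.factorThru_arrow _ _ (g.filt n p), Category.assoc]
        exact Subobject.factors_of_factors_right _ (h.filt n p) }
  id_comp g := CompleteGr.Hom.ext (funext fun _ => Category.id_comp _)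
  comp_id g := CompleteGr.Hom.ext (funext fun _ => Category.comp_id _)
  assoc g h k := CompleteGr.Hom.ext (funext fun _ => Category.assoc _ _ _)

variable (A)

/-- Complete gr-dg objects of `A`: complete filtered graded objects with a predifferential `d` of
degree `-1` which preserves the filtration and whose square maps `F_p` into `F_{p+1}`.
The component of `d` from degree `n` to degree `m` is given for `m + 1 = n`. -/
structure CompleteGrDg extends CompleteGr A where
  d : ∀ n m : ℤ, m + 1 = n → (X n ⟶ X m)
  d_filt : ∀ n m h p, (F m p).Factors ((F n p).arrow ≫ d n m h)
  d_sq_filt : ∀ n m l h h' p, (F l (p + 1)).Factors ((F n p).arrow ≫ d n m h ≫ d m l h')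

variable {A}

/-- Morphisms of complete gr-dg objects: filtered maps which commute with the predifferentials. -/
@[ext]
structure CompleteGrDg.Hom (V W : CompleteGrDg A) where
  hom : V.toCompleteGr ⟶ W.toCompleteGr
  comm : ∀ n m h, hom.f n ≫ W.d n m h = V.d n m h ≫ hom.f m

instance : Category (CompleteGrDg A) where
  Hom := CompleteGrDg.Hom
  id V :=
    { hom := 𝟙 _
      comm := fun n m h => (Category.id_comp _).trans (Category.comp_id _).symm }
  comp {U V W} g k :=
    { hom := g.hom ≫ k.hom
      comm := fun n m h => by
        change (g.hom.f n ≫ k.hom.f n) ≫ W.d n m h = U.d n m h ≫ g.hom.f m ≫ k.hom.f m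
        rw [Category.assoc, k.comm, ← Category.assoc, g.comm, Category.assoc] }
  id_comp g := CompleteGrDg.Hom.ext (Category.id_comp _)
  comp_id g := CompleteGrDg.Hom.ext (Category.comp_id _)
  assoc g h k := CompleteGrDg.Hom.ext (Category.assoc _ _ _)

variable (A)

/-- The functor which forgets the predifferential. -/
def CompleteGrDg.forget : CompleteGrDg A ⥤ CompleteGr A where
  obj V := V.toCompleteGr
  map g := g.hom

end Objects

/-! ### Symmetric modules -/

/-- `𝕊`-modules in `C`: functors from the groupoid of finite sets (and bijections) to `C`. -/
abbrev SMod (C : Type u) [Category.{v} C] := Core FintypeCat.{0} ⥤ C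

/-- A finite set, as an object of the groupoid of finite sets. -/
abbrev fin (S : Type) [Finite S] : Core FintypeCat.{0} := ⟨FintypeCat.of S⟩

/-- A bijection, as a morphism of the groupoid of finite sets. -/
def bij {S T : Type} [Finite S] [Finite T] (e : S ≃ T) : fin S ⟶ fin T :=
  ⟨FintypeCat.equivEquivIso e⟩

section Modules

variable {A : Type u} [Category.{v} A] [Abelian A]

/-- `P(S)` in degree `n`. -/
abbrev ev (P : SMod (CompleteGr A)) (S : Type) [Finite S] (n : ℤ) : A := (P.obj (fin S)).X n

/-- `F_p P(S)` in degree `n`. -/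
abbrev fil (P : SMod (CompleteGr A)) (S : Type) [Finite S] (n : ℤ) (p : ℕ) :
    Subobject (ev P S n) :=
  (P.obj (fin S)).F n p

/-- The action `P(S) ⟶ P(T)` of a bijection `S ≃ T`, in degree `n`. -/
abbrev rel (P : SMod (CompleteGr A)) {S T : Type} [Finite S] [Finite T] (e : S ≃ T) (n : ℤ) :
    ev P S n ⟶ ev P T n :=
  (P.map (bij e)).f n

/-- The component of a morphism of `𝕊`-modules at the finite set `S`, in degree `n`. -/
abbrev at_ {P Q : SMod (CompleteGr A)} (f : P ⟶ Q) (S : Type) [Finite S] (n : ℤ) :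
    ev P S n ⟶ ev Q S n :=
  (f.app (fin S)).f n

/-- The underlying complete graded `𝕊`-module of a complete gr-dg `𝕊`-module. -/
abbrev gr (M : SMod (CompleteGrDg A)) : SMod (CompleteGr A) := M ⋙ CompleteGrDg.forget A

/-- The morphism of complete graded `𝕊`-modules underlying one of complete gr-dg `𝕊`-modules. -/
abbrev grMap {M N : SMod (CompleteGrDg A)} (f : M ⟶ N) : gr M ⟶ gr N :=
  Functor.whiskerRight f (CompleteGrDg.forget A)

/-- The predifferential of `M(S)`. -/
abbrev diff (M : SMod (CompleteGrDg A)) (S : Type) [Finite S] (n m : ℤ) (h : m + 1 = n) :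
    ev (gr M) S n ⟶ ev (gr M) S m :=
  (M.obj (fin S)).d n m h

end Modules

/-! ### The module of the formal parameter -/

section Vartheta

variable (A : Type u) [Category.{v} A] [Abelian A] [MonoidalCategory A]

/-- The unit object of `A` if `p` holds, and zero otherwise. -/
abbrev unitIf (p : Prop) : A := ∐ fun _ : PLift p => 𝟙_ A

/-- The identity of the unit object if `p` holds, and zero otherwise. -/
def unitIfMap {p q : Prop} (h : p → q) : unitIf A p ⟶ unitIf A q :=
  Sigma.desc fun j => Sigma.ι (fun _ : PLift q => 𝟙_ A) ⟨h j.down⟩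

theorem unitIfMap_id {p : Prop} (h : p → p) : unitIfMap A h = 𝟙 _ :=
  Sigma.hom_ext _ _ fun j => by simp [unitIfMap]

theorem unitIfMap_comp {p q r : Prop} (h : p → q) (k : q → r) :
    unitIfMap A (k ∘ h) = unitIfMap A h ≫ unitIfMap A k :=
  Sigma.hom_ext _ _ fun j => by simp [unitIfMap]

/-- The filtered graded object `ϑI(S)`: the unit object of `A` in degree `-2`, with filtration
`F_0 = F_1 ⊇ F_2 = 0`, if `S` has exactly one element, and zero otherwise. -/
def varthetaObj (S : FintypeCat.{0}) : FilteredGr A where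
  X n := unitIf A (n = -2 ∧ Nat.card S = 1)
  F _ p := if p ≤ 1 then ⊤ else ⊥
  F_zero _ := if_pos zero_le_one
  anti n p q hpq := by
    by_cases hq : q ≤ 1
    · simp [hq, hpq.trans hq]
    · simp [hq]

theorem varthetaCond {S T : Core FintypeCat.{0}} (e : S ⟶ T) (n : ℤ) :
    n = -2 ∧ Nat.card S.of = 1 → n = -2 ∧ Nat.card T.of = 1 :=
  And.imp_right fun h => (Nat.card_congr (FintypeCat.equivEquivIso.symm e.iso)).symm.trans h

/-- The complete graded `𝕊`-module `ϑI` spanned by a formal parameter `ϑ` of arity one, homological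
degree `-2` and filtration degree `1`. -/
def vartheta : SMod (CompleteGr A) where
  obj S :=
    { toFilteredGr := varthetaObj A S.of
      complete := FilteredGr.isComplete_of_eq_bot _ 2 fun n p hp =>
        if_neg (by omega) }
  map {S T} e :=
    { f := fun n => unitIfMap A (varthetaCond e n)
      filt := fun n p => by
        by_cases hp : p ≤ 1
        · exact factors_of_eq_top _ (if_pos hp)
        · exact factors_arrow_of_eq_bot _ _ (if_neg hp) _ }
  map_id _ := CompleteGr.Hom.ext (funext fun _ => unitIfMap_id A (varthetaCond (𝟙 _) _))
  map_comp f g := CompleteGr.Hom.ext (funext fun n =>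
    unitIfMap_comp A (varthetaCond f n) (varthetaCond g n))

/-- The generator `ϑ` of `ϑI`. -/
def varthetaGen : 𝟙_ A ⟶ ev (vartheta A) Unit (-2) :=
  Sigma.ι (fun _ : PLift ((-2 : ℤ) = -2 ∧ Nat.card (FintypeCat.of Unit) = 1) => 𝟙_ A)
    ⟨rfl, Nat.card_unique⟩

end Vartheta

/-! ### Operads -/

/-- `S ⊔ (T ⊔ {*}) ≃ (S ⊔ T) ⊔ {*}` -/
def optRight (S T : Type) : S ⊕ Option T ≃ Option (S ⊕ T) where
  toFun
    | .inl s => some (.inl s)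
    | .inr (some t) => some (.inr t)
    | .inr none => none
  invFun
    | some (.inl s) => .inl s
    | some (.inr t) => .inr (some t)
    | none => .inr none
  left_inv x := by rcases x with s | _ | t <;> rfl
  right_inv x := by rcases x with _ | s | t <;> rfl

/-- `(S ⊔ {*}) ⊔ T ≃ (S ⊔ T) ⊔ {*}` -/
def optLeft (S T : Type) : Option S ⊕ T ≃ Option (S ⊕ T) where
  toFun
    | .inl (some s) => some (.inl s)
    | .inl none => none
    | .inr t => some (.inr t)
  invFun
    | some (.inl s) => .inl (some s)
    | some (.inr t) => .inr t
    | none => .inl none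
  left_inv x := by rcases x with (_ | s) | t <;> rfl
  right_inv x := by rcases x with _ | s | t <;> rfl

/-- Exchange the two added points of `(S ⊔ {*}) ⊔ {*}`. -/
def optSwap (S : Type) : Option (Option S) ≃ Option (Option S) where
  toFun
    | none => some none
    | some none => none
    | some (some s) => some (some s)
  invFun
    | none => some none
    | some none => none
    | some (some s) => some (some s)
  left_inv x := by rcases x with _ | _ | s <;> rfl
  right_inv x := by rcases x with _ | _ | s <;> rfl

/-- `(S ⊔ U) ⊔ T ≃ (S ⊔ T) ⊔ U` -/
def sumSwap (S T U : Type) : (S ⊕ U) ⊕ T ≃ (S ⊕ T) ⊕ U :=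
  (Equiv.sumAssoc S U T).trans
    (((Equiv.refl S).sumCongr (Equiv.sumComm U T)).trans (Equiv.sumAssoc S T U).symm)

/-- `{*} ≃ ∅ ⊔ {*}` -/
def pointEquiv : Unit ≃ Option Empty :=
  ((Equiv.optionEquivSumPUnit Empty).trans (Equiv.emptySum Empty Unit)).symm

open scoped Classical in
/-- `S ≃ (S ∖ {s}) ⊔ {*}`, sending `s` to `*` -/
def pointOut (S : Type) (s : S) : S ≃ Option {t : S // t ≠ s} :=
  (Equiv.optionSubtypeNe s).symm

/-- `(S ∖ {s}) ⊔ {*} ≃ S`, sending `*` to `s` -/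
def pointIn (S : Type) (s : S) : {t : S // t ≠ s} ⊕ Unit ≃ S :=
  (Equiv.optionEquivSumPUnit _).symm.trans (pointOut S s).symm

section Operads

variable {A : Type u} [Category.{v} A] [Abelian A] [MonoidalCategory A] [SymmetricCategory A]

/-- The structure of a complete (graded) operad on a complete graded `𝕊`-module `P`, in terms of
partial compositions: `comp S T` is the composition `P(S ⊔ {*}) ⊗ P(T) ⟶ P(S ⊔ T)` which plugs
elements of `P(T)` into the input `*`, in degrees `p` and `q`. Since `P(S ⊔ T)` is complete, a
morphism to it from the completed tensor product of `P(S ⊔ {*})` and `P(T)` is a family of such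
maps sending `F_a ⊗ F_b` into `F_{a+b}`. The Koszul sign rule enters the axiom `comp_par`. -/
@[ext]
structure OperadStr (P : SMod (CompleteGr A)) where
  /-- the identity operation -/
  unit : 𝟙_ A ⟶ ev P Unit 0
  comp : ∀ (S T : Type) [Finite S] [Finite T] (p q r : ℤ), p + q = r →
    (ev P (Option S) p ⊗ ev P T q ⟶ ev P (S ⊕ T) r)
  comp_filt : ∀ (S T : Type) [Finite S] [Finite T] (p q r : ℤ) (h : p + q = r) (a b : ℕ),
    (fil P (S ⊕ T) r (a + b)).Factors
      (((fil P (Option S) p a).arrow ⊗ₘ (fil P T q b).arrow) ≫ comp S T p q r h)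
  /-- equivariance -/
  comp_equivariant : ∀ (S S' T T' : Type) [Finite S] [Finite S'] [Finite T] [Finite T']
    (e : S ≃ S') (e' : T ≃ T') (p q r : ℤ) (h : p + q = r),
    (rel P e.optionCongr p ⊗ₘ rel P e' q) ≫ comp S' T' p q r h =
      comp S T p q r h ≫ rel P (e.sumCongr e') r
  /-- `λ ∘ id = λ` -/
  comp_unit : ∀ (S : Type) [Finite S] (p : ℤ),
    (ρ_ _).inv ≫ (ev P (Option S) p ◁ unit) ≫ comp S Unit p 0 p (add_zero p) =
      rel P (Equiv.optionEquivSumPUnit S) p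
  /-- `id ∘ μ = μ` -/
  unit_comp : ∀ (T : Type) [Finite T] (q : ℤ),
    (λ_ _).inv ≫ ((unit ≫ rel P pointEquiv 0) ▷ ev P T q) ≫ comp Empty T 0 q q (zero_add q) ≫
      rel P (Equiv.emptySum Empty T) q = 𝟙 _
  /-- sequential composition: `(λ ∘ μ) ∘ ν = λ ∘ (μ ∘ ν)` -/
  comp_seq : ∀ (S T U : Type) [Finite S] [Finite T] [Finite U] (p q r pq qr s : ℤ)
    (h : p + q = pq) (h' : q + r = qr) (h₁ : pq + r = s) (h₂ : p + qr = s),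
    ((comp S (Option T) p q pq h ≫ rel P (optRight S T) pq) ▷ ev P U r) ≫
        comp (S ⊕ T) U pq r s h₁ =
      (α_ _ _ _).hom ≫ (ev P (Option S) p ◁ comp T U q r qr h') ≫ comp S (T ⊕ U) p qr s h₂ ≫
        rel P (Equiv.sumAssoc S T U).symm s
  /-- parallel composition: `(λ ∘₁ μ) ∘₂ ν = (-1) ^ (|μ| |ν|) (λ ∘₂ ν) ∘₁ μ` -/
  comp_par : ∀ (S T U : Type) [Finite S] [Finite T] [Finite U] (p q r pq pr s : ℤ)
    (h : p + q = pq) (h' : p + r = pr) (h₁ : pq + r = s) (h₂ : pr + q = s),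
    ((comp (Option S) T p q pq h ≫ rel P (optLeft S T) pq) ▷ ev P U r) ≫
        comp (S ⊕ T) U pq r s h₁ =
      (q * r).negOnePow • ((α_ _ _ _).hom ≫
        (ev P (Option (Option S)) p ◁ (β_ (ev P T q) (ev P U r)).hom) ≫ (α_ _ _ _).inv ≫
        ((rel P (optSwap S) p ▷ ev P U r ≫ comp (Option S) U p r pr h' ≫
          rel P (optLeft S U) pr) ▷ ev P T q) ≫
        comp (S ⊕ U) T pr q s h₂ ≫ rel P (sumSwap S T U) s)

/-- A morphism of `𝕊`-modules is compatible with the operad structures. -/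
structure IsOperadHom {P Q : SMod (CompleteGr A)} (oP : OperadStr P) (oQ : OperadStr Q)
    (f : P ⟶ Q) : Prop where
  unit : oP.unit ≫ at_ f Unit 0 = oQ.unit
  comp : ∀ (S T : Type) [Finite S] [Finite T] (p q r : ℤ) (h : p + q = r),
    oP.comp S T p q r h ≫ at_ f (S ⊕ T) r =
      (at_ f (Option S) p ⊗ₘ at_ f T q) ≫ oQ.comp S T p q r h

theorem IsOperadHom.id {P : SMod (CompleteGr A)} (o : OperadStr P) : IsOperadHom o o (𝟙 P) where
  unit := Category.comp_id _
  comp S T _ _ p q r h := by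
    change o.comp S T p q r h ≫ 𝟙 _ = (𝟙 _ ⊗ₘ 𝟙 _) ≫ _
    simp

theorem IsOperadHom.trans {P Q R : SMod (CompleteGr A)} {oP : OperadStr P} {oQ : OperadStr Q}
    {oR : OperadStr R} {f : P ⟶ Q} {g : Q ⟶ R} (hf : IsOperadHom oP oQ f)
    (hg : IsOperadHom oQ oR g) : IsOperadHom oP oR (f ≫ g) where
  unit := by
    change oP.unit ≫ at_ f Unit 0 ≫ at_ g Unit 0 = _
    rw [← Category.assoc, hf.unit, hg.unit]
  comp S T _ _ p q r h := by
    change oP.comp S T p q r h ≫ at_ f (S ⊕ T) r ≫ at_ g (S ⊕ T) r =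
      ((at_ f (Option S) p ≫ at_ g (Option S) p) ⊗ₘ (at_ f T q ≫ at_ g T q)) ≫ _
    rw [← Category.assoc, hf.comp, Category.assoc, hg.comp, ← Category.assoc,
      MonoidalCategory.tensorHom_comp_tensorHom]

variable (A) in
/-- Complete (graded) operads in `A`. -/
structure CompleteOperad where
  mod : SMod (CompleteGr A)
  str : OperadStr mod

/-- Morphisms of complete operads. -/
@[ext]
structure CompleteOperad.Hom (P Q : CompleteOperad A) where
  hom : P.mod ⟶ Q.mod
  isHom : IsOperadHom P.str Q.str hom

instance : Category (CompleteOperad A) where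
  Hom := CompleteOperad.Hom
  id _ := ⟨𝟙 _, IsOperadHom.id _⟩
  comp f g := ⟨f.hom ≫ g.hom, f.isHom.trans g.isHom⟩
  id_comp _ := CompleteOperad.Hom.ext (Category.id_comp _)
  comp_id _ := CompleteOperad.Hom.ext (Category.comp_id _)
  assoc _ _ _ := CompleteOperad.Hom.ext (Category.assoc _ _ _)

/-- Families of degree `-1` maps `P(S) ⟶ P(S)`. -/
abbrev DegNegOne (P : SMod (CompleteGr A)) :=
  ∀ (S : Type) [Finite S] (n m : ℤ), m + 1 = n → (ev P S n ⟶ ev P S m)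

/-- The Leibniz rule `d (λ ∘ μ) = dλ ∘ μ + (-1) ^ |λ| λ ∘ dμ`. -/
def Leibniz {P : SMod (CompleteGr A)} (o : OperadStr P) (d : DegNegOne P) : Prop :=
  ∀ (S T : Type) [Finite S] [Finite T] (p p' q q' r r' : ℤ) (hp : p' + 1 = p) (hq : q' + 1 = q)
    (hr : r' + 1 = r) (h : p + q = r) (h₁ : p' + q = r') (h₂ : p + q' = r'),
    o.comp S T p q r h ≫ d (S ⊕ T) r r' hr =
      (d (Option S) p p' hp ▷ ev P T q) ≫ o.comp S T p' q r' h₁ +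
        p.negOnePow • ((ev P (Option S) p ◁ d T q q' hq) ≫ o.comp S T p q' r' h₂)

/-- `d` is a derivation of degree `-1` of the complete operad `P`: a filtered equivariant map of
degree `-1` which satisfies the Leibniz rule. -/
structure IsDerivation (P : CompleteOperad A) (d : DegNegOne P.mod) : Prop where
  filt : ∀ (S : Type) [Finite S] (n m : ℤ) (h : m + 1 = n) (p : ℕ),
    (fil P.mod S m p).Factors ((fil P.mod S n p).arrow ≫ d S n m h)
  equivariant : ∀ (S T : Type) [Finite S] [Finite T] (e : S ≃ T) (n m : ℤ) (h : m + 1 = n),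
    rel P.mod e n ≫ d T n m h = d S n m h ≫ rel P.mod e m
  leibniz : Leibniz P.str d

/-- For `μ ∈ P({*})` of degree `k`, the endomorphism
`[μ, ν] = μ ∘ ν - (-1) ^ (|μ| |ν|) ∑_{s ∈ S} ν ∘_s μ` of `P(S)`, on elements `ν` of degree `n`. -/
def bracket {P : SMod (CompleteGr A)} (o : OperadStr P) (k : ℤ) (μ : 𝟙_ A ⟶ ev P Unit k)
    (S : Type) [Finite S] (n m : ℤ) (h : k + n = m) : ev P S n ⟶ ev P S m :=
  letI := Fintype.ofFinite S
  (λ_ _).inv ≫ ((μ ≫ rel P pointEquiv k) ▷ ev P S n) ≫ o.comp Empty S k n m h ≫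
      rel P (Equiv.emptySum Empty S) m -
    (k * n).negOnePow • ∑ s : S, (ρ_ _).inv ≫ (rel P (pointOut S s) n ⊗ₘ μ) ≫
      o.comp {t : S // t ≠ s} Unit n k m (by omega) ≫ rel P (pointIn S s) m

/-! ### Curved operads -/

variable (A) in
/-- Curved operads: a complete gr-dg operad (a complete gr-dg `𝕊`-module with the structure of a
complete operad for which the predifferential is a derivation), with a closed curvature `θ` of
degree `-2` in `F_1` such that `d² = [θ, -]`. -/
structure CurvedOperad where
  mod : SMod (CompleteGrDg A)
  str : OperadStr (gr mod)
  leibniz : Leibniz str (diff mod)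
  θ : 𝟙_ A ⟶ ev (gr mod) Unit (-2)
  θ_filt : (fil (gr mod) Unit (-2) 1).Factors θ
  θ_closed : θ ≫ diff mod Unit (-2) (-3) (by norm_num) = 0
  d_sq : ∀ (S : Type) [Finite S] (n m l : ℤ) (h : m + 1 = n) (h' : l + 1 = m),
    diff mod S n m h ≫ diff mod S m l h' = bracket str (-2) θ S n l (by omega)

/-- Morphisms of curved operads: morphisms of operads which commute with the predifferentials and
preserve the curvatures. -/
@[ext]
structure CurvedOperad.Hom (P Q : CurvedOperad A) where
  hom : P.mod ⟶ Q.mod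
  isHom : IsOperadHom P.str Q.str (grMap hom)
  map_θ : P.θ ≫ at_ (grMap hom) Unit (-2) = Q.θ

instance : Category (CurvedOperad A) where
  Hom := CurvedOperad.Hom
  id _ := ⟨𝟙 _, IsOperadHom.id _, Category.comp_id _⟩
  comp f g := ⟨f.hom ≫ g.hom, f.isHom.trans g.isHom, by
    change _ ≫ at_ (grMap f.hom) Unit (-2) ≫ at_ (grMap g.hom) Unit (-2) = _
    rw [← Category.assoc, f.map_θ, g.map_θ]⟩
  id_comp _ := CurvedOperad.Hom.ext (Category.id_comp _)
  comp_id _ := CurvedOperad.Hom.ext (Category.comp_id _)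
  assoc _ _ _ := CurvedOperad.Hom.ext (Category.assoc _ _ _)

variable (A) in
/-- The forgetful functor from curved operads to complete gr-dg `𝕊`-modules. -/
def CurvedOperad.forget : CurvedOperad A ⥤ SMod (CompleteGrDg A) where
  obj P := P.mod
  map f := f.hom

/-- The complete operad underlying a curved operad. -/
abbrev CurvedOperad.toOperad (P : CurvedOperad A) : CompleteOperad A := ⟨gr P.mod, P.str⟩

/-! ### Free operads, ideals and quotients -/

/-- `(T, j)` is the free complete operad on the complete graded `𝕊`-module `N`. -/
def IsFreeOperad {N : SMod (CompleteGr A)} (T : CompleteOperad A) (j : N ⟶ T.mod) : Prop :=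
  ∀ (O : CompleteOperad A) (f : N ⟶ O.mod), ∃! g : T ⟶ O, j ≫ g.hom = f

/-- Families of graded subobjects of the `P(S)`. -/
abbrev SubFamily (P : SMod (CompleteGr A)) :=
  ∀ (S : FintypeCat.{0}) (n : ℤ), Subobject (ev P S n)

/-- `J` is an operadic ideal: it is stable under bijections and a partial composition lies in `J`
as soon as one of its two arguments does. -/
structure IsIdeal (P : CompleteOperad A) (J : SubFamily P.mod) : Prop where
  rel : ∀ (S T : Type) [Finite S] [Finite T] (e : S ≃ T) (n : ℤ),
    (J (.of T) n).Factors ((J (.of S) n).arrow ≫ rel P.mod e n)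
  comp_left : ∀ (S T : Type) [Finite S] [Finite T] (p q r : ℤ) (h : p + q = r),
    (J (.of (S ⊕ T)) r).Factors
      (((J (.of (Option S)) p).arrow ▷ ev P.mod T q) ≫ P.str.comp S T p q r h)
  comp_right : ∀ (S T : Type) [Finite S] [Finite T] (p q r : ℤ) (h : p + q = r),
    (J (.of (S ⊕ T)) r).Factors
      ((ev P.mod (Option S) p ◁ (J (.of T) q).arrow) ≫ P.str.comp S T p q r h)

/-- The morphism of operads `π : P ⟶ Q` exhibits `Q` as the quotient of `P` by the ideal `J` (in
complete objects): `π` vanishes on `J`, and each `π(S)` is universal, among the morphisms from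
`P(S)` to complete filtered graded objects, with this property. -/
structure IsQuotient {P Q : CompleteOperad A} (J : SubFamily P.mod) (π : P ⟶ Q) : Prop where
  zero : ∀ (S : Type) [Finite S] (n : ℤ), (J (.of S) n).arrow ≫ at_ π.hom S n = 0
  universal : ∀ (S : Type) [Finite S] (W : CompleteGr A) (g : P.mod.obj (fin S) ⟶ W),
    (∀ n, (J (.of S) n).arrow ≫ g.f n = 0) →
      ∃! k : Q.mod.obj (fin S) ⟶ W, π.hom.app (fin S) ≫ k = g

/-! ### The free curved operad -/


/-- The component `M(S)_n ⟶ T(S)_{n-2}` of the map `d_M² - [ϑ, -]`, where `i : M ⟶ T` is a morphism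
from `M` to the complete operad `T`, and `ϑ ∈ T({*})` has degree `-2`. -/
def curvatureDefect (M : SMod (CompleteGrDg A)) (T : CompleteOperad A) (i : gr M ⟶ T.mod)
    (ϑ : 𝟙_ A ⟶ ev T.mod Unit (-2)) (S : Type) [Finite S] (n m l : ℤ) (h : m + 1 = n)
    (h' : l + 1 = m) : ev (gr M) S n ⟶ ev T.mod S l :=
  diff M S n m h ≫ diff M S m l h' ≫ at_ i S l -
    at_ i S n ≫ bracket T.str (-2) ϑ S n l (by omega)

/-- `J` is the operadic ideal of `T` generated by the image of `d_M² - [ϑ, -] : M ⟶ T`, that is the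
smallest ideal through which this map factors. -/
def IsCurvatureIdeal (M : SMod (CompleteGrDg A)) (T : CompleteOperad A) (i : gr M ⟶ T.mod)
    (ϑ : 𝟙_ A ⟶ ev T.mod Unit (-2)) (J : SubFamily T.mod) : Prop :=
  IsLeast {K : SubFamily T.mod | IsIdeal T K ∧
    ∀ (S : Type) [Finite S] (n m l : ℤ) (h : m + 1 = n) (h' : l + 1 = m),
      (K (.of S) l).Factors (curvatureDefect M T i ϑ S n m l h h')} J

/-- `d` extends the map `M ⨿ ϑI ⟶ M ⟶ M ⟶ T` given by the predifferential of `M`, where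
`i : M ⟶ T` and `k : ϑI ⟶ T` are the components of `M ⨿ ϑI ⟶ T`. -/
def ExtendsDiff (M : SMod (CompleteGrDg A)) (T : CompleteOperad A) (i : gr M ⟶ T.mod)
    (k : vartheta A ⟶ T.mod) (d : DegNegOne T.mod) : Prop :=
  ∀ (S : Type) [Finite S] (n m : ℤ) (h : m + 1 = n),
    at_ i S n ≫ d S n m h = diff M S n m h ≫ at_ i S m ∧ at_ k S n ≫ d S n m h = 0

/-- The curved operad `C`, with the morphism `u : M ⟶ C` of complete gr-dg `𝕊`-modules, is
`𝒯(M ⨿ ϑI) / (im (d_M² - [ϑ, -]))` with the predifferential induced by the unique derivation of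
`𝒯(M ⨿ ϑI)` extending `d_M`, with the class of `ϑ` as its curvature, and with the canonical map
`M ⟶ 𝒯(M ⨿ ϑI) ⟶ C`. -/
def IsFreeCurvedQuotient (M : SMod (CompleteGrDg A)) (C : CurvedOperad A)
    (u : M ⟶ (CurvedOperad.forget A).obj C) : Prop :=
  ∃ (N : SMod (CompleteGr A)) (inM : gr M ⟶ N) (inϑ : vartheta A ⟶ N) (T : CompleteOperad A)
    (j : N ⟶ T.mod) (d : DegNegOne T.mod) (J : SubFamily T.mod) (π : T ⟶ C.toOperad),
    Nonempty (IsColimit (BinaryCofan.mk inM inϑ)) ∧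
    IsFreeOperad T j ∧
    (IsDerivation T d ∧ ExtendsDiff M T (inM ≫ j) (inϑ ≫ j) d) ∧
    (∀ d', IsDerivation T d' → ExtendsDiff M T (inM ≫ j) (inϑ ≫ j) d' → ∀ (S : Type) [Finite S]
      (n m : ℤ) (h : m + 1 = n), d' S n m h = d S n m h) ∧
    IsCurvatureIdeal M T (inM ≫ j) (varthetaGen A ≫ at_ (inϑ ≫ j) Unit (-2)) J ∧
    IsQuotient J π ∧
    (∀ (S : Type) [Finite S] (n m : ℤ) (h : m + 1 = n),
      at_ π.hom S n ≫ diff C.mod S n m h = d S n m h ≫ at_ π.hom S m) ∧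
    (varthetaGen A ≫ at_ (inϑ ≫ j) Unit (-2)) ≫ at_ π.hom Unit (-2) = C.θ ∧
    grMap u = inM ≫ j ≫ π.hom

end Operads

end FreeCurvedOperad

end

open FreeCurvedOperad

set_option linter.unusedSectionVars false

namespace FreeCurvedOperad

noncomputable section

/-! ### Subobjects -/

section Subobjects

variable {A : Type u} [Category.{v} A] [Abelian A]

/-! Everything is computed with generalized elements `Z ⟶ X`. Membership in a subobject is the
vanishing of the composite with its cokernel, and equations may be tested after an epimorphism.
Since the tensor product is closed, tensoring is additive and preserves epimorphisms, so
compositions descend to quotients.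

The free complete operad on `N` is built without imposing relations by hand. The coproduct over all
formal compositions of generators carries the operations of an operad, but not the axioms. Every map
from `N` to a complete operad `O` evaluates formal compositions in `O`, and `F_a` is defined as the
intersection of the preimages of all the `F_a O`. Elements with equal evaluations differ by an
element of every `F_a`; hence the axioms hold modulo each `F_a`, and therefore in the completion
(`OperadFiltration.completionRaw_laws`). Evaluations are filtered by construction and extend to the
completion. Uniqueness follows by induction on terms, in the stronger form `freeOperad_eq_zero`,
which applies to any filtered family of maps whose vanishing propagates through the operations.

A derivation of degree `-1` of `T` is a section of `T ⊕ ε T ⟶ T`, where `ε` has degree one and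
square zero. So `d_M`, extended by zero on `ϑI`, extends to a derivation `d` of the free operad `T`.
Let `J` be the intersection of the ideals containing the defect `d_M² - [ϑ, -]`. Since `d ϑ = 0` and
`ϑ` has even degree, `d` commutes with `[ϑ, -]`; thus `J ∩ d⁻¹ J` is again an ideal containing the
defect, and `J` is stable under `d` (`IsCurvatureIdeal.derivation_factors`). The quotient by `J` is
the completion for the filtration `F_p + J`. There `d²` and `[ϑ, -]` are derivations which agree on
`M` by the definition of `J`, and on `ϑ` because `d ϑ = 0 = [ϑ, ϑ]`; so they agree
(`CurvedData.d_d_π`). As `ϑ` lies in `F_1`, the square of the induced predifferential raises the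
filtration.

Finally, a morphism `f : M ⟶ O` and the curvature of `O` define a map on `M ⨿ ϑI`, hence a morphism
of operads `T ⟶ O`. It commutes with the derivations, as can be checked on generators, and its
kernel is an ideal containing the defect because `d² = [θ, -]` in `O`. So it descends to the
quotient (`CurvedData.existsUnique_hom`), and universal morphisms from all `M` amount to a left
adjoint. -/

theorem factors_iff_comp_cokernel {X Z : A} (P : Subobject X) (x : Z ⟶ X) :
    P.Factors x ↔ x ≫ cokernel.π P.arrow = 0 := by
  refine ⟨fun h => ?_, fun h => ?_⟩
  · rw [← P.factorThru_arrow x h, Category.assoc, cokernel.condition, comp_zero]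
  · rw [← Abelian.monoLift_comp P.arrow x h]
    exact Subobject.factors_comp_arrow _

theorem factors_epi_comp_iff {X Y Z : A} (P : Subobject X) (e : Y ⟶ Z) [Epi e] (x : Z ⟶ X) :
    P.Factors (e ≫ x) ↔ P.Factors x := by
  rw [factors_iff_comp_cokernel, factors_iff_comp_cokernel, Category.assoc]
  exact ⟨fun h => zero_of_epi_comp e h, fun h => by rw [h, comp_zero]⟩

theorem factors_comp_of_factors {X Y Z : A} {P : Subobject X} {Q : Subobject Y} {f : X ⟶ Y}
    (hf : Q.Factors (P.arrow ≫ f)) {x : Z ⟶ X} (hx : P.Factors x) : Q.Factors (x ≫ f) := by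
  rw [← P.factorThru_arrow x hx, Category.assoc]
  exact Subobject.factors_of_factors_right _ hf

theorem factors_comp_left {X Y Z : A} {P : Subobject X} (e : Y ⟶ Z) {x : Z ⟶ X}
    (hx : P.Factors x) : P.Factors (e ≫ x) :=
  Subobject.factors_of_factors_right _ hx

theorem factors_neg {X Z : A} {P : Subobject X} {x : Z ⟶ X} (hx : P.Factors x) :
    P.Factors (-x) := by
  rw [factors_iff_comp_cokernel] at *
  rw [Preadditive.neg_comp, hx, neg_zero]

theorem factors_sub {X Z : A} {P : Subobject X} {x y : Z ⟶ X} (hx : P.Factors x)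
    (hy : P.Factors y) : P.Factors (x - y) := by
  rw [sub_eq_add_neg]
  exact Subobject.factors_add _ _ hx (factors_neg hy)

theorem factors_units_smul {X Z : A} {P : Subobject X} (k : ℤˣ) {x : Z ⟶ X} (hx : P.Factors x) :
    P.Factors (k • x) := by
  rcases Int.units_eq_one_or k with rfl | rfl
  · rwa [one_smul]
  · rw [Units.neg_smul, one_smul]
    exact factors_neg hx

theorem factors_sum {ι : Type*} (s : Finset ι) {X Z : A} {P : Subobject X} (x : ι → (Z ⟶ X))
    (hx : ∀ i ∈ s, P.Factors (x i)) : P.Factors (∑ i ∈ s, x i) := by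
  rw [factors_iff_comp_cokernel, Preadditive.sum_comp]
  exact Finset.sum_eq_zero fun i hi => (factors_iff_comp_cokernel _ _).1 (hx i hi)

/-- Turns "`f` maps `P` into `Q`" into an inequality, so that joins on the source side become a
matter of order. -/
theorem factors_arrow_comp_iff_le {X Y : A} (P : Subobject X) (Q : Subobject Y) (f : X ⟶ Y) :
    Q.Factors (P.arrow ≫ f) ↔ P ≤ (Subobject.pullback f).obj Q := by
  rw [← pullback_factors_iff]
  exact ⟨Subobject.le_of_factors, fun h => Subobject.factors_of_le _ h P.factors_self⟩

theorem arrow_comp_eq_zero_iff_le {X Y : A} (P : Subobject X) (f : X ⟶ Y) :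
    P.arrow ≫ f = 0 ↔ P ≤ kernelSubobject f := by
  rw [← kernelSubobject_factors_iff]
  exact ⟨Subobject.le_of_factors, fun h => Subobject.factors_of_le _ h P.factors_self⟩

theorem sup_arrow_comp_eq_zero {X Y : A} {P Q : Subobject X} {f : X ⟶ Y} (hP : P.arrow ≫ f = 0)
    (hQ : Q.arrow ≫ f = 0) : (P ⊔ Q).arrow ≫ f = 0 := by
  rw [arrow_comp_eq_zero_iff_le] at *
  exact sup_le hP hQ

/-- A morphism which vanishes in the quotient by `Q` lifts to `Q` after an epimorphism, and more
generally a morphism to the quotient by `P` which vanishes in the quotient by `Q ≥ P` comes,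
after an epimorphism, from `Q`. -/
theorem exists_epi_lift {X Z : A} {P Q : Subobject X} (h : P ≤ Q)
    (z : Z ⟶ cokernel P.arrow) (hz : z ≫ cokernel.desc P.arrow (cokernel.π Q.arrow)
      ((factors_iff_comp_cokernel _ _).1 (Subobject.factors_of_le _ h P.factors_self)) = 0) :
    ∃ (Z' : A) (e : Z' ⟶ Z) (x : Z' ⟶ X), Epi e ∧ Q.Factors x ∧
      x ≫ cokernel.π P.arrow = e ≫ z := by
  -- The cover is the pullback of the projection along `z`: epimorphisms of an abelian category are
  -- stable under pullback.
  refine ⟨pullback (cokernel.π P.arrow) z, pullback.snd _ _, pullback.fst _ _, inferInstance, ?_,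
    pullback.condition⟩
  rw [factors_iff_comp_cokernel, ← cokernel.π_desc P.arrow (cokernel.π Q.arrow)
    ((factors_iff_comp_cokernel _ _).1 (Subobject.factors_of_le _ h P.factors_self)),
    ← Category.assoc, pullback.condition, Category.assoc, hz, comp_zero]

variable (A) in
/-- Every set of subobjects has an intersection. -/
class HasSubobjectInter : Prop where
  exists_inter : ∀ {X : A} (s : Set (Subobject X)), ∃ I : Subobject X,
    ∀ {Z : A} (x : Z ⟶ X), I.Factors x ↔ ∀ P ∈ s, P.Factors x

theorem hasSubobjectInter [LocallySmall.{w} A] [HasLimitsOfSize.{w, w} A] [WellPowered.{w} A] :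
    HasSubobjectInter A where
  exists_inter {X} s := by
    have hI : IsGLB s (Subobject.sInf.{w} s) :=
      ⟨fun P hP => Subobject.sInf_le.{w} s P hP,
        fun P hP => Subobject.le_sInf.{w} s P fun Q hQ => hP hQ⟩
    refine ⟨Subobject.sInf.{w} s, fun {Z} x =>
      ⟨fun h P hP => Subobject.factors_of_le _ (hI.1 hP) h, fun h => ?_⟩⟩
    -- The infimum only compares subobjects, so `x` is replaced by its image; `x` is an epimorphism
    -- onto it and factors through `P` exactly when the image does.
    have : imageSubobject x ≤ Subobject.sInf.{w} s := hI.2 fun P hP => by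
      refine Subobject.le_of_factors ?_
      rw [← factors_epi_comp_iff _ (factorThruImageSubobject x), imageSubobject_arrow_comp]
      exact h P hP
    rw [← imageSubobject_arrow_comp x]
    exact factors_comp_left _ (Subobject.factors_of_le _ this (Subobject.factors_self _))

section Inter

variable [HasSubobjectInter A]

/-- The intersection of a set of subobjects. -/
def subobjectInter {X : A} (s : Set (Subobject X)) : Subobject X :=
  (HasSubobjectInter.exists_inter s).choose

theorem subobjectInter_factors_iff {X Z : A} (s : Set (Subobject X)) (x : Z ⟶ X) :
    (subobjectInter s).Factors x ↔ ∀ P ∈ s, P.Factors x :=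
  (HasSubobjectInter.exists_inter s).choose_spec x

end Inter

end Subobjects

/-! ### Closed symmetric monoidal abelian categories -/

section Monoidal

variable {A : Type u} [Category.{v} A] [Abelian A] [MonoidalCategory A] [SymmetricCategory A]
  [MonoidalClosed A]

/-- Closedness makes `X ⊗ -` a left adjoint. Because of this, covers chosen separately in each
factor may be tensored. -/
theorem whiskerLeft_epi (X : A) {Y Z : A} (f : Y ⟶ Z) [Epi f] : Epi (X ◁ f) :=
  inferInstanceAs (Epi ((tensorLeft X).map f))

theorem whiskerRight_eq_braiding (X : A) {Y Z : A} (f : Y ⟶ Z) :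
    f ▷ X = (β_ Y X).hom ≫ X ◁ f ≫ (β_ Z X).inv := by
  rw [← BraidedCategory.braiding_naturality_left_assoc, Iso.hom_inv_id, Category.comp_id]

theorem whiskerRight_epi (X : A) {Y Z : A} (f : Y ⟶ Z) [Epi f] : Epi (f ▷ X) := by
  rw [whiskerRight_eq_braiding]
  have := whiskerLeft_epi X f
  infer_instance

theorem tensorHom_epi {X Y Z W : A} (f : X ⟶ Y) (g : Z ⟶ W) [Epi f] [Epi g] : Epi (f ⊗ₘ g) := by
  rw [MonoidalCategory.tensorHom_def]
  have := whiskerRight_epi Z f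
  have := whiskerLeft_epi Y g
  infer_instance

theorem tensorLeft_additive (X : A) : (tensorLeft X).Additive :=
  have : PreservesColimits (tensorLeft X) := (ihom.adjunction X).leftAdjoint_preservesColimits
  have : PreservesBinaryBiproducts (tensorLeft X) :=
    preservesBinaryBiproducts_of_preservesBinaryCoproducts _
  Functor.additive_of_preservesBinaryBiproducts _

/-- Left tensoring preserves binary coproducts as a left adjoint, hence is additive; right tensoring
inherits this through the braiding. -/
instance : MonoidalPreadditive A where
  whiskerLeft_zero {X Y Z} := by
    have := tensorLeft_additive X
    exact (tensorLeft X).map_zero Y Z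
  whiskerLeft_add {X Y Z} f g := by
    have := tensorLeft_additive X
    exact (tensorLeft X).map_add
  zero_whiskerRight {X Y Z} := by
    have := tensorLeft_additive X
    rw [whiskerRight_eq_braiding, show X ◁ (0 : Y ⟶ Z) = 0 from (tensorLeft X).map_zero Y Z,
      zero_comp, comp_zero]
  add_whiskerRight {X Y Z} f g := by
    have := tensorLeft_additive X
    rw [whiskerRight_eq_braiding, whiskerRight_eq_braiding, whiskerRight_eq_braiding,
      show X ◁ (f + g) = X ◁ f + X ◁ g from (tensorLeft X).map_add, Preadditive.add_comp,
      Preadditive.comp_add]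

/-- Morphisms out of `Y ⊗ X`, as morphisms out of `Y`. -/
def curryLeft {X Y Z : A} (f : Y ⊗ X ⟶ Z) : Y ⟶ (ihom X).obj Z :=
  MonoidalClosed.curry ((β_ X Y).hom ≫ f)

theorem comp_curryLeft {W X Y Z : A} (g : W ⟶ Y) (f : Y ⊗ X ⟶ Z) :
    g ≫ curryLeft f = curryLeft (g ▷ X ≫ f) := by
  rw [curryLeft, curryLeft, ← MonoidalClosed.curry_natural_left,
    ← BraidedCategory.braiding_naturality_right_assoc]

theorem curryLeft_injective {X Y Z : A} {f g : Y ⊗ X ⟶ Z} (h : curryLeft f = curryLeft g) :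
    f = g :=
  (cancel_epi _).1 (MonoidalClosed.curry_injective h)

/-- Inverse of `curryLeft`. -/
def uncurryLeft {X Y Z : A} (f : Y ⟶ (ihom X).obj Z) : Y ⊗ X ⟶ Z :=
  (β_ X Y).inv ≫ MonoidalClosed.uncurry f

theorem curryLeft_uncurryLeft {X Y Z : A} (f : Y ⟶ (ihom X).obj Z) :
    curryLeft (uncurryLeft f) = f := by
  simp [curryLeft, uncurryLeft]

theorem curryLeft_eq_zero_iff {X Y Z : A} (f : Y ⊗ X ⟶ Z) : curryLeft f = 0 ↔ f = 0 := by
  have h0 : curryLeft (0 : Y ⊗ X ⟶ Z) = 0 := by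
    have := comp_curryLeft (0 : Y ⟶ Y) (0 : Y ⊗ X ⟶ Z)
    rw [zero_comp, comp_zero] at this
    exact this.symm
  exact ⟨fun h => curryLeft_injective (h.trans h0.symm), fun h => h ▸ h0⟩

/-- After currying, both hypotheses say that a subobject of `X` lies in the kernel of one map out of
`X`, and a kernel contains joins. The inclusions need not stay monomorphisms after tensoring with
`Y`. -/
theorem sup_arrow_whiskerRight_comp_eq_zero {X Y Z : A} {P Q : Subobject X} {f : X ⊗ Y ⟶ Z}
    (hP : P.arrow ▷ Y ≫ f = 0) (hQ : Q.arrow ▷ Y ≫ f = 0) : (P ⊔ Q).arrow ▷ Y ≫ f = 0 := by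
  rw [← curryLeft_eq_zero_iff, ← comp_curryLeft] at *
  exact sup_arrow_comp_eq_zero hP hQ

theorem sup_arrow_whiskerLeft_comp_eq_zero {X Y Z : A} {P Q : Subobject X} {f : Y ⊗ X ⟶ Z}
    (hP : Y ◁ P.arrow ≫ f = 0) (hQ : Y ◁ Q.arrow ≫ f = 0) : Y ◁ (P ⊔ Q).arrow ≫ f = 0 := by
  have key : ∀ R : Subobject X, Y ◁ R.arrow ≫ f = 0 ↔ R.arrow ▷ Y ≫ (β_ X Y).hom ≫ f = 0 :=
    fun R => by
      rw [BraidedCategory.braiding_naturality_left_assoc, ← cancel_epi (β_ (R : A) Y).hom,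
        comp_zero]
  rw [key] at *
  exact sup_arrow_whiskerRight_comp_eq_zero hP hQ

/-- A morphism out of `X ⊗ Y` descends to the tensor product of the quotients. -/
theorem exists_tensor_desc {X Y Z : A} (P : Subobject X) (Q : Subobject Y) (f : X ⊗ Y ⟶ Z)
    (hP : P.arrow ▷ Y ≫ f = 0) (hQ : X ◁ Q.arrow ≫ f = 0) :
    ∃ g : cokernel P.arrow ⊗ cokernel Q.arrow ⟶ Z,
      (cokernel.π P.arrow ⊗ₘ cokernel.π Q.arrow) ≫ g = f := by
  have h₁ : P.arrow ≫ curryLeft f = 0 := by rwa [comp_curryLeft, curryLeft_eq_zero_iff]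
  set f₁ : cokernel P.arrow ⊗ Y ⟶ Z := uncurryLeft (cokernel.desc _ _ h₁) with hf₁
  have e₁ : cokernel.π P.arrow ▷ Y ≫ f₁ = f := by
    apply curryLeft_injective
    rw [← comp_curryLeft, hf₁, curryLeft_uncurryLeft, cokernel.π_desc]
  have h₂ : Q.arrow ≫ MonoidalClosed.curry f₁ = 0 := by
    -- Vanishing on the quotient by `P` tensored with `Q` may be tested on the cover `X ⊗ Q`, where
    -- it is the hypothesis on `f`.
    have : cokernel P.arrow ◁ Q.arrow ≫ f₁ = 0 := by
      have := whiskerRight_epi (Q : A) (cokernel.π P.arrow)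
      rw [← cancel_epi (cokernel.π P.arrow ▷ (Q : A)), ← whisker_exchange_assoc, e₁, hQ, comp_zero]
    rw [← MonoidalClosed.curry_natural_left, this]
    apply MonoidalClosed.uncurry_injective
    rw [MonoidalClosed.uncurry_curry, MonoidalClosed.uncurry_eq,
      MonoidalPreadditive.whiskerLeft_zero,
      zero_comp]
  refine ⟨MonoidalClosed.uncurry (cokernel.desc _ _ h₂), ?_⟩
  rw [MonoidalCategory.tensorHom_def, Category.assoc, ← MonoidalClosed.uncurry_natural_left,
    cokernel.π_desc,
    MonoidalClosed.uncurry_curry, e₁]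

/-- A morphism out of a tensor product of coproducts is determined by its components. -/
theorem tensor_sigma_hom_ext {I J : Type} {X : I → A} {Y : J → A} [HasCoproduct X]
    [HasCoproduct Y] {Z : A} {f g : (∐ X) ⊗ (∐ Y) ⟶ Z}
    (h : ∀ i j, (Sigma.ι X i ⊗ₘ Sigma.ι Y j) ≫ f = (Sigma.ι X i ⊗ₘ Sigma.ι Y j) ≫ g) : f = g := by
  apply curryLeft_injective
  refine Sigma.hom_ext _ _ fun i => ?_
  rw [comp_curryLeft, comp_curryLeft]
  congr 1
  apply MonoidalClosed.curry_injective
  refine Sigma.hom_ext _ _ fun j => ?_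
  rw [← MonoidalClosed.curry_natural_left, ← MonoidalClosed.curry_natural_left]
  congr 1
  rw [← Category.assoc, ← Category.assoc, ← MonoidalCategory.tensorHom_def', h i j]

/-- A morphism out of a tensor product of coproducts, given by its components. -/
def tensorSigmaDesc {I J : Type} {X : I → A} {Y : J → A} [HasCoproduct X]
    [HasCoproduct Y] {Z : A} (f : ∀ i j, X i ⊗ Y j ⟶ Z) : (∐ X) ⊗ (∐ Y) ⟶ Z :=
  uncurryLeft (Sigma.desc fun i => curryLeft
    (MonoidalClosed.uncurry (Sigma.desc fun j => MonoidalClosed.curry (f i j))))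

theorem ι_tensorSigmaDesc {I J : Type} {X : I → A} {Y : J → A} [HasCoproduct X]
    [HasCoproduct Y] {Z : A} (f : ∀ i j, X i ⊗ Y j ⟶ Z) (i : I) (j : J) :
    (Sigma.ι X i ⊗ₘ Sigma.ι Y j) ≫ tensorSigmaDesc f = f i j := by
  have h₁ : Sigma.ι X i ▷ (∐ Y) ≫ tensorSigmaDesc f =
      MonoidalClosed.uncurry (Sigma.desc fun j => MonoidalClosed.curry (f i j)) := by
    apply curryLeft_injective
    rw [← comp_curryLeft, tensorSigmaDesc, curryLeft_uncurryLeft, Sigma.ι_desc]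
  rw [MonoidalCategory.tensorHom_def', Category.assoc, h₁, ← MonoidalClosed.uncurry_natural_left,
    Sigma.ι_desc,
    MonoidalClosed.uncurry_curry]

end Monoidal

/-! ### Completion of filtered graded objects -/

section Completion

variable {A : Type u} [Category.{v} A] [Abelian A]

namespace FilteredGr

variable (V : FilteredGr A)

/-- The quotient of `V` by the `p`-th step of its filtration, in degree `n`. -/
abbrev quot (n : ℤ) (p : ℕ) : A := cokernel (V.F n p).arrow

/-- The projection to the quotient by the `p`-th step of the filtration. -/
abbrev proj (n : ℤ) (p : ℕ) : V.X n ⟶ V.quot n p := cokernel.π (V.F n p).arrow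

/-- The transition morphisms between the quotients. -/
def trans (n : ℤ) {p p' : ℕ} (h : p ≤ p') : V.quot n p' ⟶ V.quot n p :=
  cokernel.desc _ (V.proj n p)
    ((factors_iff_comp_cokernel _ _).1
      (Subobject.factors_of_le _ (V.anti n h) (V.F n p').factors_self))

@[simp]
theorem proj_trans (n : ℤ) {p p' : ℕ} (h : p ≤ p') : V.proj n p' ≫ V.trans n h = V.proj n p :=
  cokernel.π_desc _ _ _

@[simp]
theorem proj_trans_assoc (n : ℤ) {p p' : ℕ} (h : p ≤ p') {Z : A} (z : V.quot n p ⟶ Z) :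
    V.proj n p' ≫ V.trans n h ≫ z = V.proj n p ≫ z := by rw [← Category.assoc, proj_trans]

theorem factors_iff {Z : A} (n : ℤ) (p : ℕ) (x : Z ⟶ V.X n) :
    (V.F n p).Factors x ↔ x ≫ V.proj n p = 0 :=
  factors_iff_comp_cokernel _ _

theorem tower_map (n : ℤ) {p p' : ℕ} (h : p ≤ p') :
    (V.tower n).map (homOfLE h).op = V.trans n h := by
  apply coequalizer.hom_ext
  exact (cokernel.π_desc _ _ _).trans (V.proj_trans n h).symm

/-- A compatible family of morphisms to the quotients. -/
def Compat {Z : A} (n : ℤ) (y : ∀ p, Z ⟶ V.quot n p) : Prop :=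
  ∀ p p' (h : p ≤ p'), y p' ≫ V.trans n h = y p

/-- The limit in terms of compatible families of generalized elements, the form in which
completeness is proved and used below. -/
theorem isComplete_iff : V.IsComplete ↔ ∀ (n : ℤ) (Z : A) (y : ∀ p, Z ⟶ V.quot n p),
    V.Compat n y → ∃! x : Z ⟶ V.X n, ∀ p, x ≫ V.proj n p = y p := by
  constructor
  · intro hV n Z y hy
    obtain ⟨hL⟩ := hV n
    let c : Cone (V.tower n) :=
      { pt := Z
        π :=
          { app := fun p => y p.unop
            naturality := fun p p' f => by
              have : (V.tower n).map f = V.trans n (leOfHom f.unop) := V.tower_map n _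
              rw [this]
              exact (Category.id_comp _).trans (hy _ _ _).symm } }
    refine ⟨hL.lift c, fun p => hL.fac c (Opposite.op p), fun x hx => ?_⟩
    exact hL.uniq c x fun p => hx p.unop
  · intro h n
    have hc : ∀ s : Cone (V.tower n), V.Compat n fun p => s.π.app (Opposite.op p) := by
      intro s p p' hp
      rw [← V.tower_map n hp]
      exact s.w _
    refine ⟨⟨fun s => (h n s.pt _ (hc s)).choose, fun s j => ?_, fun s m hm => ?_⟩⟩
    · exact (h n s.pt _ (hc s)).choose_spec.1 j.unop
    · exact (h n s.pt _ (hc s)).choose_spec.2 m fun p => hm (Opposite.op p)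

/-- Filtered maps of any degree. -/
def IsFiltered {V W : FilteredGr A} {n m : ℤ} (f : V.X n ⟶ W.X m) : Prop :=
  ∀ p, (W.F m p).Factors ((V.F n p).arrow ≫ f)

theorem IsFiltered.factors {V W : FilteredGr A} {n m : ℤ} {f : V.X n ⟶ W.X m}
    (hf : IsFiltered f) {Z : A} {x : Z ⟶ V.X n} {p : ℕ} (hx : (V.F n p).Factors x) :
    (W.F m p).Factors (x ≫ f) :=
  factors_comp_of_factors (hf p) hx

theorem IsFiltered.comp {V W U : FilteredGr A} {n m l : ℤ} {f : V.X n ⟶ W.X m}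
    {g : W.X m ⟶ U.X l} (hf : IsFiltered f) (hg : IsFiltered g) : IsFiltered (f ≫ g) := fun p => by
  rw [← Category.assoc]
  exact hg.factors (hf p)

theorem IsFiltered.sub {V W : FilteredGr A} {n m : ℤ} {f g : V.X n ⟶ W.X m}
    (hf : IsFiltered f) (hg : IsFiltered g) : IsFiltered (f - g) := fun p => by
  rw [Preadditive.comp_sub]
  exact factors_sub (hf p) (hg p)

theorem IsFiltered.add {V W : FilteredGr A} {n m : ℤ} {f g : V.X n ⟶ W.X m}
    (hf : IsFiltered f) (hg : IsFiltered g) : IsFiltered (f + g) := fun p => by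
  rw [Preadditive.comp_add]
  exact Subobject.factors_add _ _ (hf p) (hg p)

theorem isFiltered_zero {V W : FilteredGr A} {n m : ℤ} :
    IsFiltered (V := V) (W := W) (0 : V.X n ⟶ W.X m) := fun p => by
  rw [comp_zero]
  exact Subobject.factors_zero

theorem IsFiltered.exists_quot {V W : FilteredGr A} {n m : ℤ} {f : V.X n ⟶ W.X m}
    (hf : IsFiltered f) (p : ℕ) : ∃ g : V.quot n p ⟶ W.quot m p, V.proj n p ≫ g = f ≫ W.proj m p :=
  ⟨cokernel.desc _ (f ≫ W.proj m p) (by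
    rw [← Category.assoc, ← factors_iff]; exact hf p), cokernel.π_desc _ _ _⟩

end FilteredGr

namespace CompleteGr

open FilteredGr

theorem hom_ext (W : CompleteGr A) {n : ℤ} {Z : A} {x y : Z ⟶ W.X n}
    (h : ∀ p, x ≫ W.proj n p = y ≫ W.proj n p) : x = y :=
  ((W.isComplete_iff.1 W.complete n Z (fun p => y ≫ W.proj n p)
    fun p p' h => by rw [Category.assoc, proj_trans]).unique h fun _ => rfl)

/-- The morphism to a complete object given by a compatible family of morphisms to the quotients. -/
def lift (W : CompleteGr A) {n : ℤ} {Z : A} (y : ∀ p, Z ⟶ W.quot n p) (hy : W.Compat n y) :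
    Z ⟶ W.X n :=
  (W.isComplete_iff.1 W.complete n Z y hy).choose

@[simp]
theorem lift_proj (W : CompleteGr A) {n : ℤ} {Z : A} (y : ∀ p, Z ⟶ W.quot n p)
    (hy : W.Compat n y) (p : ℕ) : W.lift y hy ≫ W.proj n p = y p :=
  (W.isComplete_iff.1 W.complete n Z y hy).choose_spec.1 p

end CompleteGr

namespace FilteredGr

variable [HasLimitsOfShape ℕᵒᵖ A] (V : FilteredGr A)

/-- The completion, as a filtered graded object. -/
def lim : FilteredGr A where
  X n := limit (V.tower n)
  F n p := kernelSubobject (limit.π (V.tower n) (Opposite.op p))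
  F_zero n := by
    -- As `F_0` is everything, the tower is zero at stage zero, and the kernel of the projection to
    -- it is everything.
    have h0 : IsZero (V.quot n 0) := by
      have : V.proj n 0 = 0 := by
        rw [← Category.id_comp (V.proj n 0), ← factors_iff]
        exact factors_of_eq_top _ (V.F_zero n)
      exact IsZero.of_epi_eq_zero (V.proj n 0) this
    refine top_le_iff.1 (Subobject.le_of_factors ?_)
    rw [kernelSubobject_factors_iff]
    exact h0.eq_of_tgt _ _
  anti n p p' h := Subobject.le_of_factors (by
    rw [kernelSubobject_factors_iff, ← limit.w (V.tower n) (homOfLE h).op,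
      kernelSubobject_arrow_comp_assoc, zero_comp])

/-- The projection of the completion. -/
def limProj (n : ℤ) (p : ℕ) : V.lim.X n ⟶ V.quot n p := limit.π (V.tower n) (Opposite.op p)

@[simp]
theorem limProj_trans (n : ℤ) {p p' : ℕ} (h : p ≤ p') :
    V.limProj n p' ≫ V.trans n h = V.limProj n p := by
  rw [← V.tower_map n h]
  exact limit.w (V.tower n) (homOfLE h).op

@[simp]
theorem limProj_trans_assoc (n : ℤ) {p p' : ℕ} (h : p ≤ p') {Z : A} (z : V.quot n p ⟶ Z) :
    V.limProj n p' ≫ V.trans n h ≫ z = V.limProj n p ≫ z := by rw [← Category.assoc, limProj_trans]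

/-- The canonical morphism to the completion. -/
def toLim (n : ℤ) : V.X n ⟶ V.lim.X n := limit.lift (V.tower n) (V.towerCone n)

@[simp]
theorem toLim_limProj (n : ℤ) (p : ℕ) : V.toLim n ≫ V.limProj n p = V.proj n p :=
  limit.lift_π (V.towerCone n) (Opposite.op p)

@[simp]
theorem toLim_limProj_assoc (n : ℤ) (p : ℕ) {Z : A} (z : V.quot n p ⟶ Z) :
    V.toLim n ≫ V.limProj n p ≫ z = V.proj n p ≫ z := by rw [← Category.assoc, toLim_limProj]

/-- The projection from `V` is an epimorphism and factors through the completion; no exactness of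
the inverse limit is involved. -/
instance (n : ℤ) (p : ℕ) : Epi (V.limProj n p) :=
  epi_of_epi_fac (V.toLim_limProj n p)

theorem lim_hom_ext {n : ℤ} {Z : A} {x y : Z ⟶ V.lim.X n}
    (h : ∀ p, x ≫ V.limProj n p = y ≫ V.limProj n p) : x = y :=
  limit.hom_ext fun p => h p.unop

/-- The morphism to the completion given by a compatible family of morphisms to the quotients. -/
def limLift {n : ℤ} {Z : A} (y : ∀ p, Z ⟶ V.quot n p) (hy : V.Compat n y) :
    Z ⟶ V.lim.X n :=
  limit.lift (V.tower n)
    { pt := Z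
      π :=
        { app := fun p => y p.unop
          naturality := fun p p' f => by
            have : (V.tower n).map f = V.trans n (leOfHom f.unop) := V.tower_map n _
            rw [this]
            exact (Category.id_comp _).trans (hy _ _ _).symm } }

@[simp]
theorem limLift_limProj {n : ℤ} {Z : A} (y : ∀ p, Z ⟶ V.quot n p) (hy : V.Compat n y) (p : ℕ) :
    V.limLift y hy ≫ V.limProj n p = y p :=
  limit.lift_π _ (Opposite.op p)

theorem lim_factors_iff {n : ℤ} {p : ℕ} {Z : A} (x : Z ⟶ V.lim.X n) :
    (V.lim.F n p).Factors x ↔ x ≫ V.limProj n p = 0 :=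
  kernelSubobject_factors_iff _ _

/-- `F_p` of the completion is the kernel of the projection to the `p`-th quotient of `V`, so the
`p`-th quotient of the completion embeds in that of `V` by `k p`. A compatible family thus becomes
one for `V`, which the limit lifts, and monicity of `k p` brings the equations back. -/
theorem lim_isComplete : V.lim.IsComplete := by
  rw [isComplete_iff]
  intro n Z y hy
  let k : ∀ p, V.lim.quot n p ⟶ V.quot n p := fun p =>
    cokernel.desc _ (V.limProj n p) ((V.lim_factors_iff _).1 (Subobject.factors_self _))
  have hk : ∀ p, V.lim.proj n p ≫ k p = V.limProj n p := fun p => cokernel.π_desc _ _ _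
  have hmono : ∀ p, Mono (k p) := by
    intro p
    refine Preadditive.mono_of_cancel_zero _ fun {Y} z hz => ?_
    -- An element of the quotient killed by `k p` lifts, after a cover, to an element of the
    -- completion lying in `F_p`.
    have h1 := (pullback.condition (f := V.lim.proj n p) (g := z))
    have h2 : pullback.fst (V.lim.proj n p) z ≫ V.lim.proj n p = 0 := by
      rw [← factors_iff]
      refine (V.lim_factors_iff _).2 ?_
      rw [← hk, pullback.condition_assoc, hz, comp_zero]
    rw [h1] at h2
    exact zero_of_epi_comp _ h2
  have hkt : ∀ p p' (h : p ≤ p'), k p' ≫ V.trans n h = V.lim.trans n h ≫ k p := by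
    intro p p' h
    rw [← cancel_epi (V.lim.proj n p'), ← Category.assoc, hk, proj_trans_assoc, hk, limProj_trans]
  have hc : V.Compat n fun p => y p ≫ k p := by
    intro p p' h
    change (y p' ≫ k p') ≫ _ = _
    rw [Category.assoc, hkt, ← Category.assoc, hy p p' h]
  refine ⟨V.limLift _ hc, fun p => ?_, fun x hx => ?_⟩
  · rw [← cancel_mono (k p), Category.assoc, hk]
    exact V.limLift_limProj _ hc p
  · refine V.lim_hom_ext fun p => ?_
    rw [limLift_limProj, ← hk, ← Category.assoc, hx]

/-- The completion of a filtered graded object. -/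
abbrev completion : CompleteGr A where
  toFilteredGr := V.lim
  complete := V.lim_isComplete

theorem toLim_isFiltered (n : ℤ) :
    IsFiltered (V := V) (W := V.completion.toFilteredGr) (V.toLim n) := fun p => by
  refine (V.lim_factors_iff _).2 ?_
  rw [Category.assoc, toLim_limProj, cokernel.condition]

variable {V}

/-- Filtered maps out of a completion are determined by their restrictions. -/
theorem completion_hom_ext {W : CompleteGr A} {n m : ℤ} {f g : V.completion.X n ⟶ W.X m}
    (hf : IsFiltered (V := V.completion.toFilteredGr) (W := W.toFilteredGr) f)
    (hg : IsFiltered (V := V.completion.toFilteredGr) (W := W.toFilteredGr) g)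
    (h : V.toLim n ≫ f = V.toLim n ≫ g) : f = g := by
  refine W.hom_ext fun p => ?_
  -- `F_p` of the completion is the kernel of the epimorphism `limProj`, so a filtered map followed
  -- by the `p`-th projection factors through the `p`-th quotient of `V`. There the values on `V`
  -- decide.
  have key : ∀ k : V.completion.X n ⟶ W.X m,
      IsFiltered (V := V.completion.toFilteredGr) (W := W.toFilteredGr) k →
      ∃ k', k ≫ W.proj m p = V.limProj n p ≫ k' := by
    intro k hk
    refine ⟨Abelian.epiDesc (V.limProj n p) (k ≫ W.proj m p) ?_, (Abelian.comp_epiDesc _ _ _).symm⟩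
    rw [← Category.assoc, ← factors_iff]
    exact hk.factors ((V.lim_factors_iff _).2 (kernel.condition _))
  obtain ⟨f', hf'⟩ := key f hf
  obtain ⟨g', hg'⟩ := key g hg
  have : f' = g' := by
    rw [← cancel_epi (V.proj n p), ← toLim_limProj, Category.assoc, Category.assoc, ← hf', ← hg',
      reassoc_of% h]
  rw [hf', hg', this]

/-- The extension of a filtered map to the completion. -/
def completionExt {W : CompleteGr A} {n m : ℤ} (f : V.X n ⟶ W.X m)
    (hf : IsFiltered (V := V) (W := W.toFilteredGr) f) : V.completion.X n ⟶ W.X m :=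
  W.lift (fun p => V.limProj n p ≫ (hf.exists_quot p).choose) fun p p' h => by
    rw [Category.assoc]
    have : (hf.exists_quot p').choose ≫ W.trans m h = V.trans n h ≫ (hf.exists_quot p).choose := by
      rw [← cancel_epi (V.proj n p'), ← Category.assoc, (hf.exists_quot p').choose_spec,
        Category.assoc, proj_trans, proj_trans_assoc, (hf.exists_quot p).choose_spec]
    rw [this, limProj_trans_assoc]

theorem completionExt_proj {W : CompleteGr A} {n m : ℤ} (f : V.X n ⟶ W.X m)
    (hf : IsFiltered (V := V) (W := W.toFilteredGr) f) (p : ℕ) :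
    completionExt f hf ≫ W.proj m p = V.limProj n p ≫ (hf.exists_quot p).choose :=
  W.lift_proj _ _ p

@[simp]
theorem toLim_completionExt {W : CompleteGr A} {n m : ℤ} (f : V.X n ⟶ W.X m)
    (hf : IsFiltered (V := V) (W := W.toFilteredGr) f) : V.toLim n ≫ completionExt f hf = f := by
  refine W.hom_ext fun p => ?_
  rw [Category.assoc, completionExt_proj, toLim_limProj_assoc, (hf.exists_quot p).choose_spec]

theorem completionExt_isFiltered {W : CompleteGr A} {n m : ℤ} (f : V.X n ⟶ W.X m)
    (hf : IsFiltered (V := V) (W := W.toFilteredGr) f) :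
    IsFiltered (V := V.completion.toFilteredGr) (W := W.toFilteredGr) (completionExt f hf) :=
  fun p => by
    rw [factors_iff, Category.assoc, completionExt_proj, ← Category.assoc]
    have : (V.completion.F n p).arrow ≫ V.limProj n p = 0 :=
      (V.lim_factors_iff _).1 (Subobject.factors_self _)
    rw [this, zero_comp]

end FilteredGr

end Completion

/-! ### Products and shifts -/

section Products

variable {A : Type u} [Category.{v} A] [Abelian A]

open FilteredGr

/-- The biproduct of two filtered graded objects. -/
def FilteredGr.prod (V W : FilteredGr A) : FilteredGr A where
  X n := V.X n ⊞ W.X n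
  F n p := (Subobject.pullback biprod.fst).obj (V.F n p) ⊓
    (Subobject.pullback biprod.snd).obj (W.F n p)
  F_zero n := by rw [V.F_zero, W.F_zero, Subobject.pullback_top, Subobject.pullback_top, inf_top_eq]
  anti n p p' h := inf_le_inf ((Subobject.pullback _).monotone (V.anti n h))
    ((Subobject.pullback _).monotone (W.anti n h))

namespace FilteredGr

variable {V W : FilteredGr A}

/-- The first projection. -/
def fst (V W : FilteredGr A) (n : ℤ) : (V.prod W).X n ⟶ V.X n := biprod.fst

/-- The second projection. -/
def snd (V W : FilteredGr A) (n : ℤ) : (V.prod W).X n ⟶ W.X n := biprod.snd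

/-- The morphism to the product with given components. -/
def pair {n : ℤ} {Z : A} (x : Z ⟶ V.X n) (y : Z ⟶ W.X n) : Z ⟶ (V.prod W).X n := biprod.lift x y

@[simp]
theorem pair_fst {n : ℤ} {Z : A} (x : Z ⟶ V.X n) (y : Z ⟶ W.X n) : pair x y ≫ fst V W n = x :=
  biprod.lift_fst _ _

@[simp]
theorem pair_fst_assoc {n : ℤ} {Z Z' : A} (x : Z ⟶ V.X n) (y : Z ⟶ W.X n) (z : V.X n ⟶ Z') :
    pair x y ≫ fst V W n ≫ z = x ≫ z := by rw [← Category.assoc, pair_fst]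

@[simp]
theorem pair_snd {n : ℤ} {Z : A} (x : Z ⟶ V.X n) (y : Z ⟶ W.X n) : pair x y ≫ snd V W n = y :=
  biprod.lift_snd _ _

@[simp]
theorem pair_snd_assoc {n : ℤ} {Z Z' : A} (x : Z ⟶ V.X n) (y : Z ⟶ W.X n) (z : W.X n ⟶ Z') :
    pair x y ≫ snd V W n ≫ z = y ≫ z := by rw [← Category.assoc, pair_snd]

theorem prod_hom_ext {n : ℤ} {Z : A} {x y : Z ⟶ (V.prod W).X n}
    (h₁ : x ≫ fst V W n = y ≫ fst V W n) (h₂ : x ≫ snd V W n = y ≫ snd V W n) : x = y :=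
  biprod.hom_ext _ _ h₁ h₂

theorem prod_hom_ext' {n : ℤ} {Z : A} {x y : (V.prod W).X n ⟶ Z}
    (h₁ : pair (𝟙 (V.X n)) (0 : _ ⟶ W.X n) ≫ x = pair (𝟙 _) 0 ≫ y)
    (h₂ : pair (0 : _ ⟶ V.X n) (𝟙 (W.X n)) ≫ x = pair 0 (𝟙 _) ≫ y) : x = y := by
  refine biprod.hom_ext' _ _ ?_ ?_
  · have e : biprod.inl = pair (𝟙 (V.X n)) (0 : _ ⟶ W.X n) :=
      prod_hom_ext (biprod.inl_fst.trans (pair_fst _ _).symm)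
        (biprod.inl_snd.trans (pair_snd _ _).symm)
    exact e ▸ h₁
  · have e : biprod.inr = pair (0 : _ ⟶ V.X n) (𝟙 (W.X n)) :=
      prod_hom_ext (biprod.inr_fst.trans (pair_fst _ _).symm)
        (biprod.inr_snd.trans (pair_snd _ _).symm)
    exact e ▸ h₂

theorem prod_factors_iff {n : ℤ} {p : ℕ} {Z : A}
    (x : Z ⟶ (V.prod W).X n) : ((V.prod W).F n p).Factors x ↔
      (V.F n p).Factors (x ≫ fst V W n) ∧ (W.F n p).Factors (x ≫ snd V W n) := by
  rw [← pullback_factors_iff, ← pullback_factors_iff, ← Subobject.inf_factors]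
  rfl

theorem fst_isFiltered (n : ℤ) : IsFiltered (V := V.prod W) (W := V) (fst V W n) := fun _ =>
  ((prod_factors_iff _).1 (Subobject.factors_self _)).1

theorem snd_isFiltered (n : ℤ) : IsFiltered (V := V.prod W) (W := W) (snd V W n) := fun _ =>
  ((prod_factors_iff _).1 (Subobject.factors_self _)).2

end FilteredGr

theorem FilteredGr.IsFiltered.quot_trans {U V : FilteredGr A} {n : ℤ} {f : U.X n ⟶ V.X n}
    {k : ∀ p, U.quot n p ⟶ V.quot n p} (hk : ∀ p, U.proj n p ≫ k p = f ≫ V.proj n p)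
    {p p' : ℕ} (h : p ≤ p') : k p' ≫ V.trans n h = U.trans n h ≫ k p := by
  rw [← cancel_epi (U.proj n p'), ← Category.assoc, hk, Category.assoc, proj_trans,
    proj_trans_assoc, hk]

/-- An element of the product lies in `F_p` exactly when both components do, so the maps `k1 p` and
`k2 p` to the quotients of the factors are jointly monic. Existence and uniqueness of lifts are then
componentwise. -/
theorem FilteredGr.prod_isComplete (V W : CompleteGr A) :
    (V.toFilteredGr.prod W.toFilteredGr).IsComplete := by
  rw [isComplete_iff]
  intro n Z y hy
  choose k1 hk1 using (fst_isFiltered (V := V.toFilteredGr) (W := W.toFilteredGr) n).exists_quot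
  choose k2 hk2 using (snd_isFiltered (V := V.toFilteredGr) (W := W.toFilteredGr) n).exists_quot
  have ext : ∀ p {Y : A} (z z' : Y ⟶ (V.toFilteredGr.prod W.toFilteredGr).quot n p),
      z ≫ k1 p = z' ≫ k1 p → z ≫ k2 p = z' ≫ k2 p →
      z = z' := by
    intro p Y z z' e1 e2
    rw [← sub_eq_zero]
    have e1' : (z - z') ≫ k1 p = 0 := by rw [Preadditive.sub_comp, e1, sub_self]
    have e2' : (z - z') ≫ k2 p = 0 := by rw [Preadditive.sub_comp, e2, sub_self]
    generalize z - z' = t at e1' e2'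
    have h3 := (pullback.condition (f := (V.toFilteredGr.prod W.toFilteredGr).proj n p) (g := t))
    have h4 : pullback.fst ((V.toFilteredGr.prod W.toFilteredGr).proj n p) t ≫
        (V.toFilteredGr.prod W.toFilteredGr).proj n p = 0 := by
      rw [← factors_iff]
      refine (prod_factors_iff _).2 ⟨?_, ?_⟩
      · rw [factors_iff, Category.assoc, ← hk1, pullback.condition_assoc, e1', comp_zero]
      · rw [factors_iff, Category.assoc, ← hk2, pullback.condition_assoc, e2', comp_zero]
    rw [h3] at h4
    exact zero_of_epi_comp _ h4
  have c1 : V.Compat n fun p => y p ≫ k1 p := by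
    intro p p' h
    change (y p' ≫ k1 p') ≫ _ = _
    rw [Category.assoc, IsFiltered.quot_trans hk1, ← Category.assoc, hy p p' h]
  have c2 : W.Compat n fun p => y p ≫ k2 p := by
    intro p p' h
    change (y p' ≫ k2 p') ≫ _ = _
    rw [Category.assoc, IsFiltered.quot_trans hk2, ← Category.assoc, hy p p' h]
  refine ⟨pair (V.lift _ c1) (W.lift _ c2), fun p => ext p _ _ ?_ ?_, fun x hx => ?_⟩
  · rw [Category.assoc, hk1, pair_fst_assoc]
    exact V.lift_proj _ c1 p
  · rw [Category.assoc, hk2, pair_snd_assoc]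
    exact W.lift_proj _ c2 p
  · refine prod_hom_ext (V.hom_ext fun p => ?_) (W.hom_ext fun p => ?_)
    · rw [pair_fst, CompleteGr.lift_proj, ← hx, Category.assoc, Category.assoc, hk1]
    · rw [pair_snd, CompleteGr.lift_proj, ← hx, Category.assoc, Category.assoc, hk2]

/-- The biproduct of two complete graded objects. -/
abbrev CompleteGr.prod (V W : CompleteGr A) : CompleteGr A where
  toFilteredGr := V.toFilteredGr.prod W.toFilteredGr
  complete := prod_isComplete V W

/-- The shift of a complete graded object, which is `V.X (n - 1)` in degree `n`. -/
abbrev CompleteGr.shift (V : CompleteGr A) : CompleteGr A where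
  X n := V.X (n - 1)
  F n p := V.F (n - 1) p
  F_zero n := V.F_zero (n - 1)
  anti n := V.anti (n - 1)
  complete n := V.complete (n - 1)

end Products

/-! ### Operadic data without axioms -/

section Raw

/-- A family of objects with the operations of a graded operad, without any axiom. -/
structure Raw (A : Type u) [Category.{v} A] [MonoidalCategory A] where
  X : ∀ (S : Type) [Finite S], ℤ → A
  rel : ∀ {S T : Type} [Finite S] [Finite T] (_ : S ≃ T) (n : ℤ), X S n ⟶ X T n
  unit : 𝟙_ A ⟶ X Unit 0
  comp : ∀ (S T : Type) [Finite S] [Finite T] (p q r : ℤ), p + q = r →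
    (X (Option S) p ⊗ X T q ⟶ X (S ⊕ T) r)

variable {A : Type u} [Category.{v} A] [MonoidalCategory A]

namespace Raw

/-- The composition of two generalized elements. -/
def mul (P : Raw A) {S T : Type} [Finite S] [Finite T] {p q r : ℤ} {Z Z' : A}
    (x : Z ⟶ P.X (Option S) p) (y : Z' ⟶ P.X T q) (h : p + q = r) : Z ⊗ Z' ⟶ P.X (S ⊕ T) r :=
  (x ⊗ₘ y) ≫ P.comp S T p q r h

theorem tensor_mul (P : Raw A) {S T : Type} [Finite S] [Finite T] {p q r : ℤ} {Y Y' Z Z' : A}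
    (a : Y ⟶ Z) (b : Y' ⟶ Z') (x : Z ⟶ P.X (Option S) p) (y : Z' ⟶ P.X T q) (h : p + q = r) :
    (a ⊗ₘ b) ≫ P.mul x y h = P.mul (a ≫ x) (b ≫ y) h := by
  rw [mul, mul, ← Category.assoc, MonoidalCategory.tensorHom_comp_tensorHom]

theorem tensor_mul_assoc (P : Raw A) {S T : Type} [Finite S] [Finite T] {p q r : ℤ}
    {Y Y' Z Z' W : A} (a : Y ⟶ Z) (b : Y' ⟶ Z') (x : Z ⟶ P.X (Option S) p) (y : Z' ⟶ P.X T q)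
    (h : p + q = r) (w : P.X (S ⊕ T) r ⟶ W) :
    (a ⊗ₘ b) ≫ P.mul x y h ≫ w = P.mul (a ≫ x) (b ≫ y) h ≫ w := by
  rw [← Category.assoc, tensor_mul]

theorem mul_eq (P : Raw A) {S T : Type} [Finite S] [Finite T] {p q r : ℤ} {Z Z' : A}
    (x : Z ⟶ P.X (Option S) p) (y : Z' ⟶ P.X T q) (h : p + q = r) :
    P.mul x y h = (x ⊗ₘ y) ≫ P.mul (𝟙 _) (𝟙 _) h := by
  rw [tensor_mul, Category.comp_id, Category.comp_id]

theorem whiskerRight_mul (P : Raw A) {S T : Type} [Finite S] [Finite T] {p q r : ℤ} {Y Z Z' : A}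
    (a : Y ⟶ Z) (x : Z ⟶ P.X (Option S) p) (y : Z' ⟶ P.X T q) (h : p + q = r) :
    a ▷ Z' ≫ P.mul x y h = P.mul (a ≫ x) y h := by
  rw [← tensorHom_id, tensor_mul, Category.id_comp]

theorem whiskerLeft_mul (P : Raw A) {S T : Type} [Finite S] [Finite T] {p q r : ℤ} {Y Z Z' : A}
    (a : Y ⟶ Z) (x : Z' ⟶ P.X (Option S) p) (y : Z ⟶ P.X T q) (h : p + q = r) :
    Z' ◁ a ≫ P.mul x y h = P.mul x (a ≫ y) h := by
  rw [← id_tensorHom, tensor_mul, Category.id_comp]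

end Raw

/-- Morphisms of operadic data. -/
structure RawHom (P Q : Raw A) where
  f : ∀ (S : Type) [Finite S] (n : ℤ), P.X S n ⟶ Q.X S n
  rel : ∀ {S T : Type} [Finite S] [Finite T] (e : S ≃ T) (n : ℤ),
    P.rel e n ≫ f T n = f S n ≫ Q.rel e n
  unit : P.unit ≫ f Unit 0 = Q.unit
  comp : ∀ (S T : Type) [Finite S] [Finite T] (p q r : ℤ) (h : p + q = r),
    P.comp S T p q r h ≫ f (S ⊕ T) r = (f (Option S) p ⊗ₘ f T q) ≫ Q.comp S T p q r h

namespace RawHom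

variable {P Q : Raw A} (f : RawHom P Q)

theorem mul {S T : Type} [Finite S] [Finite T] {p q r : ℤ} {Z Z' : A}
    (x : Z ⟶ P.X (Option S) p) (y : Z' ⟶ P.X T q) (h : p + q = r) :
    P.mul x y h ≫ f.f (S ⊕ T) r = Q.mul (x ≫ f.f (Option S) p) (y ≫ f.f T q) h := by
  rw [Raw.mul, Raw.mul, Category.assoc, f.comp, ← Category.assoc,
    MonoidalCategory.tensorHom_comp_tensorHom]

theorem mul_assoc {S T : Type} [Finite S] [Finite T] {p q r : ℤ} {Z Z' W : A}
    (x : Z ⟶ P.X (Option S) p) (y : Z' ⟶ P.X T q) (h : p + q = r) (w : Q.X (S ⊕ T) r ⟶ W) :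
    P.mul x y h ≫ f.f (S ⊕ T) r ≫ w = Q.mul (x ≫ f.f (Option S) p) (y ≫ f.f T q) h ≫ w := by
  rw [← Category.assoc, f.mul]

theorem rel_assoc {S T : Type} [Finite S] [Finite T] (e : S ≃ T) (n : ℤ) {W : A}
    (w : Q.X T n ⟶ W) : P.rel e n ≫ f.f T n ≫ w = f.f S n ≫ Q.rel e n ≫ w := by
  rw [← Category.assoc, f.rel, Category.assoc]

theorem unit_assoc {W : A} (w : Q.X Unit 0 ⟶ W) : P.unit ≫ f.f Unit 0 ≫ w = Q.unit ≫ w := by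
  rw [← Category.assoc, f.unit]

end RawHom

end Raw

/-! ### Operad axioms on generalized elements, and their transport along morphisms. -/

section Laws

variable {A : Type u} [Category.{v} A] [Abelian A] [MonoidalCategory A] [SymmetricCategory A]

theorem units_smul_comp {X Y Z : A} (k : ℤˣ) (f : X ⟶ Y) (g : Y ⟶ Z) :
    (k • f) ≫ g = k • (f ≫ g) := by
  rw [Units.smul_def, Units.smul_def, Preadditive.zsmul_comp]

theorem comp_units_smul {X Y Z : A} (k : ℤˣ) (f : X ⟶ Y) (g : Y ⟶ Z) :
    f ≫ (k • g) = k • (f ≫ g) := by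
  rw [Units.smul_def, Units.smul_def, Preadditive.comp_zsmul]

/-- The axioms of operads hold in `P` after composition with `k`. -/
structure Raw.LawsAlong (P : Raw A) {Y : ∀ (S : Type) [Finite S], ℤ → A}
    (k : ∀ (S : Type) [Finite S] (n : ℤ), P.X S n ⟶ Y S n) : Prop where
  rel_refl : ∀ (S : Type) [Finite S] (n : ℤ), P.rel (Equiv.refl S) n ≫ k S n = k S n
  rel_trans : ∀ {S T U : Type} [Finite S] [Finite T] [Finite U] (e : S ≃ T) (e' : T ≃ U) (n : ℤ),
    P.rel e n ≫ P.rel e' n ≫ k U n = P.rel (e.trans e') n ≫ k U n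
  equivariant : ∀ {S S' T T' : Type} [Finite S] [Finite S'] [Finite T] [Finite T']
    (e : S ≃ S') (e' : T ≃ T') {p q r : ℤ} (h : p + q = r) {Z Z' : A}
    (x : Z ⟶ P.X (Option S) p) (y : Z' ⟶ P.X T q),
    P.mul (x ≫ P.rel e.optionCongr p) (y ≫ P.rel e' q) h ≫ k (S' ⊕ T') r =
      P.mul x y h ≫ P.rel (e.sumCongr e') r ≫ k (S' ⊕ T') r
  comp_unit : ∀ {S : Type} [Finite S] {p : ℤ} {Z : A} (x : Z ⟶ P.X (Option S) p),
    (ρ_ Z).inv ≫ P.mul x P.unit (add_zero p) ≫ k (S ⊕ Unit) p =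
      x ≫ P.rel (Equiv.optionEquivSumPUnit S) p ≫ k (S ⊕ Unit) p
  unit_comp : ∀ {T : Type} [Finite T] {q : ℤ} {Z : A} (y : Z ⟶ P.X T q),
    (λ_ Z).inv ≫ P.mul (P.unit ≫ P.rel pointEquiv 0) y (zero_add q) ≫
      P.rel (Equiv.emptySum Empty T) q ≫ k T q = y ≫ k T q
  seq : ∀ {S T U : Type} [Finite S] [Finite T] [Finite U] {p q r pq qr s : ℤ}
    (h : p + q = pq) (h' : q + r = qr) (h₁ : pq + r = s) (h₂ : p + qr = s) {Z Z' Z'' : A}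
    (x : Z ⟶ P.X (Option S) p) (y : Z' ⟶ P.X (Option T) q) (z : Z'' ⟶ P.X U r),
    P.mul (P.mul x y h ≫ P.rel (optRight S T) pq) z h₁ ≫ k ((S ⊕ T) ⊕ U) s =
      (α_ _ _ _).hom ≫ P.mul x (P.mul y z h') h₂ ≫ P.rel (Equiv.sumAssoc S T U).symm s ≫
        k ((S ⊕ T) ⊕ U) s
  par : ∀ {S T U : Type} [Finite S] [Finite T] [Finite U] {p q r pq pr s : ℤ}
    (h : p + q = pq) (h' : p + r = pr) (h₁ : pq + r = s) (h₂ : pr + q = s) {Z Z' Z'' : A}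
    (x : Z ⟶ P.X (Option (Option S)) p) (y : Z' ⟶ P.X T q) (z : Z'' ⟶ P.X U r),
    P.mul (P.mul x y h ≫ P.rel (optLeft S T) pq) z h₁ ≫ k ((S ⊕ T) ⊕ U) s =
      (q * r).negOnePow • ((α_ _ _ _).hom ≫ (Z ◁ (β_ Z' Z'').hom) ≫ (α_ _ _ _).inv ≫
        P.mul (P.mul (x ≫ P.rel (optSwap S) p) z h' ≫ P.rel (optLeft S U) pr) y h₂ ≫
        P.rel (sumSwap S T U) s ≫ k ((S ⊕ T) ⊕ U) s)

/-- The axioms of operads. -/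
abbrev Raw.Laws (P : Raw A) : Prop := P.LawsAlong (fun S _ n => 𝟙 (P.X S n))

namespace Raw.LawsAlong

/-- A morphism of operadic data carries each side of an axiom to the same expression in the images,
where the axiom of `Q` applies. -/
theorem pull {P Q : Raw A} (f : RawHom P Q) {Y : ∀ (S : Type) [Finite S], ℤ → A}
    {k : ∀ (S : Type) [Finite S] (n : ℤ), Q.X S n ⟶ Y S n} (H : Q.LawsAlong k) :
    P.LawsAlong (fun S _ n => f.f S n ≫ k S n) where
  rel_refl S _ n := by rw [f.rel_assoc, H.rel_refl]
  rel_trans e e' n := by rw [f.rel_assoc, f.rel_assoc, f.rel_assoc, H.rel_trans]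
  equivariant e e' p q r h Z Z' x y := by
    rw [f.mul_assoc, f.rel_assoc, f.mul_assoc, Category.assoc, Category.assoc, f.rel, f.rel,
      ← Category.assoc, ← Category.assoc, H.equivariant]
  comp_unit x := by
    rw [f.mul_assoc, f.unit, H.comp_unit, f.rel_assoc, Category.assoc]
  unit_comp y := by
    rw [f.rel_assoc, f.mul_assoc, Category.assoc, f.rel, f.unit_assoc, H.unit_comp, Category.assoc]
  seq h h' h₁ h₂ Z Z' Z'' x y z := by
    rw [f.mul_assoc, f.rel_assoc, f.mul_assoc, Category.assoc, f.rel, f.mul_assoc, f.mul, H.seq]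
  par h h' h₁ h₂ Z Z' Z'' x y z := by
    rw [f.mul_assoc, f.rel_assoc, f.mul_assoc, Category.assoc, Category.assoc, f.rel, f.rel,
      f.mul_assoc, f.mul_assoc, Category.assoc, f.rel, ← Category.assoc x, H.par]

/-- Each axiom equates two elements, so it can be verified through any family of maps detecting
equality after `k`. This serves for the projections of a limit and for the evaluations in all
complete operads. -/
theorem of_forall {P : Raw A} {Y : ∀ (S : Type) [Finite S], ℤ → A}
    {k : ∀ (S : Type) [Finite S] (n : ℤ), P.X S n ⟶ Y S n} {I : Sort*}
    {Y' : I → ∀ (S : Type) [Finite S], ℤ → A}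
    {k' : ∀ (i : I) (S : Type) [Finite S] (n : ℤ), P.X S n ⟶ Y' i S n}
    (hk : ∀ (S : Type) [Finite S] (n : ℤ) {Z : A} (x y : Z ⟶ P.X S n),
      (∀ i, x ≫ k' i S n = y ≫ k' i S n) → x ≫ k S n = y ≫ k S n)
    (H : ∀ i, P.LawsAlong (k' i)) : P.LawsAlong k where
  rel_refl S _ n := by
    have := hk S n (P.rel (Equiv.refl S) n) (𝟙 _) fun i => by
      rw [(H i).rel_refl, Category.id_comp]
    rwa [Category.id_comp] at this
  rel_trans e e' n := by
    have := hk _ n (P.rel e n ≫ P.rel e' n) (P.rel (e.trans e') n) fun i => by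
      rw [Category.assoc, (H i).rel_trans]
    rwa [Category.assoc] at this
  equivariant e e' p q r h Z Z' x y := by
    rw [← Category.assoc (P.mul x y h)]
    refine hk _ _ _ _ fun i => ?_
    rw [Category.assoc, (H i).equivariant]
  comp_unit x := by
    rw [← Category.assoc, ← Category.assoc]
    refine hk _ _ _ _ fun i => ?_
    rw [Category.assoc, Category.assoc, (H i).comp_unit]
  unit_comp y := by
    rw [← Category.assoc, ← Category.assoc]
    refine hk _ _ _ _ fun i => ?_
    rw [Category.assoc, Category.assoc, (H i).unit_comp]
  seq h h' h₁ h₂ Z Z' Z'' x y z := by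
    rw [← Category.assoc (P.mul x _ _), ← Category.assoc (α_ _ _ _).hom]
    refine hk _ _ _ _ fun i => ?_
    rw [Category.assoc, Category.assoc, (H i).seq]
  par {S T U} _ _ _ {p q r pq pr s} h h' h₁ h₂ Z Z' Z'' x y z := by
    have := hk _ _ (P.mul (P.mul x y h ≫ P.rel (optLeft _ _) _) z h₁)
      ((q * r).negOnePow • ((α_ _ _ _).hom ≫ (Z ◁ (β_ Z' Z'').hom) ≫ (α_ _ _ _).inv ≫
        P.mul (P.mul (x ≫ P.rel (optSwap _) _) z h' ≫ P.rel (optLeft _ _) _) y h₂ ≫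
        P.rel (sumSwap _ _ _) _)) fun i => by
          rw [(H i).par h h' h₁ h₂, units_smul_comp]
          simp only [Category.assoc]
    rw [this, units_smul_comp]
    simp only [Category.assoc]

/-- Elements of `Q` lift to `P` after an epimorphism. Tensor products of epimorphisms are
epimorphisms, so an axiom for the lifts implies it for the original elements. -/
theorem push [MonoidalClosed A] {P Q : Raw A} (f : RawHom P Q)
    (hf : ∀ (S : Type) [Finite S] (n : ℤ), Epi (f.f S n)) {Y : ∀ (S : Type) [Finite S], ℤ → A}
    {k : ∀ (S : Type) [Finite S] (n : ℤ), Q.X S n ⟶ Y S n}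
    (H : P.LawsAlong (fun S _ n => f.f S n ≫ k S n)) : Q.LawsAlong k := by
  have lift : ∀ {S : Type} [Finite S] {n : ℤ} {Z : A} (x : Z ⟶ Q.X S n),
      ∃ (W : A) (e : W ⟶ Z) (x' : W ⟶ P.X S n), Epi e ∧ e ≫ x = x' ≫ f.f S n := by
    intro S _ n Z x
    have := hf S n
    exact ⟨pullback (f.f S n) x, pullback.snd _ _, pullback.fst _ _, inferInstance,
      pullback.condition.symm⟩
  constructor
  · intro S _ n
    have := hf S n
    rw [← cancel_epi (f.f S n), ← f.rel_assoc, H.rel_refl]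
  · intro S T U _ _ _ e e' n
    have := hf S n
    rw [← cancel_epi (f.f S n), ← f.rel_assoc, ← f.rel_assoc, H.rel_trans, f.rel_assoc]
  · intro S S' T T' _ _ _ _ e e' p q r h Z Z' x y
    obtain ⟨W, a, x', ha, hx⟩ := lift x
    obtain ⟨W', b, y', hb, hy⟩ := lift y
    have := tensorHom_epi a b
    rw [← cancel_epi (a ⊗ₘ b), Q.tensor_mul_assoc, Q.tensor_mul_assoc, ← Category.assoc a,
      ← Category.assoc b, hx, hy, Category.assoc, Category.assoc, ← f.rel, ← f.rel,
      ← Category.assoc, ← Category.assoc, ← f.mul_assoc, H.equivariant, f.rel_assoc, f.mul_assoc]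
  · intro S _ p Z x
    obtain ⟨W, a, x', ha, hx⟩ := lift x
    have e1 : a ≫ (ρ_ Z).inv = (ρ_ W).inv ≫ (a ⊗ₘ 𝟙 _) := by simp
    rw [← cancel_epi a, ← Category.assoc a, e1, Category.assoc, Q.tensor_mul_assoc,
      Category.id_comp, ← f.unit, hx, ← f.mul_assoc, H.comp_unit, f.rel_assoc, ← Category.assoc,
      ← hx, Category.assoc]
  · intro T _ q Z y
    obtain ⟨W, a, x', ha, hx⟩ := lift y
    have e1 : a ≫ (λ_ Z).inv = (λ_ W).inv ≫ (𝟙 _ ⊗ₘ a) := by simp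
    rw [← cancel_epi a, ← Category.assoc a, e1, Category.assoc, Q.tensor_mul_assoc,
      Category.id_comp, ← f.unit, hx, Category.assoc, ← f.rel, ← Category.assoc P.unit,
      ← f.mul_assoc,
      ← f.rel_assoc, H.unit_comp, ← Category.assoc, ← hx, Category.assoc]
  · intro S T U _ _ _ p q r pq qr s h h' h₁ h₂ Z Z' Z'' x y z
    obtain ⟨W, a, x', ha, hx⟩ := lift x
    obtain ⟨W', b, y', hb, hy⟩ := lift y
    obtain ⟨W'', c, z', hc, hz⟩ := lift z
    have := tensorHom_epi a b
    have := tensorHom_epi (a ⊗ₘ b) c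
    rw [← cancel_epi ((a ⊗ₘ b) ⊗ₘ c), associator_naturality_assoc]
    simp only [Raw.tensor_mul_assoc, Raw.tensor_mul]
    rw [hx, hy, hz, ← f.mul_assoc, ← f.rel, ← Category.assoc, ← f.mul_assoc, H.seq h h' h₁ h₂,
      f.rel_assoc, f.mul_assoc, f.mul]
  · intro S T U _ _ _ p q r pq pr s h h' h₁ h₂ Z Z' Z'' x y z
    obtain ⟨W, a, x', ha, hx⟩ := lift x
    obtain ⟨W', b, y', hb, hy⟩ := lift y
    obtain ⟨W'', c, z', hc, hz⟩ := lift z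
    have := tensorHom_epi a b
    have := tensorHom_epi (a ⊗ₘ b) c
    have e1 : (a ⊗ₘ b ⊗ₘ c) ≫ Z ◁ (β_ Z' Z'').hom = W ◁ (β_ W' W'').hom ≫ (a ⊗ₘ c ⊗ₘ b) := by
      rw [← id_tensorHom, ← id_tensorHom, MonoidalCategory.tensorHom_comp_tensorHom,
        MonoidalCategory.tensorHom_comp_tensorHom, BraidedCategory.braiding_naturality,
        Category.comp_id, Category.id_comp]
    rw [← cancel_epi ((a ⊗ₘ b) ⊗ₘ c), comp_units_smul, associator_naturality_assoc,
      reassoc_of% e1, associator_inv_naturality_assoc]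
    simp only [Raw.tensor_mul_assoc]
    rw [← Category.assoc a, hx, hy, hz, Category.assoc, ← f.rel, ← f.mul_assoc, ← f.rel,
      ← Category.assoc, ← f.mul_assoc, H.par h h' h₁ h₂, f.rel_assoc, f.mul_assoc,
      Category.assoc, f.rel, f.mul_assoc, Category.assoc]

end Raw.LawsAlong

/-- The operadic data underlying an operad structure. -/
abbrev OperadStr.raw {P : SMod (CompleteGr A)} (o : OperadStr P) : Raw A where
  X S _ n := ev P S n
  rel e n := FreeCurvedOperad.rel P e n
  unit := o.unit
  comp := o.comp

theorem rel_refl (P : SMod (CompleteGr A)) (S : Type) [Finite S] (n : ℤ) :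
    rel P (Equiv.refl S) n = 𝟙 _ := by
  have : bij (Equiv.refl S) = 𝟙 (fin S) := rfl
  rw [rel, this, P.map_id]
  rfl

theorem rel_rel (P : SMod (CompleteGr A)) {S T U : Type} [Finite S] [Finite T] [Finite U]
    (e : S ≃ T) (e' : T ≃ U) (n : ℤ) : rel P e n ≫ rel P e' n = rel P (e.trans e') n := by
  have : bij (e.trans e') = bij e ≫ bij e' := rfl
  rw [rel, rel, rel, this, P.map_comp]
  rfl

theorem rel_rel_assoc (P : SMod (CompleteGr A)) {S T U : Type} [Finite S] [Finite T] [Finite U]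
    (e : S ≃ T) (e' : T ≃ U) (n : ℤ) {Z : A} (z : ev P U n ⟶ Z) :
    rel P e n ≫ rel P e' n ≫ z = rel P (e.trans e') n ≫ z := by
  rw [← Category.assoc, rel_rel]

/-- Precomposing the axioms with tensor products of elements gives their element forms;
`CRaw.toOperad` goes back by inserting identities as elements. -/
theorem OperadStr.laws {P : SMod (CompleteGr A)} (o : OperadStr P) : o.raw.Laws where
  rel_refl S _ n := by rw [Category.comp_id]; exact FreeCurvedOperad.rel_refl P S n
  rel_trans e e' n := by rw [Category.comp_id, Category.comp_id]; exact rel_rel P e e' n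
  equivariant e e' p q r h Z Z' x y := by
    rw [Category.comp_id, Category.comp_id, ← Raw.tensor_mul, o.raw.mul_eq x, Category.assoc]
    congr 1
    simpa [Raw.mul] using o.comp_equivariant _ _ _ _ e e' p q r h
  comp_unit x := by
    rw [Category.comp_id, Category.comp_id]
    have := x ≫= o.comp_unit _ _
    rw [← this, Raw.mul, MonoidalCategory.tensorHom_def]
    simp
  unit_comp y := by
    rw [Category.comp_id, Category.comp_id]
    have := y ≫= o.unit_comp _ _
    rw [Category.comp_id] at this
    rw [Raw.mul, MonoidalCategory.tensorHom_def', Category.assoc, Category.assoc,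
      ← leftUnitor_inv_naturality_assoc]
    exact this
  seq h h' h₁ h₂ Z Z' Z'' x y z := by
    rw [Category.comp_id, Category.comp_id]
    have := ((x ⊗ₘ y) ⊗ₘ z) ≫= o.comp_seq _ _ _ _ _ _ _ _ _ h h' h₁ h₂
    rw [associator_naturality_assoc, ← tensorHom_id, ← id_tensorHom,
      MonoidalCategory.tensorHom_comp_tensorHom_assoc,
      MonoidalCategory.tensorHom_comp_tensorHom_assoc, Category.comp_id, Category.comp_id] at this
    simp only [Raw.mul, Category.assoc]
    exact this
  par h h' h₁ h₂ Z Z' Z'' x y z := by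
    rw [Category.comp_id, Category.comp_id]
    have e1 : (x ⊗ₘ (β_ Z' Z'').hom ≫ (z ⊗ₘ y)) = Z ◁ (β_ Z' Z'').hom ≫ (x ⊗ₘ z ⊗ₘ y) := by
      rw [← id_tensorHom, MonoidalCategory.tensorHom_comp_tensorHom, Category.id_comp]
    have := ((x ⊗ₘ y) ⊗ₘ z) ≫= o.comp_par _ _ _ _ _ _ _ _ _ h h' h₁ h₂
    rw [comp_units_smul, associator_naturality_assoc, ← tensorHom_id, ← id_tensorHom,
      MonoidalCategory.tensorHom_comp_tensorHom_assoc,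
      MonoidalCategory.tensorHom_comp_tensorHom_assoc, Category.comp_id, Category.comp_id,
      BraidedCategory.braiding_naturality, e1, Category.assoc,
      associator_inv_naturality_assoc, ← tensorHom_id,
      MonoidalCategory.tensorHom_comp_tensorHom_assoc, Category.comp_id] at this
    simp only [Raw.mul, Category.assoc]
    refine this.trans ?_
    congr 5
    rw [← tensorHom_id, ← Category.assoc, MonoidalCategory.tensorHom_comp_tensorHom,
      Category.comp_id]

theorem rel_at {P Q : SMod (CompleteGr A)} (f : P ⟶ Q) {S T : Type} [Finite S] [Finite T]
    (e : S ≃ T) (n : ℤ) : rel P e n ≫ at_ f T n = at_ f S n ≫ rel Q e n :=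
  congrFun (congrArg CompleteGr.Hom.f (f.naturality (bij e))) n

/-- The morphism of operadic data underlying a morphism of operads. -/
abbrev IsOperadHom.rawHom {P Q : SMod (CompleteGr A)} {oP : OperadStr P} {oQ : OperadStr Q}
    {f : P ⟶ Q} (h : IsOperadHom oP oQ f) : RawHom oP.raw oQ.raw where
  f S _ n := at_ f S n
  rel e n := rel_at f e n
  unit := h.unit
  comp := h.comp

theorem smod_hom_ext {P Q : SMod (CompleteGr A)} {f g : P ⟶ Q}
    (h : ∀ (S : Type) [Finite S] (n : ℤ), at_ f S n = at_ g S n) : f = g :=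
  NatTrans.ext (funext fun S => CompleteGr.Hom.ext (funext fun n => h S.of n))

/-- A morphism of `𝕊`-modules given by a family of filtered equivariant maps. -/
def smodHom {P Q : SMod (CompleteGr A)} (f : ∀ (S : Type) [Finite S] (n : ℤ), ev P S n ⟶ ev Q S n)
    (hf : ∀ (S : Type) [Finite S] (n : ℤ), FilteredGr.IsFiltered
      (V := (P.obj (fin S)).toFilteredGr) (W := (Q.obj (fin S)).toFilteredGr) (f S n))
    (hr : ∀ {S T : Type} [Finite S] [Finite T] (e : S ≃ T) (n : ℤ),
      rel P e n ≫ f T n = f S n ≫ rel Q e n) : P ⟶ Q where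
  app S := ⟨fun n => f S.of n, fun n p => hf S.of n p⟩
  naturality _ _ e := CompleteGr.Hom.ext (funext fun n =>
    hr (FintypeCat.equivEquivIso.symm e.iso) n)

/-- Operadic data with values in complete graded objects. -/
structure CRaw (A : Type u) [Category.{v} A] [Abelian A] [MonoidalCategory A] where
  V : ∀ (S : Type) [Finite S], CompleteGr A
  rel : ∀ {S T : Type} [Finite S] [Finite T] (_ : S ≃ T), V S ⟶ V T
  unit : 𝟙_ A ⟶ (V Unit).X 0
  comp : ∀ (S T : Type) [Finite S] [Finite T] (p q r : ℤ), p + q = r →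
    ((V (Option S)).X p ⊗ (V T).X q ⟶ (V (S ⊕ T)).X r)
  comp_filt : ∀ (S T : Type) [Finite S] [Finite T] (p q r : ℤ) (h : p + q = r) (a b : ℕ),
    ((V (S ⊕ T)).F r (a + b)).Factors
      ((((V (Option S)).F p a).arrow ⊗ₘ ((V T).F q b).arrow) ≫ comp S T p q r h)

namespace CRaw

/-- The underlying operadic data. -/
abbrev raw (P : CRaw A) : Raw A where
  X S _ n := (P.V S).X n
  rel e n := (P.rel e).f n
  unit := P.unit
  comp := P.comp

/-- The underlying `𝕊`-module. -/
abbrev mod (P : CRaw A) (H : P.raw.Laws) : SMod (CompleteGr A) where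
  obj S := P.V S.of
  map e := P.rel (FintypeCat.equivEquivIso.symm e.iso)
  map_id S := CompleteGr.Hom.ext (funext fun n => by
    have := H.rel_refl S.of n
    rwa [Category.comp_id] at this)
  map_comp e e' := CompleteGr.Hom.ext (funext fun n => by
    have := H.rel_trans (FintypeCat.equivEquivIso.symm e.iso)
      (FintypeCat.equivEquivIso.symm e'.iso) n
    rw [Category.comp_id, Category.comp_id] at this
    exact this.symm)

/-- The complete operad given by complete operadic data which satisfy the axioms. -/
abbrev toOperad (P : CRaw A) (H : P.raw.Laws) : CompleteOperad A where
  mod := P.mod H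
  str :=
    { unit := P.unit
      comp := P.comp
      comp_filt := P.comp_filt
      comp_equivariant := fun S S' T T' _ _ _ _ e e' p q r h => by
        have := H.equivariant e e' h (𝟙 _) (𝟙 _)
        rw [Category.comp_id, Category.comp_id, Category.id_comp, Category.id_comp, Raw.mul,
          Raw.mul, id_tensorHom_id, Category.id_comp] at this
        exact this
      comp_unit := fun S _ p => by
        have := H.comp_unit (S := S) (p := p) (𝟙 _)
        rw [Category.comp_id, Category.comp_id, Category.id_comp, Raw.mul, id_tensorHom] at this
        exact this
      unit_comp := fun T _ q => by
        have := H.unit_comp (T := T) (q := q) (𝟙 _)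
        rw [Category.comp_id, Category.comp_id, Raw.mul, tensorHom_id, Category.assoc] at this
        exact this
      comp_seq := fun S T U _ _ _ p q r pq qr s h h' h₁ h₂ => by
        have := H.seq (S := S) (T := T) (U := U) h h' h₁ h₂ (𝟙 _) (𝟙 _) (𝟙 _)
        rw [Category.comp_id, Category.comp_id, Raw.mul, Raw.mul, Raw.mul, Raw.mul, id_tensorHom_id,
          tensorHom_id, Category.id_comp, id_tensorHom_id, Category.id_comp, id_tensorHom,
          Category.assoc] at this
        exact this
      comp_par := fun S T U _ _ _ p q r pq pr s h h' h₁ h₂ => by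
        have := H.par (S := S) (T := T) (U := U) h h' h₁ h₂ (𝟙 _) (𝟙 _) (𝟙 _)
        rw [Category.comp_id, Category.comp_id, Raw.mul, Raw.mul, Raw.mul, Raw.mul, id_tensorHom_id,
          tensorHom_id, Category.id_comp, tensorHom_id, Category.id_comp, tensorHom_id,
          Category.assoc, Category.assoc] at this
        exact this }

end CRaw

end Laws

/-! ### Completion of filtered operadic data -/

section RawCompletion

variable {A : Type u} [Category.{v} A] [Abelian A] [MonoidalCategory A] [SymmetricCategory A]
  [MonoidalClosed A]

/-- A multiplicative filtration of operadic data, modulo every step of which the axioms of operads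
hold. -/
structure OperadFiltration (E : Raw A) where
  F : ∀ (S : Type) [Finite S] (n : ℤ), ℕ → Subobject (E.X S n)
  F_zero : ∀ (S : Type) [Finite S] (n : ℤ), F S n 0 = ⊤
  anti : ∀ (S : Type) [Finite S] (n : ℤ), Antitone (F S n)
  rel : ∀ {S T : Type} [Finite S] [Finite T] (e : S ≃ T) (n : ℤ) (p : ℕ),
    (F T n p).Factors ((F S n p).arrow ≫ E.rel e n)
  mul : ∀ {S T : Type} [Finite S] [Finite T] {p q r : ℤ} (h : p + q = r) {a b : ℕ} {Z Z' : A}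
    {x : Z ⟶ E.X (Option S) p} {y : Z' ⟶ E.X T q}, (F (Option S) p a).Factors x →
      (F T q b).Factors y → (F (S ⊕ T) r (a + b)).Factors (E.mul x y h)
  laws : ∀ a : ℕ, E.LawsAlong (fun S _ n => cokernel.π (F S n a).arrow)

namespace OperadFiltration

variable {E : Raw A} (K : OperadFiltration E)

/-- The underlying filtered graded objects. -/
abbrev V (S : Type) [Finite S] : FilteredGr A where
  X n := E.X S n
  F n := K.F S n
  F_zero n := K.F_zero S n
  anti n := K.anti S n

open FilteredGr

theorem exists_comp_quot (S T : Type) [Finite S] [Finite T] (p q r : ℤ) (h : p + q = r) (a : ℕ) :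
    ∃ g : (K.V (Option S)).quot p a ⊗ (K.V T).quot q a ⟶ (K.V (S ⊕ T)).quot r a,
      ((K.V (Option S)).proj p a ⊗ₘ (K.V T).proj q a) ≫ g =
        E.comp S T p q r h ≫ (K.V (S ⊕ T)).proj r a := by
  refine exists_tensor_desc (K.F (Option S) p a) (K.F T q a) _ ?_ ?_
  -- `F_0` is everything, so multiplicativity with one index zero makes `F_a` absorb compositions on
  -- either side.
  · have := K.mul h (b := 0) ((K.F (Option S) p a).factors_self)
      (factors_of_eq_top (𝟙 _) (K.F_zero T q))
    rw [Raw.mul, tensorHom_id, factors_iff_comp_cokernel, Category.assoc] at this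
    exact this
  · have := K.mul h (a := 0) (factors_of_eq_top (𝟙 _) (K.F_zero (Option S) p))
      ((K.F T q a).factors_self)
    rw [Raw.mul, id_tensorHom, factors_iff_comp_cokernel, Category.assoc] at this
    rw [zero_add] at this
    exact this

/-- The compositions of the quotient. -/
def quotComp (S T : Type) [Finite S] [Finite T] (p q r : ℤ) (h : p + q = r) (a : ℕ) :
    (K.V (Option S)).quot p a ⊗ (K.V T).quot q a ⟶ (K.V (S ⊕ T)).quot r a :=
  (K.exists_comp_quot S T p q r h a).choose

/-- The relabelling maps of the quotient. -/
def quotRel {S T : Type} [Finite S] [Finite T] (e : S ≃ T) (n : ℤ) (a : ℕ) :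
    (K.V S).quot n a ⟶ (K.V T).quot n a :=
  (IsFiltered.exists_quot (V := K.V S) (W := K.V T) (fun p => K.rel e n p) a).choose

/-- The quotient operadic data. -/
abbrev level (a : ℕ) : Raw A where
  X S _ n := (K.V S).quot n a
  rel e n := K.quotRel e n a
  unit := E.unit ≫ (K.V Unit).proj 0 a
  comp S T _ _ p q r h := K.quotComp S T p q r h a

/-- The projection to the quotient. -/
abbrev projHom (a : ℕ) : RawHom E (K.level a) where
  f S _ n := (K.V S).proj n a
  rel {S T} _ _ e n :=
    (IsFiltered.exists_quot (V := K.V S) (W := K.V T) (fun p => K.rel e n p) a).choose_spec.symm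
  unit := rfl
  comp S T _ _ p q r h := (K.exists_comp_quot S T p q r h a).choose_spec.symm

theorem projHom_epi (a : ℕ) (S : Type) [Finite S] (n : ℤ) : Epi ((K.projHom a).f S n) :=
  inferInstanceAs (Epi (cokernel.π _))

theorem level_laws (a : ℕ) : (K.level a).Laws := by
  refine Raw.LawsAlong.push (K.projHom a) (K.projHom_epi a) ?_
  have := K.laws a
  simp only [Category.comp_id]
  exact this

/-- The transition morphism between two quotients. -/
abbrev transHom {a b : ℕ} (h : a ≤ b) : RawHom (K.level b) (K.level a) where
  f S _ n := (K.V S).trans n h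
  rel {S T} _ _ e n := by
    have h1 := (K.projHom b).rel e n
    have h2 := (K.projHom a).rel e n
    rw [← cancel_epi ((K.V S).proj n b), ← Category.assoc, ← h1, Category.assoc, proj_trans,
      proj_trans_assoc, h2]
  unit := by rw [Category.assoc, proj_trans]
  comp S T _ _ p q r hr := by
    have := K.projHom_epi b (Option S) p
    have := K.projHom_epi b T q
    have := tensorHom_epi ((K.V (Option S)).proj p b) ((K.V T).proj q b)
    have h1 := (K.projHom b).comp S T p q r hr
    have h2 := (K.projHom a).comp S T p q r hr
    rw [← cancel_epi ((K.V (Option S)).proj p b ⊗ₘ (K.V T).proj q b), ← Category.assoc,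
      ← Category.assoc, ← h1, MonoidalCategory.tensorHom_comp_tensorHom, Category.assoc,
      proj_trans, proj_trans, proj_trans, h2]

variable [HasLimitsOfShape ℕᵒᵖ A]

/-- The relabelling maps of the completion. -/
def limRel {S T : Type} [Finite S] [Finite T] (e : S ≃ T) (n : ℤ) :
    (K.V S).lim.X n ⟶ (K.V T).lim.X n :=
  (K.V T).limLift (fun a => (K.V S).limProj n a ≫ K.quotRel e n a) fun a b h => by
    have := (K.transHom h).rel e n
    rw [Category.assoc, this, limProj_trans_assoc]

/-- The compositions of the completion. -/
def limComp (S T : Type) [Finite S] [Finite T] (p q r : ℤ) (h : p + q = r) :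
    (K.V (Option S)).lim.X p ⊗ (K.V T).lim.X q ⟶ (K.V (S ⊕ T)).lim.X r :=
  (K.V (S ⊕ T)).limLift (fun a => ((K.V (Option S)).limProj p a ⊗ₘ (K.V T).limProj q a) ≫
      K.quotComp S T p q r h a) fun a b hab => by
    have := (K.transHom hab).comp S T p q r h
    rw [Category.assoc, this, ← Category.assoc, MonoidalCategory.tensorHom_comp_tensorHom,
      limProj_trans, limProj_trans]

theorem limComp_limProj (S T : Type) [Finite S] [Finite T] (p q r : ℤ) (h : p + q = r) (a : ℕ) :
    K.limComp S T p q r h ≫ (K.V (S ⊕ T)).limProj r a =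
      ((K.V (Option S)).limProj p a ⊗ₘ (K.V T).limProj q a) ≫ K.quotComp S T p q r h a :=
  limLift_limProj _ _ _ _

theorem limRel_limProj {S T : Type} [Finite S] [Finite T] (e : S ≃ T) (n : ℤ) (a : ℕ) :
    K.limRel e n ≫ (K.V T).limProj n a = (K.V S).limProj n a ≫ K.quotRel e n a :=
  limLift_limProj _ _ _ _

/-- An element of `F_a` of the completion vanishes in the quotient by `F_a`, so its image in the
finer quotient by `F_c` comes, after a cover, from `F_a` of `E`. Elements are thus approximated to
any precision `c` without leaving the filtration step. -/
theorem exists_epi_lift_lim (S : Type) [Finite S] (n : ℤ) {a c : ℕ} (h : a ≤ c) :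
    ∃ (Z : A) (e : Z ⟶ ((K.V S).lim.F n a : A)) (x : Z ⟶ E.X S n), Epi e ∧ (K.F S n a).Factors x ∧
      x ≫ (K.V S).proj n c = e ≫ ((K.V S).lim.F n a).arrow ≫ (K.V S).limProj n c := by
  refine exists_epi_lift (K.anti S n h) _ ?_
  have h1 : ((K.V S).lim.F n a).arrow ≫ (K.V S).limProj n a = 0 :=
    (lim_factors_iff _ _).1 (Subobject.factors_self _)
  rw [Category.assoc]
  have := (K.V S).limProj_trans n h
  rw [FilteredGr.trans] at this
  rw [this, h1]

/-- The completion, as operadic data. -/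
abbrev completionRaw : CRaw A where
  V S _ := (K.V S).completion
  rel {S T} _ _ e :=
    { f := fun n => K.limRel e n
      filt := fun n a => by
        refine (lim_factors_iff _ _).2 ?_
        rw [Category.assoc, limRel_limProj, ← Category.assoc,
          (lim_factors_iff _ _).1 (Subobject.factors_self _), zero_comp] }
  unit := E.unit ≫ (K.V Unit).toLim 0
  comp := K.limComp
  comp_filt S T _ _ p q r h a b := by
    refine (lim_factors_iff _ _).2 ?_
    -- The claim is a vanishing at level `a + b`, so approximations modulo `F_(a+b)` suffice, and
    -- the composition of the approximations lies in `F_(a+b)`.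
    obtain ⟨Z, e, x, he, hx, hxe⟩ := K.exists_epi_lift_lim (Option S) p (Nat.le_add_right a b)
    obtain ⟨Z', e', x', he', hx', hxe'⟩ := K.exists_epi_lift_lim T q (Nat.le_add_left b a)
    have := tensorHom_epi e e'
    refine zero_of_epi_comp (e ⊗ₘ e') ?_
    rw [Category.assoc, limComp_limProj, ← Category.assoc, ← Category.assoc,
      MonoidalCategory.tensorHom_comp_tensorHom, MonoidalCategory.tensorHom_comp_tensorHom,
      Category.assoc, Category.assoc, ← hxe, ← hxe', ← MonoidalCategory.tensorHom_comp_tensorHom,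
      Category.assoc]
    have h1 := (K.projHom (a + b)).comp S T p q r h
    rw [← h1, ← Category.assoc]
    exact (factors_iff_comp_cokernel _ _).1 (K.mul h hx hx')

/-- The projection from the completion. -/
abbrev limHom (a : ℕ) : RawHom K.completionRaw.raw (K.level a) where
  f S _ n := (K.V S).limProj n a
  rel e n := K.limRel_limProj e n a
  unit := by
    rw [Category.assoc, toLim_limProj]
  comp S T _ _ p q r h := K.limComp_limProj S T p q r h a

/-- The projections to the levels are jointly monic, and every level satisfies the axioms. -/
theorem completionRaw_laws : K.completionRaw.raw.Laws := by
  refine Raw.LawsAlong.of_forall (k' := fun a S _ n => (K.limHom a).f S n ≫ 𝟙 _) ?_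
    fun a => (K.level_laws a).pull (K.limHom a)
  intro S _ n Z x y h
  simp only [Category.comp_id] at h ⊢
  exact lim_hom_ext _ h

/-- The completion of operadic data with respect to a filtration. -/
abbrev completion : CompleteOperad A := K.completionRaw.toOperad K.completionRaw_laws

/-- The canonical morphism to the completion. -/
abbrev toCompletion : RawHom E K.completion.str.raw where
  f S _ n := (K.V S).toLim n
  rel {S T} _ _ e n := by
    refine lim_hom_ext _ fun a => ?_
    refine (Category.assoc _ _ _).trans (((Category.assoc _ _ _).trans ?_).symm)
    refine ((K.V S).toLim n ≫= K.limRel_limProj e n a).trans ?_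
    rw [toLim_limProj, toLim_limProj_assoc]
    exact ((K.projHom a).rel e n).symm
  unit := rfl
  comp S T _ _ p q r h := by
    refine lim_hom_ext _ fun a => ?_
    refine (Category.assoc _ _ _).trans (((Category.assoc _ _ _).trans ?_).symm)
    refine (_ ≫= K.limComp_limProj S T p q r h a).trans ?_
    rw [← Category.assoc, MonoidalCategory.tensorHom_comp_tensorHom, toLim_limProj, toLim_limProj,
      toLim_limProj]
    exact ((K.projHom a).comp S T p q r h).symm

end OperadFiltration

end RawCompletion

/-! ### Universal property of the completion of operadic data. -/

section CompletionDesc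

variable {A : Type u} [Category.{v} A] [Abelian A] [MonoidalCategory A] [SymmetricCategory A]

open FilteredGr

theorem Raw.LawsAlong.comp {P : Raw A} {Y Y' : ∀ (S : Type) [Finite S], ℤ → A}
    {k : ∀ (S : Type) [Finite S] (n : ℤ), P.X S n ⟶ Y S n} (H : P.LawsAlong k)
    (g : ∀ (S : Type) [Finite S] (n : ℤ), Y S n ⟶ Y' S n) :
    P.LawsAlong (fun S _ n => k S n ≫ g S n) :=
  Raw.LawsAlong.of_forall (I := Unit) (k' := fun _ S _ n => k S n)
    (fun S _ n Z x y h => by rw [← Category.assoc, h (), Category.assoc]) fun _ => H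

theorem OperadStr.mul_factors {P : SMod (CompleteGr A)} (o : OperadStr P) {S T : Type} [Finite S]
    [Finite T] {p q r : ℤ} (h : p + q = r) {a b : ℕ} {Z Z' : A} {x : Z ⟶ ev P (Option S) p}
    {y : Z' ⟶ ev P T q} (hx : (fil P (Option S) p a).Factors x) (hy : (fil P T q b).Factors y) :
    (fil P (S ⊕ T) r (a + b)).Factors (o.raw.mul x y h) := by
  have := factors_comp_left (Subobject.factorThru _ x hx ⊗ₘ Subobject.factorThru _ y hy)
    (o.comp_filt S T p q r h a b)
  rw [← Category.assoc, MonoidalCategory.tensorHom_comp_tensorHom, Subobject.factorThru_arrow,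
    Subobject.factorThru_arrow] at this
  exact this

/-- The filtration of a complete operad. -/
abbrev CompleteOperad.filtration (P : CompleteOperad A) : OperadFiltration P.str.raw where
  F S _ n := fil P.mod S n
  F_zero S _ n := (P.mod.obj (fin S)).F_zero n
  anti S _ n := (P.mod.obj (fin S)).anti n
  rel e n p := (P.mod.map (bij e)).filt n p
  mul h _ _ _ _ _ _ hx hy := P.str.mul_factors h hx hy
  laws a := by
    have := P.str.laws.comp (fun S _ n => (P.mod.obj (fin S)).proj n a)
    simp only [Category.id_comp] at this
    exact this

/-- A filtered morphism of operadic data between complete operads is a morphism of operads. -/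
def RawHom.toHom {P Q : CompleteOperad A} (f : RawHom P.str.raw Q.str.raw)
    (hf : ∀ (S : Type) [Finite S] (n : ℤ), IsFiltered (V := (P.mod.obj (fin S)).toFilteredGr)
      (W := (Q.mod.obj (fin S)).toFilteredGr) (f.f S n)) : P ⟶ Q where
  hom := smodHom (fun S _ n => f.f S n) hf fun e n => f.rel e n
  isHom := ⟨f.unit, f.comp⟩

namespace OperadFiltration

variable [MonoidalClosed A] {E E' : Raw A} (K : OperadFiltration E) (K' : OperadFiltration E')

/-- A morphism of operadic data which preserves filtrations. -/
def PreservesFilt (h : RawHom E E') : Prop :=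
  ∀ (S : Type) [Finite S] (n : ℤ), IsFiltered (V := K.V S) (W := K'.V S) (h.f S n)

variable {K K'}

/-- The morphism between quotients induced by a filtered morphism. -/
def quotMap {h : RawHom E E'} (hh : PreservesFilt K K' h) (S : Type) [Finite S] (n : ℤ) (a : ℕ) :
    (K.V S).quot n a ⟶ (K'.V S).quot n a :=
  ((hh S n).exists_quot a).choose

theorem proj_quotMap {h : RawHom E E'} (hh : PreservesFilt K K' h) (S : Type) [Finite S] (n : ℤ)
    (a : ℕ) : (K.V S).proj n a ≫ quotMap hh S n a = h.f S n ≫ (K'.V S).proj n a :=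
  ((hh S n).exists_quot a).choose_spec

/-- The morphism of operadic data between quotients induced by a filtered morphism. -/
abbrev quotHom {h : RawHom E E'} (hh : PreservesFilt K K' h) (a : ℕ) :
    RawHom (K.level a) (K'.level a) where
  f S _ n := quotMap hh S n a
  rel {S T} _ _ e n := by
    have h1 := (K.projHom a).rel e n
    have h2 := (K'.projHom a).rel e n
    rw [← cancel_epi ((K.V S).proj n a), ← Category.assoc, ← h1, Category.assoc, proj_quotMap,
      h.rel_assoc, h2, ← Category.assoc, ← Category.assoc, proj_quotMap]
  unit := by rw [Category.assoc, proj_quotMap, h.unit_assoc]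
  comp S T _ _ p q r hr := by
    have := K.projHom_epi a (Option S) p
    have := K.projHom_epi a T q
    have := tensorHom_epi ((K.V (Option S)).proj p a) ((K.V T).proj q a)
    have h1 := (K.projHom a).comp S T p q r hr
    have h2 := (K'.projHom a).comp S T p q r hr
    rw [← cancel_epi ((K.V (Option S)).proj p a ⊗ₘ (K.V T).proj q a), ← Category.assoc, ← h1,
      Category.assoc, proj_quotMap, ← Category.assoc, h.comp, Category.assoc, h2, ← Category.assoc,
      ← Category.assoc, MonoidalCategory.tensorHom_comp_tensorHom,
      MonoidalCategory.tensorHom_comp_tensorHom, proj_quotMap, proj_quotMap]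

variable [HasLimitsOfShape ℕᵒᵖ A] {O : CompleteOperad A}

/-- The extension to the completion of a filtered morphism to a complete operad, at a finite set. -/
def descAt {h : RawHom E O.str.raw} (hh : PreservesFilt K O.filtration h) (S : Type) [Finite S]
    (n : ℤ) : ev K.completion.mod S n ⟶ ev O.mod S n :=
  completionExt (V := K.V S) (W := O.mod.obj (fin S)) (h.f S n) (hh S n)

theorem toLim_descAt {h : RawHom E O.str.raw} (hh : PreservesFilt K O.filtration h) (S : Type)
    [Finite S] (n : ℤ) : (K.V S).toLim n ≫ descAt hh S n = h.f S n :=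
  toLim_completionExt _ _

theorem descAt_proj {h : RawHom E O.str.raw} (hh : PreservesFilt K O.filtration h) (S : Type)
    [Finite S] (n : ℤ) (a : ℕ) : descAt hh S n ≫ (O.mod.obj (fin S)).proj n a =
      (K.V S).limProj n a ≫ quotMap hh S n a :=
  completionExt_proj _ _ _

theorem descAt_isFiltered {h : RawHom E O.str.raw} (hh : PreservesFilt K O.filtration h)
    (S : Type) [Finite S] (n : ℤ) : IsFiltered (V := (K.completion.mod.obj (fin S)).toFilteredGr)
      (W := (O.mod.obj (fin S)).toFilteredGr) (descAt hh S n) :=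
  completionExt_isFiltered _ _

/-- The morphism of operadic data out of the completion given by a filtered morphism to a complete
operad. -/
abbrev descRaw {h : RawHom E O.str.raw} (hh : PreservesFilt K O.filtration h) :
    RawHom K.completion.str.raw O.str.raw where
  f S _ n := descAt hh S n
  rel {S T} _ _ e n := by
    -- Equality in the complete object is tested at each level, where the extension is the map of
    -- quotients induced by `h`.
    refine (O.mod.obj (fin T)).hom_ext fun a => ?_
    have h1 := (O.filtration.projHom a).rel e n
    have h2 := (quotHom hh a).rel e n
    rw [Category.assoc, Category.assoc, descAt_proj, h1, ← Category.assoc (descAt hh S n),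
      descAt_proj, Category.assoc, ← h2, ← Category.assoc, ← Category.assoc]
    exact K.limRel_limProj e n a =≫ _
  unit := by
    rw [← h.unit]
    exact (Category.assoc _ _ _).trans (_ ≫= toLim_descAt hh Unit 0)
  comp S T _ _ p q r hr := by
    refine (O.mod.obj (fin (S ⊕ T))).hom_ext fun a => ?_
    have h1 := (O.filtration.projHom a).comp S T p q r hr
    have h2 := (quotHom hh a).comp S T p q r hr
    rw [Category.assoc, Category.assoc, descAt_proj, h1, ← Category.assoc (_ ⊗ₘ _),
      MonoidalCategory.tensorHom_comp_tensorHom, descAt_proj, descAt_proj,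
      ← MonoidalCategory.tensorHom_comp_tensorHom, Category.assoc, ← h2, ← Category.assoc,
      ← Category.assoc]
    exact K.limComp_limProj S T p q r hr a =≫ _

/-- The morphism out of the completion given by a filtered morphism to a complete operad. -/
def desc {h : RawHom E O.str.raw} (hh : PreservesFilt K O.filtration h) : K.completion ⟶ O :=
  (descRaw hh).toHom (descAt_isFiltered hh)

theorem completion_isFiltered_ext {V : CompleteGr A} {S : Type} [Finite S] {n m : ℤ}
    {f g : ev K.completion.mod S n ⟶ V.X m}
    (hf : IsFiltered (V := (K.completion.mod.obj (fin S)).toFilteredGr) (W := V.toFilteredGr) f)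
    (hg : IsFiltered (V := (K.completion.mod.obj (fin S)).toFilteredGr) (W := V.toFilteredGr) g)
    (h : (K.V S).toLim n ≫ f = (K.V S).toLim n ≫ g) : f = g :=
  completion_hom_ext (V := K.V S) (W := V) hf hg h

theorem toLim_desc {h : RawHom E O.str.raw} (hh : PreservesFilt K O.filtration h) (S : Type)
    [Finite S] (n : ℤ) : (K.V S).toLim n ≫ at_ (desc hh).hom S n = h.f S n :=
  toLim_descAt hh S n

end OperadFiltration

end CompletionDesc

/-! ### Free complete operads -/

/-- Formal iterated compositions of generators, with inputs labelled by `Fin m`, in degree `n`. -/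
inductive Term : ℕ → ℤ → Type
  | gen (m : ℕ) (n : ℤ) : Term m n
  | unit : Term 1 0
  -- The bijection `e` selects the input to be plugged and `e'` names the inputs of the result. Only
  -- the sets `Fin m` occur, so terms form a small type and coproducts over them exist.
  | comp {a b c d : ℕ} {p q r : ℤ} (e : Fin a ≃ Option (Fin b)) (e' : Fin b ⊕ Fin c ≃ Fin d)
      (h : p + q = r) (s : Term a p) (t : Term c q) : Term d r

section Free

variable {A : Type u} [Category.{v} A] [Abelian A] [MonoidalCategory A] [SymmetricCategory A]

open FilteredGr

variable (N : SMod (CompleteGr A))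

/-- The tensor product of the values of `N` at the generators of a formal composition. -/
@[reducible]
def Term.obj : {m : ℕ} → {n : ℤ} → Term m n → A
  | _, _, .gen m n => ev N (Fin m) n
  | _, _, .unit => 𝟙_ A
  | _, _, .comp _ _ _ s t => s.obj ⊗ t.obj

/-- Formal compositions with inputs labelled by a finite set. -/
abbrev LTerm (S : Type) (n : ℤ) : Type := Σ m : ℕ, (Fin m ≃ S) × Term m n

/-- The evaluation of a formal composition. -/
def Term.eval {N : SMod (CompleteGr A)} (O : Raw A)
    (f : ∀ (S : Type) [Finite S] (n : ℤ), ev N S n ⟶ O.X S n) :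
    {m : ℕ} → {n : ℤ} → (t : Term m n) → (t.obj N ⟶ O.X (Fin m) n)
  | _, _, .gen m n => f (Fin m) n
  | _, _, .unit => O.unit ≫ O.rel finOneEquiv.symm 0
  | _, _, .comp e e' h s t =>
      O.mul (s.eval O f ≫ O.rel e _) (t.eval O f) h ≫ O.rel e' _

variable [MonoidalClosed A] [HasCoproducts.{0} A]

/-- The free operadic data on `N`. -/
abbrev freeRaw : Raw A where
  -- Terms which an operad axiom would identify remain distinct summands here; the axioms only hold
  -- after completion.
  X S _ n := ∐ fun x : LTerm S n => x.2.2.obj N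
  rel e _ := Sigma.desc fun x =>
    Sigma.ι (fun x : LTerm _ _ => x.2.2.obj N) ⟨x.1, x.2.1.trans e, x.2.2⟩
  unit := Sigma.ι (fun x : LTerm Unit 0 => x.2.2.obj N) ⟨1, finOneEquiv, .unit⟩
  comp S T _ _ _ _ r h := tensorSigmaDesc fun x y =>
    Sigma.ι (fun x : LTerm (S ⊕ T) r => x.2.2.obj N)
      ⟨_, (Finite.equivFin (S ⊕ T)).symm,
        .comp (x.2.1.trans (Finite.equivFin S).optionCongr)
          (((Finite.equivFin S).symm.sumCongr y.2.1).trans (Finite.equivFin (S ⊕ T))) h x.2.2 y.2.2⟩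

variable {N} (O : CompleteOperad A) (f : N ⟶ O.mod)

/-- The evaluation of the free operadic data. -/
abbrev freeEval : RawHom (freeRaw N) O.str.raw where
  f S _ n := Sigma.desc fun x => x.2.2.eval O.str.raw (fun S _ n => at_ f S n) ≫ rel O.mod x.2.1 n
  rel e n := by
    refine Sigma.hom_ext _ _ fun x => ?_
    rw [Sigma.ι_desc_assoc, Sigma.ι_desc, Sigma.ι_desc_assoc, Category.assoc, rel_rel]
  unit := by
    rw [Sigma.ι_desc]
    change (O.str.unit ≫ rel O.mod _ 0) ≫ _ = _
    rw [Category.assoc, rel_rel, Equiv.symm_trans_self, rel_refl, Category.comp_id]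
  comp S T _ _ p q r h := by
    refine tensor_sigma_hom_ext fun x y => ?_
    rw [← Category.assoc, ι_tensorSigmaDesc, Sigma.ι_desc, ← Category.assoc,
      MonoidalCategory.tensorHom_comp_tensorHom, Sigma.ι_desc, Sigma.ι_desc]
    change (O.str.raw.mul (_ ≫ rel O.mod _ p) _ h ≫ rel O.mod _ r) ≫ rel O.mod _ r =
      O.str.raw.mul _ _ h
    -- The composition of `freeRaw` transports its labels to sets `Fin m`; equivariance in `O`
    -- undoes this transport.
    have := O.str.laws.equivariant (Finite.equivFin S) y.2.1.symm h
      (x.2.2.eval O.str.raw (fun S _ n => at_ f S n) ≫ rel O.mod x.2.1 p)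
      (y.2.2.eval O.str.raw (fun S _ n => at_ f S n) ≫ rel O.mod y.2.1 q)
    rw [Category.comp_id, Category.comp_id, Category.assoc, Category.assoc, rel_rel, rel_rel,
      Equiv.self_trans_symm, rel_refl, Category.comp_id] at this
    rw [this, Category.assoc, Category.assoc, rel_rel, rel_rel]
    have e : ((Finite.equivFin S).sumCongr y.2.1.symm).trans
      ((((Finite.equivFin S).symm.sumCongr y.2.1).trans (Finite.equivFin (S ⊕ T))).trans
        (Finite.equivFin (S ⊕ T)).symm) = Equiv.refl _ := by
      ext z
      rcases z with z | z <;> simp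
    rw [e, rel_refl, Category.comp_id]

end Free

/-! ### The filtration defined by evaluations, and the free complete operad. -/

section FreeOperad

variable {A : Type u} [Category.{v} A] [Abelian A] [MonoidalCategory A] [SymmetricCategory A]
  [MonoidalClosed A] [HasCoproducts.{0} A] [HasSubobjectInter A]

open FilteredGr OperadFiltration

section

variable (N : SMod (CompleteGr A))

/-- The coarsest filtration of the free operadic data for which all evaluations are filtered. -/
def freeFil (S : Type) [Finite S] (n : ℤ) (a : ℕ) : Subobject ((freeRaw N).X S n) :=
  -- The operads `O` range over a large collection, but they only contribute a set of subobjects of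
  -- one fixed object.
  subobjectInter {P | ∃ (O : CompleteOperad A) (f : N ⟶ O.mod),
    P = (Subobject.pullback ((freeEval O f).f S n)).obj (fil O.mod S n a)}

variable {N}

theorem freeFil_factors_iff {S : Type} [Finite S] {n : ℤ} {a : ℕ} {Z : A}
    (x : Z ⟶ (freeRaw N).X S n) : (freeFil N S n a).Factors x ↔
      ∀ (O : CompleteOperad A) (f : N ⟶ O.mod),
        (fil O.mod S n a).Factors (x ≫ (freeEval O f).f S n) := by
  rw [freeFil, subobjectInter_factors_iff]
  constructor
  · intro h O f
    exact (pullback_factors_iff _ _ _).1 (h _ ⟨O, f, rfl⟩)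
  · rintro h P ⟨O, f, rfl⟩
    exact (pullback_factors_iff _ _ _).2 (h O f)

variable (N)

/-- The filtration of the free operadic data whose completion is the free complete operad. -/
abbrev freeFiltration : OperadFiltration (freeRaw N) where
  F := freeFil N
  F_zero S _ n := by
    refine top_le_iff.1 (Subobject.le_of_factors ((freeFil_factors_iff _).2 fun O f => ?_))
    exact factors_of_eq_top _ ((O.mod.obj (fin S)).F_zero n)
  anti S _ n a b h := by
    refine Subobject.le_of_factors ((freeFil_factors_iff _).2 fun O f => ?_)
    exact Subobject.factors_of_le _ ((O.mod.obj (fin S)).anti n h)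
      ((freeFil_factors_iff _).1 (Subobject.factors_self _) O f)
  rel {S T} _ _ e n p := by
    refine (freeFil_factors_iff _).2 fun O f => ?_
    rw [Category.assoc, (freeEval O f).rel, ← Category.assoc]
    exact IsFiltered.factors (V := (O.mod.obj (fin S)).toFilteredGr)
      (W := (O.mod.obj (fin T)).toFilteredGr) ((O.mod.map (bij e)).filt n)
      ((freeFil_factors_iff _).1 (Subobject.factors_self _) O f)
  mul h _ _ _ _ x y hx hy := by
    refine (freeFil_factors_iff _).2 fun O f => ?_
    rw [(freeEval O f).mul]
    exact O.str.mul_factors h ((freeFil_factors_iff _).1 hx O f) ((freeFil_factors_iff _).1 hy O f)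
  laws a := by
    -- The axioms hold after evaluation in each `O`. Hence the difference of the two sides evaluates
    -- to zero everywhere and lies in `F_a`.
    refine Raw.LawsAlong.of_forall (I := Σ O : CompleteOperad A, N ⟶ O.mod)
      (k' := fun i S _ n => (freeEval i.1 i.2).f S n ≫ 𝟙 _) ?_
      fun i => i.1.str.laws.pull (freeEval i.1 i.2)
    intro S _ n Z x y h
    rw [← sub_eq_zero, ← Preadditive.sub_comp, ← factors_iff_comp_cokernel]
    refine (freeFil_factors_iff _).2 fun O f => ?_
    have := h ⟨O, f⟩
    simp only [Category.comp_id] at this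
    rw [Preadditive.sub_comp, this, sub_self]
    exact Subobject.factors_zero

/-- The difference evaluates to zero in all complete operads, so it belongs to every step of the
filtration. This is how relations enter the free operad without being imposed. -/
theorem proj_eq_of_eval_eq {S : Type} [Finite S] {n : ℤ} {Z : A} {x y : Z ⟶ (freeRaw N).X S n}
    (h : ∀ (O : CompleteOperad A) (f : N ⟶ O.mod),
      x ≫ (freeEval O f).f S n = y ≫ (freeEval O f).f S n) (a : ℕ) :
    x ≫ ((freeFiltration N).V S).proj n a = y ≫ ((freeFiltration N).V S).proj n a := by
  rw [← sub_eq_zero, ← Preadditive.sub_comp, ← factors_iff_comp_cokernel]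
  refine (freeFil_factors_iff _).2 fun O f => ?_
  rw [Preadditive.sub_comp, h, sub_self]
  exact Subobject.factors_zero

/-- The inclusion of the generators. -/
def genIncl (S : Type) [Finite S] (n : ℤ) : ev N S n ⟶ (freeRaw N).X S n :=
  rel N (Finite.equivFin S) n ≫ Sigma.ι (fun x : LTerm S n => x.2.2.obj N)
    ⟨Nat.card S, (Finite.equivFin S).symm, .gen _ n⟩

variable {N}

theorem genIncl_eval (O : CompleteOperad A) (f : N ⟶ O.mod) (S : Type) [Finite S] (n : ℤ) :
    genIncl N S n ≫ (freeEval O f).f S n = at_ f S n := by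
  rw [genIncl, Category.assoc, Sigma.ι_desc]
  change _ ≫ at_ f _ n ≫ _ = _
  rw [← Category.assoc, rel_at, Category.assoc, rel_rel, Equiv.self_trans_symm, rel_refl,
    Category.comp_id]

variable (N) [HasLimitsOfShape ℕᵒᵖ A]

/-- The free complete operad on `N`. -/
abbrev freeOperad : CompleteOperad A := (freeFiltration N).completion

theorem toLim_eq_of_eval_eq {S : Type} [Finite S] {n : ℤ} {Z : A} {x y : Z ⟶ (freeRaw N).X S n}
    (h : ∀ (O : CompleteOperad A) (f : N ⟶ O.mod),
      x ≫ (freeEval O f).f S n = y ≫ (freeEval O f).f S n) :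
    x ≫ ((freeFiltration N).V S).toLim n = y ≫ ((freeFiltration N).V S).toLim n := by
  refine lim_hom_ext _ fun a => ?_
  rw [Category.assoc, Category.assoc, toLim_limProj]
  exact proj_eq_of_eval_eq N h a

/-- The inclusion of the generators in the free complete operad. -/
def freeIncl : N ⟶ (freeOperad N).mod :=
  smodHom (fun S _ n => genIncl N S n ≫ ((freeFiltration N).V S).toLim n)
    (fun S _ n p => by
      rw [← Category.assoc]
      refine IsFiltered.factors (V := (freeFiltration N).V S)
        (W := ((freeOperad N).mod.obj (fin S)).toFilteredGr) (toLim_isFiltered _ n)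
        ((freeFil_factors_iff _).2 fun O f => ?_)
      rw [Category.assoc, genIncl_eval]
      exact (f.app (fin S)).filt n p)
    fun {S T} _ _ e n => by
      have := (freeFiltration N).toCompletion.rel e n
      rw [Category.assoc, ← this, ← Category.assoc, ← Category.assoc]
      refine toLim_eq_of_eval_eq N fun O f => ?_
      rw [Category.assoc, genIncl_eval, Category.assoc, (freeEval O f).rel, ← Category.assoc,
        genIncl_eval, rel_at]

theorem freeIncl_at (S : Type) [Finite S] (n : ℤ) :
    at_ (freeIncl N) S n = genIncl N S n ≫ ((freeFiltration N).V S).toLim n := rfl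

variable {N}

theorem freeEval_preservesFilt (O : CompleteOperad A) (f : N ⟶ O.mod) :
    PreservesFilt (freeFiltration N) O.filtration (freeEval O f) := fun _ _ _ _ =>
  (freeFil_factors_iff _).1 (Subobject.factors_self _) O f

/-- A family of filtered maps out of the free complete operad vanishes if it vanishes on the
generators and on the identity, and is compatible with relabelling and compositions. -/
theorem freeOperad_eq_zero {W : ∀ (S : Type) [Finite S], CompleteGr A} {k : ℤ → ℤ}
    (D : ∀ (S : Type) [Finite S] (n : ℤ), ev (freeOperad N).mod S n ⟶ (W S).X (k n))
    (hD : ∀ (S : Type) [Finite S] (n : ℤ), IsFiltered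
      (V := ((freeOperad N).mod.obj (fin S)).toFilteredGr) (W := (W S).toFilteredGr) (D S n))
    (hgen : ∀ (S : Type) [Finite S] (n : ℤ), at_ (freeIncl N) S n ≫ D S n = 0)
    (hunit : (freeOperad N).str.unit ≫ D Unit 0 = 0)
    (hrel : ∀ {S T : Type} [Finite S] [Finite T] (e : S ≃ T) (n : ℤ) {Z : A}
      (x : Z ⟶ ev (freeOperad N).mod S n), x ≫ D S n = 0 →
        (x ≫ rel (freeOperad N).mod e n) ≫ D T n = 0)
    (hmul : ∀ {S T : Type} [Finite S] [Finite T] {p q r : ℤ} (h : p + q = r) {Z Z' : A}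
      (x : Z ⟶ ev (freeOperad N).mod (Option S) p) (y : Z' ⟶ ev (freeOperad N).mod T q),
      x ≫ D (Option S) p = 0 → y ≫ D T q = 0 →
        (freeOperad N).str.raw.mul x y h ≫ D (S ⊕ T) r = 0)
    (S : Type) [Finite S] (n : ℤ) : D S n = 0 := by
  -- Induction on the term. In the completion, the inclusion of the summand of a term is the
  -- operation at its root applied to the inclusions for its subterms, because both have equal
  -- evaluations in all operads.
  have key : ∀ {m : ℕ} {n : ℤ} (t : Term m n),
      Sigma.ι (fun x : LTerm (Fin m) n => x.2.2.obj N) ⟨m, Equiv.refl _, t⟩ ≫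
        ((freeFiltration N).V (Fin m)).toLim n ≫ D (Fin m) n = 0 := by
    intro m n t
    induction t with
    | gen m n =>
      rw [← hgen (Fin m) n, freeIncl_at, Category.assoc, ← Category.assoc, ← Category.assoc]
      congr 1
      refine toLim_eq_of_eval_eq N fun O f => ?_
      rw [genIncl_eval, Sigma.ι_desc, rel_refl, Category.comp_id]
      rfl
    | unit =>
      rw [← Category.assoc]
      have := hrel finOneEquiv.symm 0 _ hunit
      refine Eq.trans ?_ this
      congr 1
      have h1 := (freeFiltration N).toCompletion.unit
      have h2 := (freeFiltration N).toCompletion.rel finOneEquiv.symm 0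
      refine Eq.trans ?_ (h1 =≫ rel (freeOperad N).mod finOneEquiv.symm 0)
      rw [Category.assoc, ← h2, ← Category.assoc]
      refine toLim_eq_of_eval_eq N fun O f => ?_
      rw [Category.assoc, (freeEval O f).rel, (freeEval O f).unit_assoc, Sigma.ι_desc, rel_refl,
        Category.comp_id]
      rfl
    | @comp a b c d p q r e e' h s t hs ht =>
      rw [← Category.assoc] at hs ht ⊢
      have := hrel e' r _ (hmul h _ _ (hrel e p _ hs) ht)
      refine Eq.trans ?_ this
      congr 1
      have h2 := (freeFiltration N).toCompletion.rel e p
      have h3 := (freeFiltration N).toCompletion.rel e' r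
      rw [Category.assoc, ← h2, ← Category.assoc _ ((freeRaw N).rel e p),
        ← (freeFiltration N).toCompletion.mul, Category.assoc, ← h3, ← Category.assoc]
      refine toLim_eq_of_eval_eq N fun O f => ?_
      rw [Category.assoc, (freeEval O f).rel, (freeEval O f).mul_assoc, Category.assoc,
        (freeEval O f).rel, Sigma.ι_desc, rel_refl, Category.comp_id, Sigma.ι_desc_assoc,
        Sigma.ι_desc, rel_refl, rel_refl, Category.comp_id, Category.comp_id]
      rfl
  -- A filtered map on the completion is determined on the coproduct of terms, and a summand with an
  -- arbitrary labelling is a relabelling of one with the identity labelling.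
  refine completion_isFiltered_ext (hD S n) isFiltered_zero ?_
  rw [comp_zero]
  refine Sigma.hom_ext _ _ fun x => ?_
  rw [comp_zero]
  have h1 := hrel x.2.1 n _ ((Category.assoc _ _ _).trans (key x.2.2))
  have h2 := (freeFiltration N).toCompletion.rel x.2.1 n
  rw [Category.assoc, Category.assoc, ← Category.assoc (((freeFiltration N).V _).toLim n), ← h2,
    Category.assoc, Sigma.ι_desc_assoc, Equiv.refl_trans] at h1
  exact h1

/-- The filtration makes evaluations filtered, so they extend to the completion. For uniqueness, the
difference of two morphisms is not a morphism of operads, but its vanishing propagates through all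
operations. -/
theorem isFreeOperad_freeOperad : IsFreeOperad (freeOperad N) (freeIncl N) := by
  intro O f
  refine ⟨desc (freeEval_preservesFilt O f), ?_, ?_⟩
  · refine smod_hom_ext fun S _ n => ?_
    have := toLim_desc (freeEval_preservesFilt O f) S n
    exact (Category.assoc _ _ _).trans ((_ ≫= this).trans (genIncl_eval O f S n))
  · intro g hg
    refine CompleteOperad.Hom.ext (smod_hom_ext fun S _ n => ?_)
    set g' := desc (freeEval_preservesFilt O f) with hg'
    have hf : ∀ (S : Type) [Finite S] (n : ℤ), at_ (freeIncl N) S n ≫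
        at_ g'.hom S n = at_ f S n := by
      intro S _ n
      have := toLim_desc (freeEval_preservesFilt O f) S n
      exact (Category.assoc _ _ _).trans ((_ ≫= this).trans (genIncl_eval O f S n))
    rw [← sub_eq_zero]
    refine freeOperad_eq_zero (W := fun S _ => O.mod.obj (fin S)) (k := id)
      (fun S _ n => at_ g.hom S n - at_ g'.hom S n) ?_ ?_ ?_ ?_ ?_ S n
    · intro S _ n
      exact IsFiltered.sub (V := ((freeOperad N).mod.obj (fin S)).toFilteredGr)
        (W := (O.mod.obj (fin S)).toFilteredGr)
        ((g.hom.app (fin S)).filt n) ((g'.hom.app (fin S)).filt n)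
    · intro S _ n
      rw [Preadditive.comp_sub, hf, ← hg]
      exact sub_self _
    · rw [Preadditive.comp_sub, g.isHom.unit, g'.isHom.unit, sub_self]
    · intro S T _ _ e n Z x hx
      rw [Preadditive.comp_sub, sub_eq_zero] at hx ⊢
      rw [Category.assoc, Category.assoc, rel_at, rel_at, reassoc_of% hx]
    · intro S T _ _ p q r h Z Z' x y hx hy
      rw [Preadditive.comp_sub, sub_eq_zero] at hx hy ⊢
      have h1 := g.isHom.rawHom.mul x y h
      have h2 := g'.isHom.rawHom.mul x y h
      rw [h1, h2, hx, hy]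

end

end FreeOperad

/-! ### Dual numbers and derivations -/

section Linearity

variable {A : Type u} [Category.{v} A] [Abelian A] [MonoidalCategory A] [MonoidalPreadditive A]

theorem units_smul_tensorHom (k : ℤˣ) {X Y Z W : A} (f : X ⟶ Y) (g : Z ⟶ W) :
    (k • f) ⊗ₘ g = k • (f ⊗ₘ g) := by
  rcases Int.units_eq_one_or k with rfl | rfl
  · rw [one_smul, one_smul]
  · rw [Units.neg_smul, one_smul, Units.neg_smul, one_smul, MonoidalCategory.tensorHom_def,
      MonoidalCategory.tensorHom_def, ← Preadditive.neg_comp]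
    congr 1
    exact (MonoidalCategory.tensorRight Z).map_neg

theorem tensorHom_units_smul (k : ℤˣ) {X Y Z W : A} (f : X ⟶ Y) (g : Z ⟶ W) :
    f ⊗ₘ (k • g) = k • (f ⊗ₘ g) := by
  rcases Int.units_eq_one_or k with rfl | rfl
  · rw [one_smul, one_smul]
  · rw [Units.neg_smul, one_smul, Units.neg_smul, one_smul, MonoidalCategory.tensorHom_def,
      MonoidalCategory.tensorHom_def, ← Preadditive.comp_neg]
    congr 1
    exact (MonoidalCategory.tensorLeft Y).map_neg

end Linearity

section Dual

variable {A : Type u} [Category.{v} A] [Abelian A] [MonoidalCategory A] [SymmetricCategory A]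
  [MonoidalPreadditive A]

namespace Raw

variable (P : Raw A) {S T : Type} [Finite S] [Finite T] {p q r : ℤ} {Z Z' : A}

theorem add_mul (x x' : Z ⟶ P.X (Option S) p) (y : Z' ⟶ P.X T q) (h : p + q = r) :
    P.mul (x + x') y h = P.mul x y h + P.mul x' y h := by
  rw [mul, mul, mul, MonoidalPreadditive.add_tensor, Preadditive.add_comp]

theorem mul_add (x : Z ⟶ P.X (Option S) p) (y y' : Z' ⟶ P.X T q) (h : p + q = r) :
    P.mul x (y + y') h = P.mul x y h + P.mul x y' h := by
  rw [mul, mul, mul, MonoidalPreadditive.tensor_add, Preadditive.add_comp]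

theorem units_smul_mul (k : ℤˣ) (x : Z ⟶ P.X (Option S) p) (y : Z' ⟶ P.X T q) (h : p + q = r) :
    P.mul (k • x) y h = k • P.mul x y h := by
  rw [mul, mul, units_smul_tensorHom, units_smul_comp]

theorem mul_units_smul (k : ℤˣ) (x : Z ⟶ P.X (Option S) p) (y : Z' ⟶ P.X T q) (h : p + q = r) :
    P.mul x (k • y) h = k • P.mul x y h := by
  rw [mul, mul, tensorHom_units_smul, units_smul_comp]

theorem zero_mul (y : Z' ⟶ P.X T q) (h : p + q = r) :
    P.mul (0 : Z ⟶ P.X (Option S) p) y h = 0 := by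
  rw [mul, MonoidalPreadditive.zero_tensor, zero_comp]

theorem mul_zero (x : Z ⟶ P.X (Option S) p) (h : p + q = r) :
    P.mul x (0 : Z' ⟶ P.X T q) h = 0 := by
  rw [mul, MonoidalPreadditive.tensor_zero, zero_comp]

theorem sub_mul (x x' : Z ⟶ P.X (Option S) p) (y : Z' ⟶ P.X T q) (h : p + q = r) :
    P.mul (x - x') y h = P.mul x y h - P.mul x' y h := by
  rw [eq_sub_iff_add_eq, ← add_mul, sub_add_cancel]

theorem mul_sub (x : Z ⟶ P.X (Option S) p) (y y' : Z' ⟶ P.X T q) (h : p + q = r) :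
    P.mul x (y - y') h = P.mul x y h - P.mul x y' h := by
  rw [eq_sub_iff_add_eq, ← mul_add, sub_add_cancel]

theorem sum_mul {I : Type} [Fintype I] (x : I → (Z ⟶ P.X (Option S) p)) (y : Z' ⟶ P.X T q)
    (h : p + q = r) : P.mul (∑ i, x i) y h = ∑ i, P.mul (x i) y h := by
  rw [mul, sum_tensor, Preadditive.sum_comp]
  rfl

theorem mul_sum {I : Type} [Fintype I] (x : Z ⟶ P.X (Option S) p) (y : I → (Z' ⟶ P.X T q))
    (h : p + q = r) : P.mul x (∑ i, y i) h = ∑ i, P.mul x (y i) h := by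
  rw [mul, tensor_sum, Preadditive.sum_comp]
  rfl

end Raw

open FilteredGr

variable (P : CompleteOperad A)

/-- The filtered objects underlying the dual numbers. -/
abbrev dualObj (S : Type) [Finite S] : CompleteGr A :=
  (P.mod.obj (fin S)).prod (P.mod.obj (fin S)).shift

/-- The first component. -/
abbrev dualFst (S : Type) [Finite S] (n : ℤ) : (dualObj P S).X n ⟶ ev P.mod S n :=
  fst (P.mod.obj (fin S)).toFilteredGr (P.mod.obj (fin S)).shift.toFilteredGr n

/-- The second component. -/
abbrev dualSnd (S : Type) [Finite S] (n : ℤ) : (dualObj P S).X n ⟶ ev P.mod S (n - 1) :=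
  snd (P.mod.obj (fin S)).toFilteredGr (P.mod.obj (fin S)).shift.toFilteredGr n

/-- The element with given components. -/
abbrev dualPair {P : CompleteOperad A} {S : Type} [Finite S] {n : ℤ} {Z : A} (x : Z ⟶ ev P.mod S n)
    (y : Z ⟶ ev P.mod S (n - 1)) : Z ⟶ (dualObj P S).X n :=
  pair (V := (P.mod.obj (fin S)).toFilteredGr) (W := (P.mod.obj (fin S)).shift.toFilteredGr) x y

theorem dual_factors_iff {S : Type} [Finite S] {n : ℤ} {a : ℕ} {Z : A}
    (x : Z ⟶ (dualObj P S).X n) : ((dualObj P S).F n a).Factors x ↔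
      (fil P.mod S n a).Factors (x ≫ dualFst P S n) ∧
        (fil P.mod S (n - 1) a).Factors (x ≫ dualSnd P S n) :=
  prod_factors_iff x

/-- The operadic data `P ⊕ ε P`, where `ε` has degree `1` and square `0`. -/
abbrev dualCRaw : CRaw A where
  V := fun S _ => dualObj P S
  rel {S T} _ _ e :=
    { f := fun n => dualPair (dualFst P S n ≫ rel P.mod e n) (dualSnd P S n ≫ rel P.mod e (n - 1))
      filt := fun n a => by
        rw [dual_factors_iff]
        have h := (dual_factors_iff P _).1 ((dualObj P S).F n a).factors_self
        refine ⟨?_, ?_⟩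
        · rw [Category.assoc, pair_fst, ← Category.assoc]
          exact (P.filtration.rel e n a |> factors_comp_of_factors) h.1
        · rw [Category.assoc, pair_snd, ← Category.assoc]
          exact (P.filtration.rel e (n - 1) a |> factors_comp_of_factors) h.2 }
  unit := dualPair P.str.unit 0
  -- In an element `x + ε y` of degree `p`, the part `y` has degree `p - 1`. Moving `ε` to the front
  -- past `x` in `x ∘ ε y'` costs the sign `(-1) ^ p`.
  comp S T _ _ p q r h := dualPair
    (P.str.raw.mul (dualFst P (Option S) p) (dualFst P T q) h)
    (P.str.raw.mul (dualSnd P (Option S) p) (dualFst P T q) (by omega) +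
      p.negOnePow • P.str.raw.mul (dualFst P (Option S) p) (dualSnd P T q) (by omega))
  comp_filt S T _ _ p q r h a b := by
    rw [dual_factors_iff]
    have hx := (dual_factors_iff P _).1 ((dualObj P (Option S)).F p a).factors_self
    have hy := (dual_factors_iff P _).1 ((dualObj P T).F q b).factors_self
    refine ⟨?_, ?_⟩
    · rw [Category.assoc, pair_fst, Raw.tensor_mul]
      exact P.str.mul_factors _ hx.1 hy.1
    · rw [Category.assoc, pair_snd, Preadditive.comp_add, comp_units_smul, Raw.tensor_mul,
        Raw.tensor_mul]
      exact Subobject.factors_add _ _ (P.str.mul_factors _ hx.2 hy.1)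
        (factors_units_smul _ (P.str.mul_factors _ hx.1 hy.2))

section

variable {P} {S T : Type} [Finite S] [Finite T] {p q r : ℤ} {Z Z' : A}

theorem dual_mul_fst (x : Z ⟶ (dualObj P (Option S)).X p) (y : Z' ⟶ (dualObj P T).X q)
    (h : p + q = r) : (dualCRaw P).raw.mul x y h ≫ dualFst P (S ⊕ T) r =
      P.str.raw.mul (x ≫ dualFst P (Option S) p) (y ≫ dualFst P T q) h := by
  rw [Raw.mul, Category.assoc, pair_fst, Raw.tensor_mul]

theorem dual_mul_snd (x : Z ⟶ (dualObj P (Option S)).X p) (y : Z' ⟶ (dualObj P T).X q)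
    (h : p + q = r) : (dualCRaw P).raw.mul x y h ≫ dualSnd P (S ⊕ T) r =
      P.str.raw.mul (x ≫ dualSnd P (Option S) p) (y ≫ dualFst P T q) (by omega) +
      p.negOnePow • P.str.raw.mul (x ≫ dualFst P (Option S) p) (y ≫ dualSnd P T q) (by omega) := by
  rw [Raw.mul, Category.assoc, pair_snd, Preadditive.comp_add, comp_units_smul, Raw.tensor_mul,
    Raw.tensor_mul]

theorem dual_rel_fst (e : S ≃ T) (n : ℤ) : (dualCRaw P).raw.rel e n ≫ dualFst P T n =
    dualFst P S n ≫ rel P.mod e n := pair_fst _ _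

theorem dual_rel_snd (e : S ≃ T) (n : ℤ) : (dualCRaw P).raw.rel e n ≫ dualSnd P T n =
    dualSnd P S n ≫ rel P.mod e (n - 1) := pair_snd _ _

end

/-- The first components give the axiom for `P`. Since `ε² = 0`, the second components are sums of
instances of the same axiom with one argument replaced by its `ε`-part, of degree one lower; only
signs remain to be compared. -/
theorem dual_laws : (dualCRaw P).raw.Laws where
  rel_refl S _ n := by
    rw [Category.comp_id]
    refine prod_hom_ext ?_ ?_
    · rw [dual_rel_fst, rel_refl, Category.comp_id, Category.id_comp]
    · rw [dual_rel_snd, rel_refl, Category.comp_id, Category.id_comp]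
  rel_trans e e' n := by
    rw [Category.comp_id, Category.comp_id]
    refine prod_hom_ext ?_ ?_
    · rw [Category.assoc, dual_rel_fst, dual_rel_fst, ← Category.assoc, dual_rel_fst,
        Category.assoc, rel_rel]
    · rw [Category.assoc, dual_rel_snd, dual_rel_snd, ← Category.assoc, dual_rel_snd,
        Category.assoc, rel_rel]
  equivariant e e' p q r h Z Z' x y := by
    have H := @Raw.LawsAlong.equivariant _ _ _ _ _ _ _ _ P.str.laws
    simp only [Category.comp_id] at H ⊢
    refine prod_hom_ext ?_ ?_
    · rw [dual_mul_fst, Category.assoc x, dual_rel_fst, Category.assoc y, dual_rel_fst,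
        Category.assoc ((dualCRaw P).raw.mul x y h), dual_rel_fst, ← Category.assoc,
        ← Category.assoc, ← Category.assoc, dual_mul_fst]
      exact H e e' _ _ _
    · rw [dual_mul_snd, Category.assoc x, Category.assoc x, dual_rel_fst, dual_rel_snd,
        Category.assoc y, Category.assoc y, dual_rel_fst, dual_rel_snd,
        Category.assoc ((dualCRaw P).raw.mul x y h), dual_rel_snd, ← Category.assoc x,
        ← Category.assoc x, ← Category.assoc y, ← Category.assoc y, ← Category.assoc, dual_mul_snd,
        Preadditive.add_comp, units_smul_comp, H e e', H e e']
  comp_unit x := by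
    have H := @Raw.LawsAlong.comp_unit _ _ _ _ _ _ _ _ P.str.laws
    simp only [Category.comp_id] at H ⊢
    refine prod_hom_ext ?_ ?_
    · rw [Category.assoc, dual_mul_fst, pair_fst, H, Category.assoc, Category.assoc, dual_rel_fst]
    · rw [Category.assoc, dual_mul_snd, pair_fst, pair_snd, Raw.mul_zero, smul_zero, add_zero, H,
        Category.assoc, Category.assoc, dual_rel_snd]
  unit_comp y := by
    have H := @Raw.LawsAlong.unit_comp _ _ _ _ _ _ _ _ P.str.laws
    simp only [Category.comp_id] at H ⊢
    refine prod_hom_ext ?_ ?_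
    · rw [Category.assoc, Category.assoc, dual_rel_fst, ← Category.assoc _ (dualFst P _ _),
        dual_mul_fst, Category.assoc, dual_rel_fst, pair_fst_assoc, H]
    · rw [Category.assoc, Category.assoc, dual_rel_snd, ← Category.assoc _ (dualSnd P _ _),
        dual_mul_snd, Category.assoc, Category.assoc, dual_rel_fst, dual_rel_snd, pair_fst_assoc,
        pair_snd_assoc, zero_comp, Raw.zero_mul, zero_add, Int.negOnePow_zero, one_smul, H]
  seq {S T U} _ _ _ {p q r pq qr s} h h' h₁ h₂ Z Z' Z'' x y z := by
    have H := @Raw.LawsAlong.seq _ _ _ _ _ _ _ _ P.str.laws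
    simp only [Category.comp_id] at H ⊢
    refine prod_hom_ext ?_ ?_
    · rw [dual_mul_fst, Category.assoc, Category.assoc, Category.assoc, dual_rel_fst, dual_rel_fst,
        ← Category.assoc _ (dualFst P _ _), dual_mul_fst, ← Category.assoc _ (dualFst P _ _),
        dual_mul_fst, dual_mul_fst, H]
    · rw [dual_mul_snd, Category.assoc, Category.assoc, Category.assoc, Category.assoc,
        dual_rel_fst, dual_rel_snd, dual_rel_snd,
        ← Category.assoc _ (dualFst P _ _), dual_mul_fst, ← Category.assoc _ (dualSnd P _ _),
        dual_mul_snd, ← Category.assoc _ (dualSnd P _ _), dual_mul_snd, dual_mul_fst, dual_mul_snd,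
        Preadditive.add_comp, Raw.add_mul, units_smul_comp, Raw.units_smul_mul, Raw.mul_add,
        Raw.mul_units_smul, smul_add, smul_smul, Preadditive.add_comp, Preadditive.add_comp,
        Preadditive.comp_add, Preadditive.comp_add, units_smul_comp, units_smul_comp,
        comp_units_smul, comp_units_smul, ← Int.negOnePow_add, h, add_assoc,
        H (qr := qr) _ h' _ (by omega), H (qr := qr - 1) _ (by omega) _ (by omega),
        H (qr := qr - 1) _ (by omega) _ (by omega)]
  par {S T U} _ _ _ {p q r pq pr s} h h' h₁ h₂ Z Z' Z'' x y z := by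
    have H := @Raw.LawsAlong.par _ _ _ _ _ _ _ _ P.str.laws
    simp only [Category.comp_id] at H ⊢
    -- Here `pq` and `pr` are the sums `p + q` and `p + r`. The two identities match the Koszul
    -- signs when the `ε`-part is taken in the third and in the second argument.
    have s1 : (pq.negOnePow * (q * (r - 1)).negOnePow) = (q * r).negOnePow * p.negOnePow := by
      rw [← Int.negOnePow_add, ← Int.negOnePow_add, Int.negOnePow_eq_iff]
      exact ⟨0, by rw [← h]; ring⟩
    have s2 : (p.negOnePow * ((q - 1) * r).negOnePow) = (q * r).negOnePow * pr.negOnePow := by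
      rw [← Int.negOnePow_add, ← Int.negOnePow_add, Int.negOnePow_eq_iff]
      exact ⟨-r, by rw [← h']; ring⟩
    refine prod_hom_ext ?_ ?_
    · rw [dual_mul_fst, units_smul_comp]
      simp only [Category.assoc]
      rw [dual_rel_fst, dual_rel_fst, ← Category.assoc _ (dualFst P _ _), dual_mul_fst,
        ← Category.assoc _ (dualFst P _ _) (rel P.mod (sumSwap S T U) s), dual_mul_fst,
        Category.assoc, dual_rel_fst, ← Category.assoc _ (dualFst P _ _), dual_mul_fst,
        H (pr := pr) _ h' _ h₂, Category.assoc, Category.assoc, dual_rel_fst]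
    · rw [dual_mul_snd, units_smul_comp]
      simp only [Category.assoc]
      rw [dual_rel_fst, dual_rel_snd, dual_rel_snd, ← Category.assoc _ (dualFst P _ _),
        dual_mul_fst, ← Category.assoc _ (dualSnd P _ _), dual_mul_snd,
        ← Category.assoc _ (dualSnd P _ _) (rel P.mod (sumSwap S T U) (s - 1)), dual_mul_snd,
        Category.assoc, Category.assoc, dual_rel_fst, dual_rel_snd,
        ← Category.assoc _ (dualFst P _ _), dual_mul_fst, ← Category.assoc _ (dualSnd P _ _),
        dual_mul_snd, Category.assoc, Category.assoc, dual_rel_fst, dual_rel_snd]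
      have H₁ := H (pr := pr - 1) (s := s - 1) (show p - 1 + q = pq - 1 by omega) (by omega)
        (show pq - 1 + r = s - 1 by omega) (by omega)
        (x ≫ dualSnd P (Option (Option S)) p) (y ≫ dualFst P T q) (z ≫ dualFst P U r)
      have H₂ := H (pr := pr) (s := s - 1) (show p + (q - 1) = pq - 1 by omega) h'
        (show pq - 1 + r = s - 1 by omega) (by omega)
        (x ≫ dualFst P (Option (Option S)) p) (y ≫ dualSnd P T q) (z ≫ dualFst P U r)
      have H₃ := H (pr := pr - 1) (s := s - 1) h (show p + (r - 1) = pr - 1 by omega)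
        (show pq + (r - 1) = s - 1 by omega) (by omega)
        (x ≫ dualFst P (Option (Option S)) p) (y ≫ dualFst P T q) (z ≫ dualSnd P U r)
      rw [Preadditive.add_comp, Raw.add_mul, units_smul_comp, Raw.units_smul_mul, H₁, H₂, H₃,
        Preadditive.add_comp _ _ _ (P.str.raw.mul _ _ _) _ _, Preadditive.add_comp _ _ _
          (P.str.raw.mul _ _ _) _ (rel P.mod (optLeft S U) (pr - 1)), Raw.add_mul,
        units_smul_comp p.negOnePow, Raw.units_smul_mul]
      simp only [Preadditive.add_comp, Preadditive.comp_add, units_smul_comp, comp_units_smul,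
        smul_add, smul_smul, s1, s2]
      simp only [Category.assoc]
      abel

/-- The dual numbers. -/
abbrev dualOperad : CompleteOperad A := (dualCRaw P).toOperad (dual_laws P)

end Dual

/-! ### Generation by a submodule, element forms of the axioms, and derivations. -/

section Derivations

variable {A : Type u} [Category.{v} A] [Abelian A] [MonoidalCategory A] [SymmetricCategory A]

open FilteredGr

/-- A family of filtered maps out of `T` vanishes if it vanishes on `N` and on the identity, and is
compatible with relabelling and compositions. -/
def IsGeneratedBy {N : SMod (CompleteGr A)} (T : CompleteOperad A) (j : N ⟶ T.mod) : Prop :=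
  ∀ {W : ∀ (S : Type) [Finite S], CompleteGr A} {k : ℤ → ℤ}
    (D : ∀ (S : Type) [Finite S] (n : ℤ), ev T.mod S n ⟶ (W S).X (k n))
    (_ : ∀ (S : Type) [Finite S] (n : ℤ), IsFiltered
      (V := (T.mod.obj (fin S)).toFilteredGr) (W := (W S).toFilteredGr) (D S n))
    (_ : ∀ (S : Type) [Finite S] (n : ℤ), at_ j S n ≫ D S n = 0)
    (_ : T.str.unit ≫ D Unit 0 = 0)
    (_ : ∀ {S S' : Type} [Finite S] [Finite S'] (e : S ≃ S') (n : ℤ) {Z : A}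
      (x : Z ⟶ ev T.mod S n), x ≫ D S n = 0 → (x ≫ rel T.mod e n) ≫ D S' n = 0)
    (_ : ∀ {S S' : Type} [Finite S] [Finite S'] {p q r : ℤ} (h : p + q = r) {Z Z' : A}
      (x : Z ⟶ ev T.mod (Option S) p) (y : Z' ⟶ ev T.mod S' q),
      x ≫ D (Option S) p = 0 → y ≫ D S' q = 0 → T.str.raw.mul x y h ≫ D (S ⊕ S') r = 0)
    (S : Type) [Finite S] (n : ℤ), D S n = 0

theorem OperadStr.unit_comp_element {P : SMod (CompleteGr A)} (o : OperadStr P) {T : Type}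
    [Finite T] {q : ℤ} {Z : A} (y : Z ⟶ ev P T q) :
    (λ_ Z).inv ≫ o.raw.mul (o.unit ≫ rel P pointEquiv 0) y (zero_add q) ≫
      rel P (Equiv.emptySum Empty T) q = y := by
  have := o.laws.unit_comp y
  rw [Category.comp_id, Category.comp_id] at this
  exact this

theorem OperadStr.comp_unit_element {P : SMod (CompleteGr A)} (o : OperadStr P) {S : Type}
    [Finite S] {p : ℤ} {Z : A} (x : Z ⟶ ev P (Option S) p) :
    (ρ_ Z).inv ≫ o.raw.mul x o.unit (add_zero p) = x ≫ rel P (Equiv.optionEquivSumPUnit S) p := by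
  have := o.laws.comp_unit x
  rw [Category.comp_id, Category.comp_id] at this
  exact this

theorem OperadStr.equivariant_element {P : SMod (CompleteGr A)} (o : OperadStr P)
    {S S' T T' : Type} [Finite S] [Finite S'] [Finite T] [Finite T']
    (e : S ≃ S') (e' : T ≃ T') {p q r : ℤ} (h : p + q = r) {Z Z' : A}
    (x : Z ⟶ ev P (Option S) p) (y : Z' ⟶ ev P T q) :
    o.raw.mul (x ≫ rel P e.optionCongr p) (y ≫ rel P e' q) h =
      o.raw.mul x y h ≫ rel P (e.sumCongr e') r := by
  have := o.laws.equivariant e e' h x y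
  rw [Category.comp_id, Category.comp_id] at this
  exact this

theorem OperadStr.seq_element {P : SMod (CompleteGr A)} (o : OperadStr P) {S T U : Type}
    [Finite S] [Finite T] [Finite U] {p q r pq qr s : ℤ}
    (h : p + q = pq) (h' : q + r = qr) (h₁ : pq + r = s) (h₂ : p + qr = s) {Z Z' Z'' : A}
    (x : Z ⟶ ev P (Option S) p) (y : Z' ⟶ ev P (Option T) q) (z : Z'' ⟶ ev P U r) :
    o.raw.mul (o.raw.mul x y h ≫ rel P (optRight S T) pq) z h₁ =
      (α_ _ _ _).hom ≫ o.raw.mul x (o.raw.mul y z h') h₂ ≫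
        rel P (Equiv.sumAssoc S T U).symm s := by
  have := o.laws.seq h h' h₁ h₂ x y z
  rw [Category.comp_id, Category.comp_id] at this
  exact this

theorem OperadStr.par_element {P : SMod (CompleteGr A)} (o : OperadStr P) {S T U : Type}
    [Finite S] [Finite T] [Finite U] {p q r pq pr s : ℤ}
    (h : p + q = pq) (h' : p + r = pr) (h₁ : pq + r = s) (h₂ : pr + q = s) {Z Z' Z'' : A}
    (x : Z ⟶ ev P (Option (Option S)) p) (y : Z' ⟶ ev P T q) (z : Z'' ⟶ ev P U r) :
    o.raw.mul (o.raw.mul x y h ≫ rel P (optLeft S T) pq) z h₁ =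
      (q * r).negOnePow • ((α_ _ _ _).hom ≫ (Z ◁ (β_ Z' Z'').hom) ≫ (α_ _ _ _).inv ≫
        o.raw.mul (o.raw.mul (x ≫ rel P (optSwap S) p) z h' ≫ rel P (optLeft S U) pr) y h₂ ≫
        rel P (sumSwap S T U) s) := by
  have := o.laws.par h h' h₁ h₂ x y z
  rw [Category.comp_id, Category.comp_id] at this
  exact this

variable [MonoidalPreadditive A]

theorem Leibniz.mul {P : SMod (CompleteGr A)} {o : OperadStr P} {d : DegNegOne P}
    (hd : Leibniz o d) {S T : Type} [Finite S] [Finite T] {p p' q q' r r' : ℤ} (hp : p' + 1 = p)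
    (hq : q' + 1 = q) (hr : r' + 1 = r) (h : p + q = r) {Z Z' : A}
    (x : Z ⟶ ev P (Option S) p) (y : Z' ⟶ ev P T q) :
    o.raw.mul x y h ≫ d (S ⊕ T) r r' hr =
      o.raw.mul (x ≫ d (Option S) p p' hp) y (by omega) +
        p.negOnePow • o.raw.mul x (y ≫ d T q q' hq) (by omega) := by
  rw [Raw.mul, Category.assoc, hd S T p p' q q' r r' hp hq hr h (by omega) (by omega),
    Preadditive.comp_add, comp_units_smul, ← tensorHom_id, ← id_tensorHom, Raw.mul, Raw.mul,
    MonoidalCategory.tensorHom_comp_tensorHom_assoc,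
    MonoidalCategory.tensorHom_comp_tensorHom_assoc, Category.comp_id, Category.comp_id]

/-- A derivation vanishes on the identity operation. -/
theorem IsDerivation.unit {P : CompleteOperad A} {d : DegNegOne P.mod} (hd : IsDerivation P d)
    (m : ℤ) (h : m + 1 = 0) : P.str.unit ≫ d Unit 0 m h = 0 := by
  -- Differentiating `id ∘ id = id` gives `d id = d id ∘ id + id ∘ d id`. The first summand is
  -- already `d id`, so the second vanishes, and it is `d id` too.
  have h1 := P.str.comp_unit_element (P.str.unit ≫ rel P.mod pointEquiv 0)
  have h2 := h1 =≫ d _ 0 m h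
  rw [Category.assoc, hd.leibniz.mul h h h, Category.assoc _ (rel P.mod _ 0), hd.equivariant,
    Category.assoc, hd.equivariant, Int.negOnePow_zero, one_smul, Preadditive.comp_add] at h2
  have h3 := P.str.comp_unit_element (P.str.unit ≫ d Unit 0 m h ≫ rel P.mod pointEquiv m)
  have h4 := P.str.unit_comp_element (P.str.unit ≫ d Unit 0 m h)
  have h5 := hd.equivariant _ _ pointEquiv 0 m h
  rw [Category.assoc _ (rel P.mod pointEquiv 0), reassoc_of% h5, h3, Category.assoc,
    Category.assoc, add_eq_left, ← unitors_inv_equal] at h2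
  rw [← h4, ← Category.assoc, h2, zero_comp]

end Derivations

/-! ### Derivations as morphisms to the dual numbers. -/

section DualHom

variable {A : Type u} [Category.{v} A] [Abelian A] [MonoidalCategory A] [SymmetricCategory A]
  [MonoidalPreadditive A]

open FilteredGr

/-- The projection from the dual numbers. -/
def dualProj (P : CompleteOperad A) : dualOperad P ⟶ P :=
  RawHom.toHom (P := dualOperad P) (Q := P)
    { f := fun S _ n => dualFst P S n
      rel := fun e n => dual_rel_fst e n
      unit := pair_fst _ _
      comp := fun _ _ _ _ _ _ _ _ => pair_fst _ _ }
    (fun _ _ n => fst_isFiltered n)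

/-- A section of the projection from the dual numbers defines a derivation. -/
theorem exists_derivation_of_section {T : CompleteOperad A} (φ : T ⟶ dualOperad T)
    (hφ : φ ≫ dualProj T = 𝟙 T) : ∃ d : DegNegOne T.mod, IsDerivation T d ∧
      ∀ (S : Type) [Finite S] (n : ℤ),
        d S n (n - 1) (sub_add_cancel n 1) = at_ φ.hom S n ≫ dualSnd T S n := by
  have hφ1 : ∀ (S : Type) [Finite S] (n : ℤ), at_ φ.hom S n ≫ dualFst T S n = 𝟙 _ := fun S _ n =>
    congrArg (fun k : T ⟶ T => at_ k.hom S n) hφ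
  -- The second component lands in degree `n - 1`, which is only propositionally equal to `m`.
  let d : DegNegOne T.mod := fun S _ n m h =>
    at_ φ.hom S n ≫ dualSnd T S n ≫ eqToHom (by rw [← h, add_sub_cancel_right])
  have hd : ∀ (S : Type) [Finite S] (n : ℤ), d S n (n - 1) (sub_add_cancel n 1) =
      at_ φ.hom S n ≫ dualSnd T S n := fun S _ n => by
    change _ ≫ _ ≫ 𝟙 _ = _
    rw [Category.comp_id]
  refine ⟨d, ⟨?_, ?_, ?_⟩, hd⟩
  · intro S _ n m h p
    obtain rfl : m = n - 1 := by omega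
    rw [hd]
    exact IsFiltered.comp (V := (T.mod.obj (fin S)).toFilteredGr)
      (W := (dualObj T S).toFilteredGr) (U := (T.mod.obj (fin S)).shift.toFilteredGr)
      ((φ.hom.app (fin S)).filt n) (snd_isFiltered n) p
  · intro S S' _ _ e n m h
    obtain rfl : m = n - 1 := by omega
    have h1 := rel_at φ.hom e n
    have h2 := dual_rel_snd (P := T) e n
    rw [hd, hd, Category.assoc, ← h2, ← Category.assoc, h1, Category.assoc]
    rfl
  · intro S S' _ _ p p' q q' r r' hp hq hr h h₁ h₂
    obtain rfl : p' = p - 1 := by omega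
    obtain rfl : q' = q - 1 := by omega
    obtain rfl : r' = r - 1 := by omega
    rw [hd, hd, hd, ← Category.assoc, φ.isHom.comp]
    have h1 := dual_mul_snd (P := T) (at_ φ.hom (Option S) p) (at_ φ.hom S' q) h
    refine h1.trans ?_
    rw [hφ1, hφ1, Raw.mul, Raw.mul, tensorHom_id, id_tensorHom]

/-- Every filtered equivariant map of degree `-1` on the generators extends to a derivation of the
free operad. -/
theorem IsFreeOperad.exists_derivation {N : SMod (CompleteGr A)} {T : CompleteOperad A}
    {j : N ⟶ T.mod} (hT : IsFreeOperad T j)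
    (δ : ∀ (S : Type) [Finite S] (n m : ℤ), m + 1 = n → (ev N S n ⟶ ev T.mod S m))
    (hδ : ∀ (S : Type) [Finite S] (n m : ℤ) (h : m + 1 = n), IsFiltered
      (V := (N.obj (fin S)).toFilteredGr) (W := (T.mod.obj (fin S)).toFilteredGr) (δ S n m h))
    (hr : ∀ {S S' : Type} [Finite S] [Finite S'] (e : S ≃ S') (n m : ℤ) (h : m + 1 = n),
      rel N e n ≫ δ S' n m h = δ S n m h ≫ rel T.mod e m) :
    ∃ d : DegNegOne T.mod, IsDerivation T d ∧ ∀ (S : Type) [Finite S] (n m : ℤ) (h : m + 1 = n),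
      at_ j S n ≫ d S n m h = δ S n m h := by
  -- This is `j + ε δ`; its extension to `T` will be `id + ε d`.
  let f : N ⟶ (dualOperad T).mod := smodHom
    (fun S _ n => dualPair (at_ j S n) (δ S n (n - 1) (by omega)))
    (fun S _ n a => by
      refine (dual_factors_iff T _).2 ⟨?_, ?_⟩
      · rw [Category.assoc, pair_fst]
        exact (j.app (fin S)).filt n a
      · rw [Category.assoc, pair_snd]
        exact hδ S n _ _ a)
    (fun e n => by
      refine prod_hom_ext ?_ ?_
      · have := dual_rel_fst (P := T) e n
        refine ((Category.assoc _ _ _).trans (_ ≫= pair_fst _ _)).trans ?_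
        refine Eq.trans ?_ ((Category.assoc _ _ _).trans (_ ≫= this)).symm
        rw [pair_fst_assoc, rel_at]
      · have := dual_rel_snd (P := T) e n
        refine ((Category.assoc _ _ _).trans (_ ≫= pair_snd _ _)).trans ?_
        refine Eq.trans ?_ ((Category.assoc _ _ _).trans (_ ≫= this)).symm
        rw [pair_snd_assoc, hr])
  obtain ⟨φ, hφ, -⟩ := hT (dualOperad T) f
  -- The first component of the extension restricts to `j`, so freeness forces it to be the
  -- identity.
  have hfst : φ ≫ dualProj T = 𝟙 T := by
    refine (hT T j).unique ?_ (Category.comp_id _)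
    change j ≫ φ.hom ≫ (dualProj T).hom = j
    rw [← Category.assoc, hφ]
    exact smod_hom_ext fun S _ n => pair_fst _ _
  obtain ⟨d, hd, hd'⟩ := exists_derivation_of_section φ hfst
  refine ⟨d, hd, fun S _ n m h => ?_⟩
  obtain rfl : m = n - 1 := by omega
  have h1 : at_ j S n ≫ at_ φ.hom S n = at_ f S n := congrArg (fun k => at_ k S n) hφ
  rw [hd', ← Category.assoc, h1]
  exact pair_snd _ _

/-- A derivation of `T`, followed by a morphism `T ⟶ Q`, as a morphism to the dual numbers. -/
def IsDerivation.dualHom {T Q : CompleteOperad A} {d : DegNegOne T.mod} (hd : IsDerivation T d)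
    (π : T ⟶ Q) : T ⟶ dualOperad Q :=
  RawHom.toHom (P := T) (Q := dualOperad Q)
    { f := fun S _ n => dualPair (at_ π.hom S n) (d S n (n - 1) (by omega) ≫ at_ π.hom S (n - 1))
      rel := fun {S S'} _ _ e n => by
        refine prod_hom_ext ?_ ?_
        · refine ((Category.assoc _ _ _).trans (_ ≫= pair_fst _ _)).trans ?_
          refine Eq.trans ?_ ((Category.assoc _ _ _).trans
            (_ ≫= dual_rel_fst (P := Q) e n)).symm
          rw [pair_fst_assoc, rel_at]
        · refine ((Category.assoc _ _ _).trans (_ ≫= pair_snd _ _)).trans ?_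
          refine Eq.trans ?_ ((Category.assoc _ _ _).trans
            (_ ≫= dual_rel_snd (P := Q) e n)).symm
          rw [pair_snd_assoc, Category.assoc, ← rel_at, ← Category.assoc, hd.equivariant,
            Category.assoc]
      unit := by
        refine prod_hom_ext ?_ ?_
        · rw [Category.assoc, pair_fst, pair_fst, π.isHom.unit]
        · rw [Category.assoc, pair_snd, pair_snd, ← Category.assoc, hd.unit, zero_comp]
      comp := fun S S' _ _ p q r h => by
        refine prod_hom_ext ?_ ?_
        · refine Eq.trans ?_ (dual_mul_fst (P := Q) _ _ h).symm
          rw [Category.assoc, pair_fst, pair_fst, pair_fst]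
          exact π.isHom.comp S S' p q r h
        · refine Eq.trans ?_ (dual_mul_snd (P := Q) _ _ h).symm
          have h1 := hd.leibniz.mul (p' := p - 1) (q' := q - 1) (r' := r - 1) (by omega) (by omega)
            (by omega) h (𝟙 (ev T.mod (Option S) p)) (𝟙 (ev T.mod S' q))
          rw [Raw.mul, id_tensorHom_id, Category.id_comp, Category.id_comp, Category.id_comp] at h1
          have h2 := π.isHom.rawHom.mul (d (Option S) p (p - 1) (by omega)) (𝟙 (ev T.mod S' q))
            (show p - 1 + q = r - 1 by omega)
          have h3 := π.isHom.rawHom.mul (𝟙 (ev T.mod (Option S) p)) (d S' q (q - 1) (by omega))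
            (show p + (q - 1) = r - 1 by omega)
          rw [Category.id_comp] at h2 h3
          rw [Category.assoc, pair_snd, ← Category.assoc, h1, Preadditive.add_comp, units_smul_comp,
            h2, h3, pair_fst, pair_fst, pair_snd, pair_snd] }
    (fun S _ n a => by
      refine (dual_factors_iff Q _).2 ⟨?_, ?_⟩
      · rw [Category.assoc, pair_fst]
        exact (π.hom.app (fin S)).filt n a
      · rw [Category.assoc, pair_snd, ← Category.assoc]
        exact factors_comp_of_factors ((π.hom.app (fin S)).filt (n - 1) a)
          (hd.filt S n (n - 1) (by omega) a))

/-- Both derivations vanish on the identity, and the Leibniz rule propagates agreement through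
compositions, so generation applies to their difference. This is a family of degree `-1`, not a
morphism. -/
theorem IsGeneratedBy.derivation_ext {N : SMod (CompleteGr A)} {T : CompleteOperad A}
    {j : N ⟶ T.mod} (hT : IsGeneratedBy T j) {d d' : DegNegOne T.mod} (hd : IsDerivation T d)
    (hd' : IsDerivation T d')
    (h : ∀ (S : Type) [Finite S] (n m : ℤ) (h : m + 1 = n),
      at_ j S n ≫ d S n m h = at_ j S n ≫ d' S n m h)
    (S : Type) [Finite S] (n m : ℤ) (hm : m + 1 = n) : d S n m hm = d' S n m hm := by
  obtain rfl : m = n - 1 := by omega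
  rw [← sub_eq_zero]
  refine hT (W := fun S _ => T.mod.obj (fin S)) (k := fun n => n - 1)
    (fun S _ n => d S n (n - 1) (by omega) - d' S n (n - 1) (by omega)) ?_ ?_ ?_ ?_ ?_ S n
  · intro S _ n
    exact IsFiltered.sub (V := (T.mod.obj (fin S)).toFilteredGr)
        (W := (T.mod.obj (fin S)).toFilteredGr) (hd.filt S n _ _) (hd'.filt S n _ _)
  · intro S _ n
    rw [Preadditive.comp_sub, h, sub_self]
  · rw [Preadditive.comp_sub, hd.unit, hd'.unit, sub_self]
  · intro S S' _ _ e n Z x hx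
    rw [Preadditive.comp_sub, sub_eq_zero] at hx ⊢
    rw [Category.assoc, Category.assoc, hd.equivariant, hd'.equivariant, reassoc_of% hx]
  · intro S S' _ _ p q r h Z Z' x y hx hy
    rw [Preadditive.comp_sub, sub_eq_zero] at hx hy ⊢
    rw [hd.leibniz.mul (p' := p - 1) (q' := q - 1) (by omega) (by omega),
      hd'.leibniz.mul (p' := p - 1) (q' := q - 1) (by omega) (by omega), hx, hy]

end DualHom

/-! ### The bracket -/

section Bracket

variable {A : Type u} [Category.{v} A] [Abelian A] [MonoidalCategory A] [SymmetricCategory A]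

variable {P : SMod (CompleteGr A)} (o : OperadStr P) {k : ℤ} (μ : 𝟙_ A ⟶ ev P Unit k)

/-- The composition `μ ∘ x`. -/
def actLeft {S : Type} [Finite S] {n m : ℤ} (h : k + n = m) {Z : A} (x : Z ⟶ ev P S n) :
    Z ⟶ ev P S m :=
  (λ_ Z).inv ≫ o.raw.mul (μ ≫ rel P pointEquiv k) x h ≫ rel P (Equiv.emptySum Empty S) m

/-- The composition of `x` with `μ` at the input which `e` sends to the added point. -/
def insertAt {S S' : Type} [Finite S] [Finite S'] (e : S ≃ Option S') {n m : ℤ} (h : n + k = m)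
    {Z : A} (x : Z ⟶ ev P S n) : Z ⟶ ev P S m :=
  (ρ_ Z).inv ≫ o.raw.mul (x ≫ rel P e n) μ h ≫
    rel P ((Equiv.optionEquivSumPUnit S').symm.trans e.symm) m

theorem comp_bracket {S : Type} [Fintype S] {n m : ℤ} (h : k + n = m) (h' : n + k = m) {Z : A}
    (x : Z ⟶ ev P S n) : x ≫ bracket o k μ S n m h =
      actLeft o μ h x - (k * n).negOnePow • ∑ s : S, insertAt o μ (pointOut S s) h' x := by
  have hS : Fintype.ofFinite S = ‹Fintype S› := Subsingleton.elim _ _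
  rw [bracket, hS, Preadditive.comp_sub, comp_units_smul, Preadditive.comp_sum]
  congr 1
  · rw [actLeft, leftUnitor_inv_naturality_assoc, Raw.mul, MonoidalCategory.tensorHom_def',
      Category.assoc, Category.assoc]
  · congr 1
    refine Finset.sum_congr rfl fun s _ => ?_
    rw [insertAt, rightUnitor_inv_naturality_assoc, ← tensorHom_id,
      MonoidalCategory.tensorHom_comp_tensorHom_assoc, Category.id_comp, Raw.mul, Category.assoc]
    rfl

theorem exists_optionCongr {S S' : Type} (e : Option S ≃ Option S') (h : e none = none) :
    ∃ g : S ≃ S', e = g.optionCongr := by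
  refine ⟨Equiv.removeNone e, Equiv.ext fun a => ?_⟩
  cases a with
  | none => exact h
  | some a =>
    have : ∃ b, e (some a) = some b := by
      rw [← Option.ne_none_iff_exists']
      intro h'
      exact Option.some_ne_none a (e.injective (h'.trans h.symm))
    exact (Equiv.removeNone_some e this).symm

/-- Relabelling the remaining inputs before the insertion and back afterwards changes nothing, by
equivariance; only the selected input matters. So the complements `S ∖ {s}` may be replaced by any
convenient model. -/
theorem insertAt_congr {S S' S'' : Type} [Finite S] [Finite S'] [Finite S''] {e : S ≃ Option S'}
    {f : S ≃ Option S''} (hef : e.symm none = f.symm none) {n m : ℤ} (h : n + k = m) {Z : A}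
    (x : Z ⟶ ev P S n) : insertAt o μ e h x = insertAt o μ f h x := by
  obtain ⟨g, hg⟩ := exists_optionCongr (e.symm.trans f) (by
    rw [Equiv.trans_apply, hef, Equiv.apply_symm_apply])
  obtain rfl : f = e.trans g.optionCongr := by
    rw [← hg, ← Equiv.trans_assoc, Equiv.self_trans_symm, Equiv.refl_trans]
  have h1 := o.equivariant_element g (Equiv.refl Unit) h (x ≫ rel P e n) μ
  rw [rel_refl, Category.comp_id, Category.assoc, rel_rel] at h1
  rw [insertAt, insertAt, h1, Category.assoc, rel_rel]
  congr 3
  refine Equiv.ext fun a => ?_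
  rcases a with a | a <;> simp [Equiv.eq_symm_apply]

theorem pointOut_symm_none (S : Type) (s : S) : (pointOut S s).symm none = s := by
  classical
  rw [pointOut, Equiv.symm_symm]
  exact Equiv.optionSubtypeNe_none s

/-- Frees the sum over inputs from the particular splittings `pointOut` and from the index set `S`.
-/
theorem sum_insertAt {S : Type} [Fintype S] {n m : ℤ} (h : n + k = m) {Z : A} (x : Z ⟶ ev P S n)
    {I : Type} [Fintype I] (i : I ≃ S) {S' : I → Type} [∀ a, Finite (S' a)]
    (e : ∀ a, S ≃ Option (S' a)) (he : ∀ a, (e a).symm none = i a) :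
    ∑ s : S, insertAt o μ (pointOut S s) h x = ∑ a : I, insertAt o μ (e a) h x := by
  rw [← Equiv.sum_comp i]
  refine Finset.sum_congr rfl fun a _ => insertAt_congr o μ ?_ h x
  rw [he]
  exact pointOut_symm_none S _

section Filtration

variable {o μ}

theorem actLeft_factors {a b : ℕ} (hμ : (fil P Unit k a).Factors μ) {S : Type} [Finite S] {n m : ℤ}
    (h : k + n = m) {Z : A} {x : Z ⟶ ev P S n} (hx : (fil P S n b).Factors x) :
    (fil P S m (a + b)).Factors (actLeft o μ h x) := by
  refine factors_comp_left _ (factors_comp_of_factors ((P.map (bij _)).filt m _)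
    (o.mul_factors h (factors_comp_of_factors ((P.map (bij _)).filt k _) hμ) hx))

theorem insertAt_factors {a b : ℕ} (hμ : (fil P Unit k a).Factors μ) {S S' : Type} [Finite S]
    [Finite S'] (e : S ≃ Option S') {n m : ℤ} (h : n + k = m) {Z : A} {x : Z ⟶ ev P S n}
    (hx : (fil P S n b).Factors x) : (fil P S m (b + a)).Factors (insertAt o μ e h x) := by
  refine factors_comp_left _ (factors_comp_of_factors ((P.map (bij _)).filt m _)
    (o.mul_factors h (factors_comp_of_factors ((P.map (bij _)).filt n _) hx) hμ))

/-- Composition with `μ` on either side adds the filtration degree of `μ`. For `a = 1` this is why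
the square of the predifferential of the free curved operad maps `F_p` into `F_{p+1}`. -/
theorem bracket_factors {a b : ℕ} (hμ : (fil P Unit k a).Factors μ) {S : Type} [Finite S] {n m : ℤ}
    (h : k + n = m) {Z : A} {x : Z ⟶ ev P S n} (hx : (fil P S n b).Factors x) :
    (fil P S m (b + a)).Factors (x ≫ bracket o k μ S n m h) := by
  have := Fintype.ofFinite S
  rw [comp_bracket o μ h (by omega)]
  refine factors_sub ?_ (factors_units_smul _ (factors_sum _ _ fun s _ =>
    insertAt_factors hμ _ _ hx))
  rw [add_comm]
  exact actLeft_factors hμ h hx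

theorem bracket_isFiltered {S : Type} [Finite S] {n m : ℤ} (h : k + n = m) :
    FilteredGr.IsFiltered (V := (P.obj (fin S)).toFilteredGr) (W := (P.obj (fin S)).toFilteredGr)
      (bracket o k μ S n m h) := fun _ =>
  bracket_factors (a := 0) (factors_of_eq_top _ ((P.obj (fin Unit)).F_zero k)) h
    (Subobject.factors_self _)

end Filtration

section Naturality

variable {o} {Q : SMod (CompleteGr A)} {oQ : OperadStr Q} {g : P ⟶ Q} (hg : IsOperadHom o oQ g)

include hg

theorem actLeft_at {S : Type} [Finite S] {n m : ℤ} (h : k + n = m) {Z : A} (x : Z ⟶ ev P S n) :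
    actLeft o μ h x ≫ at_ g S m = actLeft oQ (μ ≫ at_ g Unit k) h (x ≫ at_ g S n) := by
  have := hg.rawHom.mul_assoc (μ ≫ rel P pointEquiv k) x h (rel Q (Equiv.emptySum Empty S) m)
  rw [actLeft, actLeft, Category.assoc, Category.assoc, rel_at, this, Category.assoc,
    Category.assoc,
    rel_at]

theorem insertAt_at {S S' : Type} [Finite S] [Finite S'] (e : S ≃ Option S') {n m : ℤ}
    (h : n + k = m) {Z : A} (x : Z ⟶ ev P S n) :
    insertAt o μ e h x ≫ at_ g S m = insertAt oQ (μ ≫ at_ g Unit k) e h (x ≫ at_ g S n) := by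
  have := hg.rawHom.mul_assoc (x ≫ rel P e n) μ h
    (rel Q ((Equiv.optionEquivSumPUnit S').symm.trans e.symm) m)
  rw [insertAt, insertAt, Category.assoc, Category.assoc, rel_at, this, Category.assoc,
    Category.assoc, rel_at]

theorem bracket_at {S : Type} [Finite S] {n m : ℤ} (h : k + n = m) :
    bracket o k μ S n m h ≫ at_ g S m = at_ g S n ≫ bracket oQ k (μ ≫ at_ g Unit k) S n m h := by
  have := Fintype.ofFinite S
  have h1 := comp_bracket o μ h (by omega) (𝟙 (ev P S n))
  rw [Category.id_comp] at h1
  rw [h1, comp_bracket oQ _ h (by omega), Preadditive.sub_comp, units_smul_comp,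
    Preadditive.sum_comp, actLeft_at μ hg, Category.id_comp]
  congr 2
  refine Finset.sum_congr rfl fun s _ => ?_
  rw [insertAt_at μ hg, Category.id_comp]

end Naturality

theorem rel_bracket {S T : Type} [Finite S] [Finite T] (e : S ≃ T) {n m : ℤ} (h : k + n = m) :
    rel P e n ≫ bracket o k μ T n m h = bracket o k μ S n m h ≫ rel P e m := by
  have := Fintype.ofFinite S
  have := Fintype.ofFinite T
  have h1 := comp_bracket o μ h (by omega) (𝟙 (ev P S n))
  rw [Category.id_comp] at h1
  rw [h1, comp_bracket o μ h (by omega), Preadditive.sub_comp, units_smul_comp,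
    Preadditive.sum_comp]
  congr 2
  · have h2 := o.equivariant_element (Equiv.refl Empty) e h (μ ≫ rel P pointEquiv k) (𝟙 _)
    rw [Equiv.optionCongr_refl, rel_refl, Category.comp_id, Category.id_comp] at h2
    rw [actLeft, actLeft, Category.assoc, Category.assoc, rel_rel, h2, Category.assoc, rel_rel]
    congr 3
    exact Equiv.ext fun a => by rcases a with a | a <;> [exact a.elim; rfl]
  -- The inputs in `T` are indexed by `S` through `e`, and `T` is split at `e s` by transporting the
  -- splitting of `S` at `s`.
  · rw [sum_insertAt o μ (by omega) (rel P e n) e (fun s => e.symm.trans (pointOut S s))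
      fun s => ?_]
    · refine Finset.sum_congr rfl fun s _ => ?_
      rw [insertAt, insertAt, rel_rel, Category.id_comp, Category.assoc, Category.assoc, rel_rel,
        ← Equiv.trans_assoc, Equiv.self_trans_symm, Equiv.refl_trans]
      rfl
    · exact congrArg e (pointOut_symm_none S s)

/-- There is a single input, and the sign is trivial for even `k`: the bracket is `μ ∘ μ - μ ∘ μ`,
whereas an odd degree would give twice `μ ∘ μ`. -/
theorem bracket_self (m : ℤ) (h : k + k = m) (hk : Even k) : μ ≫ bracket o k μ Unit k m h = 0 := by
  rw [comp_bracket o μ h h, Int.negOnePow_even _ (hk.mul_left k), one_smul, Fintype.sum_unique,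
    sub_eq_zero, insertAt_congr o μ (f := pointEquiv) (Subsingleton.elim _ _), actLeft, insertAt,
    unitors_inv_equal]
  congr 3

/-- The bracket is `μ ∘ id - id ∘ μ`, and both terms equal `μ`. -/
theorem unit_bracket (m : ℤ) (h : k + 0 = m) : o.unit ≫ bracket o k μ Unit 0 m h = 0 := by
  obtain rfl : k = m := by omega
  rw [comp_bracket o μ h (by omega), mul_zero, Int.negOnePow_zero, one_smul, Fintype.sum_unique,
    sub_eq_zero, insertAt_congr o μ (f := pointEquiv) (Subsingleton.elim _ _), actLeft, insertAt]
  have h1 := o.comp_unit_element (μ ≫ rel P pointEquiv k)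
  have h2 := o.unit_comp_element μ
  rw [← unitors_inv_equal] at h1 ⊢
  rw [reassoc_of% h1, rel_rel, rel_rel]
  refine Eq.trans ?_ (h2.symm.trans ?_)
  · refine (Eq.trans ?_ (μ ≫= rel_refl P Unit k)).trans (Category.comp_id _)
    congr 2
  · congr 3

end Bracket

/-! ### Leibniz rule for the bracket, and its commutation with derivations. -/

section BracketMul

variable {A : Type u} [Category.{v} A] [Abelian A] [MonoidalCategory A] [SymmetricCategory A]
  {P : SMod (CompleteGr A)} (o : OperadStr P) {k : ℤ} (μ : 𝟙_ A ⟶ ev P Unit k)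

theorem OperadStr.mul_rel_left {S S' T : Type} [Finite S] [Finite S'] [Finite T] (e : S ≃ S')
    {p q r : ℤ} (h : p + q = r) {Z Z' : A} (x : Z ⟶ ev P (Option S) p) (y : Z' ⟶ ev P T q) :
    o.raw.mul (x ≫ rel P e.optionCongr p) y h =
      o.raw.mul x y h ≫ rel P (e.sumCongr (Equiv.refl T)) r := by
  have := o.equivariant_element e (Equiv.refl T) h x y
  rwa [rel_refl, Category.comp_id] at this

theorem OperadStr.mul_rel_right {S T T' : Type} [Finite S] [Finite T] [Finite T'] (e : T ≃ T')
    {p q r : ℤ} (h : p + q = r) {Z Z' : A} (x : Z ⟶ ev P (Option S) p) (y : Z' ⟶ ev P T q) :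
    o.raw.mul x (y ≫ rel P e q) h =
      o.raw.mul x y h ≫ rel P ((Equiv.refl S).sumCongr e) r := by
  have := o.equivariant_element (Equiv.refl S) e h x y
  rwa [Equiv.optionCongr_refl, rel_refl, Category.comp_id] at this

variable {S T : Type} [Finite S] [Finite T] {p q r : ℤ} {Z Z' : A}
  (x : Z ⟶ ev P (Option S) p) (y : Z' ⟶ ev P T q)

theorem actLeft_mul {p' r' : ℤ} (h : p + q = r) (hr : k + r = r') (hp : k + p = p') :
    actLeft o μ hr (o.raw.mul x y h) = o.raw.mul (actLeft o μ hp x) y (by omega) := by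
  have h1 := o.seq_element hp h (show p' + q = r' by omega) hr (μ ≫ rel P pointEquiv k) x y
  have e1 : Equiv.emptySum Empty (Option S) =
      (optRight Empty S).trans (Equiv.emptySum Empty S).optionCongr :=
    Equiv.ext fun a => by rcases a with a | _ | a <;> [exact a.elim; rfl; rfl]
  rw [actLeft, actLeft, e1, ← rel_rel, ← Category.assoc (o.raw.mul _ _ _),
    ← o.raw.whiskerRight_mul (λ_ Z).inv,
    o.mul_rel_left, h1, Category.assoc, Category.assoc, rel_rel, leftUnitor_inv_whiskerRight,
    Category.assoc, Iso.inv_hom_id_assoc]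
  congr 3
  exact Equiv.ext fun a => by rcases a with a | a | a <;> [exact a.elim; rfl; rfl]

/-- Sequential associativity with `μ` as the middle factor. This term occurs in both halves of the
Leibniz rule for the bracket, with opposite signs. -/
theorem mul_actLeft {p' q' r' : ℤ} (hp : p + k = p') (hq : k + q = q') (hr : p + q' = r')
    (hr' : p' + q = r') : o.raw.mul x (actLeft o μ hq y) hr =
      o.raw.mul (insertAt o μ (Equiv.refl (Option S)) hp x) y hr' := by
  have h1 := o.seq_element hp hq hr' hr x (μ ≫ rel P pointEquiv k) y
  have e1 : (Equiv.optionEquivSumPUnit S).symm.trans (Equiv.refl (Option S)).symm =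
      (((Equiv.refl S).sumCongr pointEquiv).trans (optRight S Empty)).trans
        (Equiv.sumEmpty S Empty).optionCongr :=
    Equiv.ext fun a => by rcases a with a | a <;> rfl
  rw [actLeft, insertAt, e1, ← rel_rel, ← rel_rel, rel_refl, Category.comp_id,
    ← Category.assoc (o.raw.mul x μ hp), ← Category.assoc (o.raw.mul x μ hp), ← o.mul_rel_right,
    ← o.raw.whiskerRight_mul (ρ_ Z).inv, o.mul_rel_left, h1, ← o.raw.whiskerLeft_mul (λ_ Z').inv,
    o.mul_rel_right,
    Category.assoc, Category.assoc, rel_rel, triangle_assoc_comp_right_inv_assoc]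
  congr 3
  exact Equiv.ext fun a => by rcases a with a | a | a <;> [rfl; exact a.elim; rfl]

theorem insertAt_mul_right {T' : Type} [Finite T'] (f : T ≃ Option T') {q' r' : ℤ} (h : p + q = r)
    (hr : r + k = r') (hq : q + k = q') :
    insertAt o μ (((Equiv.refl S).sumCongr f).trans (optRight S T')) hr (o.raw.mul x y h) =
      o.raw.mul x (insertAt o μ f hq y) (by omega) := by
  have h1 := o.seq_element h hq hr (show p + q' = r' by omega) x (y ≫ rel P f q) μ
  rw [insertAt, insertAt, ← rel_rel, ← Category.assoc (o.raw.mul x y h), ← o.mul_rel_right, h1,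
    ← o.raw.whiskerLeft_mul (ρ_ Z').inv, o.mul_rel_right, Category.assoc, Category.assoc, rel_rel,
    rightUnitor_tensor_inv, Category.assoc, Iso.inv_hom_id_assoc]
  congr 3
  exact Equiv.ext fun a => by rcases a with a | a | a <;> rfl

/-- Here `μ` enters an input of `x` other than the plugged one, so the parallel axiom applies. Its
sign `(-1) ^ (q k)` is trivial for even `k`, and the braiding with the unit object is absorbed by
unitors. -/
theorem insertAt_mul_left (hk : Even k) {S' : Type} [Finite S'] (f : S ≃ Option S') {p' r' : ℤ}
    (h : p + q = r) (hr : r + k = r') (hp : p + k = p') :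
    insertAt o μ ((f.sumCongr (Equiv.refl T)).trans (optLeft S' T)) hr (o.raw.mul x y h) =
      o.raw.mul (insertAt o μ (f.optionCongr.trans (optSwap S')) hp x) y (by omega) := by
  have h1 := o.par_element h hp hr (show p' + q = r' by omega) (x ≫ rel P f.optionCongr p) y μ
  have e1 : (Equiv.optionEquivSumPUnit (Option S')).symm.trans
      (f.optionCongr.trans (optSwap S')).symm = (optLeft S' Unit).trans
        ((Equiv.optionEquivSumPUnit S').symm.trans f.symm).optionCongr :=
    Equiv.ext fun a => by rcases a with (_ | a) | a <;> rfl
  have c1 : (ρ_ (Z ⊗ Z')).inv ≫ (α_ Z Z' (𝟙_ A)).hom ≫ Z ◁ (β_ Z' (𝟙_ A)).hom ≫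
      (α_ Z (𝟙_ A) Z').inv = (ρ_ Z).inv ▷ Z' := by
    rw [rightUnitor_tensor_inv, Category.assoc, Iso.inv_hom_id_assoc,
      ← MonoidalCategory.whiskerLeft_comp_assoc, rightUnitor_inv_braiding,
      ← triangle_assoc_comp_right_inv, Category.assoc, Iso.hom_inv_id, Category.comp_id]
  rw [insertAt, insertAt, e1, ← rel_rel P (f.sumCongr (Equiv.refl T)) (optLeft S' T),
    ← rel_rel P f.optionCongr (optSwap S'), ← rel_rel P (optLeft S' Unit),
    ← Category.assoc (o.raw.mul x y h), ← o.mul_rel_left, h1,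
    Int.negOnePow_even _ (hk.mul_left q), one_smul, ← Category.assoc x,
    ← Category.assoc (o.raw.mul (_ ≫ _) μ hp), ← o.raw.whiskerRight_mul (ρ_ Z).inv,
    o.mul_rel_left, ← c1]
  simp only [Category.assoc]
  rw [rel_rel, rel_rel]
  congr 6
  exact Equiv.ext fun a => by rcases a with (a | a) | a <;> rfl

variable [MonoidalPreadditive A]

/-- The bracket with an element of even degree is a derivation. -/
theorem mul_bracket (hk : Even k) {p' q' r' : ℤ} (hp : k + p = p') (hq : k + q = q')
    (hr : k + r = r') (h : p + q = r) :
    o.raw.mul x y h ≫ bracket o k μ (S ⊕ T) r r' hr =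
      o.raw.mul (x ≫ bracket o k μ (Option S) p p' hp) y (by omega) +
        o.raw.mul x (y ≫ bracket o k μ T q q' hq) (by omega) := by
  have := Fintype.ofFinite S
  have := Fintype.ofFinite T
  -- In `[μ, x] ∘ y`, the insertion of `μ` at the plugged input gives `(x ∘ μ) ∘ y = x ∘ (μ ∘ y)`,
  -- which cancels against the corresponding term of `x ∘ [μ, y]`. The other insertions match the
  -- inputs in `S` and in `T`.
  rw [comp_bracket o μ _ (by omega), comp_bracket o μ _ (by omega), comp_bracket o μ _ (by omega),
    Int.negOnePow_even _ (hk.mul_right r), Int.negOnePow_even _ (hk.mul_right p),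
    Int.negOnePow_even _ (hk.mul_right q), one_smul, one_smul, one_smul, Raw.sub_mul, Raw.mul_sub,
    Raw.sum_mul, Raw.mul_sum, actLeft_mul o μ x y h hr hp,
    mul_actLeft o μ x y (show p + k = p' by omega) hq (by omega) (by omega),
    Fintype.sum_option, Fintype.sum_sum_type,
    insertAt_congr o μ (f := Equiv.refl (Option S)) (pointOut_symm_none (Option S) none)]
  have hS : ∀ s : S, insertAt o μ (pointOut (S ⊕ T) (Sum.inl s)) (show r + k = r' by omega)
      (o.raw.mul x y h) = o.raw.mul (insertAt o μ (pointOut (Option S) (some s))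
        (show p + k = p' by omega) x) y (by omega) := fun s => by
    rw [insertAt_congr o μ (f := ((pointOut S s).sumCongr (Equiv.refl T)).trans (optLeft _ T)),
      insertAt_mul_left o μ x y hk _ h _ (show p + k = p' by omega),
      insertAt_congr o μ (f := pointOut (Option S) (some s))]
    · rw [pointOut_symm_none]
      exact congrArg some (pointOut_symm_none S s)
    · rw [pointOut_symm_none]
      exact congrArg Sum.inl (pointOut_symm_none S s).symm
  have hT : ∀ t : T, insertAt o μ (pointOut (S ⊕ T) (Sum.inr t)) (show r + k = r' by omega)
      (o.raw.mul x y h) = o.raw.mul x (insertAt o μ (pointOut T t)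
        (show q + k = q' by omega) y) (by omega) := fun t => by
    rw [insertAt_congr o μ (f := ((Equiv.refl S).sumCongr (pointOut T t)).trans (optRight S _)),
      insertAt_mul_right o μ x y _ h _ (show q + k = q' by omega)]
    rw [pointOut_symm_none]
    exact congrArg Sum.inr (pointOut_symm_none T t).symm
  rw [Finset.sum_congr rfl fun s _ => hS s, Finset.sum_congr rfl fun t _ => hT t]
  abel

/-- In general `d [μ, x] = [d μ, x] + (-1) ^ k [μ, d x]`; here `d μ = 0` and `k` is even. -/
theorem IsDerivation.bracket {P : CompleteOperad A} {d : DegNegOne P.mod} (hd : IsDerivation P d)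
    (hk : Even k) (μ : 𝟙_ A ⟶ ev P.mod Unit k) (hμ : ∀ m h, μ ≫ d Unit k m h = 0) (S : Type)
    [Finite S] {n m n' m' : ℤ} (h : k + n = m) (hn : n' + 1 = n) (hm : m' + 1 = m) :
    FreeCurvedOperad.bracket P.str k μ S n m h ≫ d S m m' hm =
      d S n n' hn ≫ FreeCurvedOperad.bracket P.str k μ S n' m' (by omega) := by
  have := Fintype.ofFinite S
  have h1 := comp_bracket P.str μ h (by omega) (𝟙 (ev P.mod S n))
  rw [Category.id_comp] at h1
  rw [h1, comp_bracket P.str μ _ (by omega), Int.negOnePow_even _ (hk.mul_right n),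
    Int.negOnePow_even _ (hk.mul_right n'), one_smul, one_smul, Preadditive.sub_comp,
    Preadditive.sum_comp]
  have hμ' : ∀ h', (μ ≫ rel P.mod pointEquiv k) ≫ d _ k (k - 1) h' = 0 := fun h' => by
    rw [Category.assoc, hd.equivariant, reassoc_of% hμ, zero_comp]
  congr 1
  · rw [actLeft, actLeft, Category.assoc, Category.assoc, hd.equivariant,
      ← Category.assoc (P.str.raw.mul _ _ _), hd.leibniz.mul (p' := k - 1) (q' := n') (by omega) hn,
      hμ', Raw.zero_mul, zero_add, Int.negOnePow_even _ hk, one_smul, Category.id_comp]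
  · refine Finset.sum_congr rfl fun s _ => ?_
    rw [insertAt, insertAt, Category.assoc, Category.assoc, hd.equivariant,
      ← Category.assoc (P.str.raw.mul _ _ _), hd.leibniz.mul (p' := n') (q' := k - 1) hn (by omega),
      hμ, Raw.mul_zero, smul_zero, add_zero, Category.id_comp, hd.equivariant]

end BracketMul

/-! ### Ideals and quotients -/

section Ideals

variable {A : Type u} [Category.{v} A] [Abelian A] [MonoidalCategory A] [SymmetricCategory A]

open FilteredGr

section Elements

variable {T : CompleteOperad A} {J : SubFamily T.mod} (hJ : IsIdeal T J)

include hJ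

theorem IsIdeal.rel_factors {S S' : Type} [Finite S] [Finite S'] (e : S ≃ S') {n : ℤ} {Z : A}
    {x : Z ⟶ ev T.mod S n} (hx : (J (.of S) n).Factors x) :
    (J (.of S') n).Factors (x ≫ FreeCurvedOperad.rel T.mod e n) :=
  factors_comp_of_factors (hJ.rel S S' e n) hx

theorem IsIdeal.mul_left_factors {S S' : Type} [Finite S] [Finite S'] {p q r : ℤ} (h : p + q = r)
    {Z Z' : A} {x : Z ⟶ ev T.mod (Option S) p} (hx : (J (.of (Option S)) p).Factors x)
    (y : Z' ⟶ ev T.mod S' q) : (J (.of (S ⊕ S')) r).Factors (T.str.raw.mul x y h) := by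
  have := factors_comp_left (Subobject.factorThru _ x hx ⊗ₘ y) (hJ.comp_left S S' p q r h)
  rw [← tensorHom_id, MonoidalCategory.tensorHom_comp_tensorHom_assoc, Subobject.factorThru_arrow,
    Category.comp_id] at this
  exact this

theorem IsIdeal.mul_right_factors {S S' : Type} [Finite S] [Finite S'] {p q r : ℤ} (h : p + q = r)
    {Z Z' : A} (x : Z ⟶ ev T.mod (Option S) p) {y : Z' ⟶ ev T.mod S' q}
    (hy : (J (.of S') q).Factors y) : (J (.of (S ⊕ S')) r).Factors (T.str.raw.mul x y h) := by
  have := factors_comp_left (x ⊗ₘ Subobject.factorThru _ y hy) (hJ.comp_right S S' p q r h)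
  rw [← id_tensorHom, MonoidalCategory.tensorHom_comp_tensorHom_assoc, Subobject.factorThru_arrow,
    Category.comp_id] at this
  exact this

end Elements

theorem isIdeal_of_factors {T : CompleteOperad A} {J : SubFamily T.mod}
    (hr : ∀ {S S' : Type} [Finite S] [Finite S'] (e : S ≃ S') {n : ℤ} {Z : A}
      {x : Z ⟶ ev T.mod S n} (_ : (J (.of S) n).Factors x),
        (J (.of S') n).Factors (x ≫ rel T.mod e n))
    (hl : ∀ {S S' : Type} [Finite S] [Finite S'] {p q r : ℤ} (h : p + q = r) {Z Z' : A}
      {x : Z ⟶ ev T.mod (Option S) p} (_ : (J (.of (Option S)) p).Factors x)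
      (y : Z' ⟶ ev T.mod S' q), (J (.of (S ⊕ S')) r).Factors (T.str.raw.mul x y h))
    (hr' : ∀ {S S' : Type} [Finite S] [Finite S'] {p q r : ℤ} (h : p + q = r) {Z Z' : A}
      (x : Z ⟶ ev T.mod (Option S) p) {y : Z' ⟶ ev T.mod S' q} (_ : (J (.of S') q).Factors y),
        (J (.of (S ⊕ S')) r).Factors (T.str.raw.mul x y h)) : IsIdeal T J where
  rel _ _ _ _ e _ := hr e (Subobject.factors_self _)
  comp_left S S' _ _ p q r h := by
    have := hl h (Subobject.factors_self (J (.of (Option S)) p)) (𝟙 (ev T.mod S' q))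
    rwa [Raw.mul, tensorHom_id] at this
  comp_right S S' _ _ p q r h := by
    have := hr' h (𝟙 (ev T.mod (Option S) p)) (Subobject.factors_self (J (.of S') q))
    rwa [Raw.mul, id_tensorHom] at this

/-- The kernel of a morphism of operads is an ideal. -/
theorem isIdeal_kernel [MonoidalPreadditive A] {T O : CompleteOperad A} (g : T ⟶ O) :
    IsIdeal T (fun S n => kernelSubobject (at_ g.hom S n)) := by
  refine isIdeal_of_factors ?_ ?_ ?_
  · intro S S' _ _ e n Z x hx
    rw [kernelSubobject_factors_iff] at hx ⊢
    have h1 := rel_at g.hom e n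
    rw [Category.assoc, h1, reassoc_of% hx, zero_comp]
  · intro S S' _ _ p q r h Z Z' x hx y
    rw [kernelSubobject_factors_iff] at hx ⊢
    have h1 := g.isHom.rawHom.mul x y h
    exact h1.trans ((congrArg (fun z => O.str.raw.mul z _ h) hx).trans (Raw.zero_mul _ _ _))
  · intro S S' _ _ p q r h Z Z' x y hy
    rw [kernelSubobject_factors_iff] at hy ⊢
    have h1 := g.isHom.rawHom.mul x y h
    exact h1.trans ((congrArg (fun z => O.str.raw.mul _ z h) hy).trans (Raw.mul_zero _ _ _))

section Inter

variable [HasSubobjectInter A] {T : CompleteOperad A}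

/-- The intersection of a set of families of subobjects. -/
def interFamily (s : Set (SubFamily T.mod)) : SubFamily T.mod :=
  fun S n => subobjectInter {Q | ∃ K ∈ s, Q = K S n}

theorem interFamily_factors_iff (s : Set (SubFamily T.mod)) {S : FintypeCat.{0}} {n : ℤ} {Z : A}
    (x : Z ⟶ ev T.mod S n) : (interFamily s S n).Factors x ↔ ∀ K ∈ s, (K S n).Factors x := by
  rw [interFamily, subobjectInter_factors_iff]
  exact ⟨fun h K hK => h _ ⟨K, hK, rfl⟩, fun h Q ⟨K, hK, e⟩ => e ▸ h K hK⟩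

theorem isIdeal_interFamily {s : Set (SubFamily T.mod)} (hs : ∀ K ∈ s, IsIdeal T K) :
    IsIdeal T (interFamily s) := by
  refine isIdeal_of_factors ?_ ?_ ?_
  · intro S S' _ _ e n Z x hx
    exact (interFamily_factors_iff _ _).2 fun K hK =>
      (hs K hK).rel_factors e ((interFamily_factors_iff _ _).1 hx K hK)
  · intro S S' _ _ p q r h Z Z' x hx y
    exact (interFamily_factors_iff _ _).2 fun K hK =>
      (hs K hK).mul_left_factors h ((interFamily_factors_iff _ _).1 hx K hK) y
  · intro S S' _ _ p q r h Z Z' x y hy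
    exact (interFamily_factors_iff _ _).2 fun K hK =>
      (hs K hK).mul_right_factors h x ((interFamily_factors_iff _ _).1 hy K hK)

/-- The intersection of all ideals containing the defect is again such an ideal, because membership
is tested ideal by ideal. -/
theorem exists_isCurvatureIdeal (M : SMod (CompleteGrDg A)) (i : gr M ⟶ T.mod)
    (ϑ : 𝟙_ A ⟶ ev T.mod Unit (-2)) : ∃ J, IsCurvatureIdeal M T i ϑ J := by
  refine ⟨interFamily {K : SubFamily T.mod | IsIdeal T K ∧
    ∀ (S : Type) [Finite S] (n m l : ℤ) (h : m + 1 = n) (h' : l + 1 = m),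
      (K (.of S) l).Factors (curvatureDefect M T i ϑ S n m l h h')},
    ⟨isIdeal_interFamily fun K hK => hK.1, ?_⟩, ?_⟩
  · intro S _ n m l h h'
    exact (interFamily_factors_iff _ _).2 fun K hK => hK.2 S n m l h h'
  · intro K hK S n
    refine Subobject.le_of_factors ?_
    exact (interFamily_factors_iff _ _).1 (Subobject.factors_self _) K hK

end Inter

variable [MonoidalPreadditive A]

/-- The curvature ideal is stable under the derivation. -/
theorem IsCurvatureIdeal.derivation_factors {M : SMod (CompleteGrDg A)} {T : CompleteOperad A}
    {i : gr M ⟶ T.mod} {ϑ : 𝟙_ A ⟶ ev T.mod Unit (-2)} {J : SubFamily T.mod}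
    (hJ : IsCurvatureIdeal M T i ϑ J) {d : DegNegOne T.mod} (hd : IsDerivation T d)
    (hi : ∀ (S : Type) [Finite S] (n m : ℤ) (h : m + 1 = n),
      at_ i S n ≫ d S n m h = diff M S n m h ≫ at_ i S m)
    (hϑ : ∀ m h, ϑ ≫ d Unit (-2) m h = 0) (S : Type) [Finite S] (n m : ℤ) (h : m + 1 = n)
    {Z : A} {x : Z ⟶ ev T.mod S n} (hx : (J (.of S) n).Factors x) :
    (J (.of S) m).Factors (x ≫ d S n m h) := by
  -- `K` is `J ∩ d⁻¹ J`. It is an ideal by the Leibniz rule; once it contains the defect, minimality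
  -- of `J` gives `J ≤ K`, which is the claim.
  let K : SubFamily T.mod := fun S n =>
    J S n ⊓ (Subobject.pullback (d S n (n - 1) (by omega))).obj (J S (n - 1))
  have hK : ∀ {S : Type} [Finite S] {n : ℤ} {Z : A} {x : Z ⟶ ev T.mod S n},
      (K (.of S) n).Factors x ↔ (J (.of S) n).Factors x ∧
        (J (.of S) (n - 1)).Factors (x ≫ d S n (n - 1) (by omega)) := by
    intro S _ n Z x
    rw [← pullback_factors_iff, ← Subobject.inf_factors]
  have h1 : J ≤ K := by
    refine hJ.2 ⟨isIdeal_of_factors ?_ ?_ ?_, ?_⟩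
    · intro S S' _ _ e n Z x hx
      rw [hK] at hx ⊢
      refine ⟨hJ.1.1.rel_factors e hx.1, ?_⟩
      rw [Category.assoc, hd.equivariant, ← Category.assoc]
      exact hJ.1.1.rel_factors e hx.2
    · intro S S' _ _ p q r h Z Z' x hx y
      rw [hK] at hx ⊢
      refine ⟨hJ.1.1.mul_left_factors h hx.1 y, ?_⟩
      rw [hd.leibniz.mul (p' := p - 1) (q' := q - 1) (by omega) (by omega)]
      exact Subobject.factors_add _ _ (hJ.1.1.mul_left_factors _ hx.2 y)
        (factors_units_smul _ (hJ.1.1.mul_left_factors _ hx.1 _))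
    · intro S S' _ _ p q r h Z Z' x y hy
      rw [hK] at hy ⊢
      refine ⟨hJ.1.1.mul_right_factors h x hy.1, ?_⟩
      rw [hd.leibniz.mul (p' := p - 1) (q' := q - 1) (by omega) (by omega)]
      exact Subobject.factors_add _ _ (hJ.1.1.mul_right_factors _ _ hy.1)
        (factors_units_smul _ (hJ.1.1.mul_right_factors _ _ hy.2))
    · intro S _ n m l h h'
      rw [hK]
      refine ⟨hJ.1.2 S n m l h h', ?_⟩
      have h2 := hJ.1.2 S m l (l - 1) h' (by omega)
      -- On `M`, `d` extends `d_M`, and it commutes with `[ϑ, -]` because `ϑ` is closed of even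
      -- degree. So `d` of the defect is the defect precomposed with `d_M`, which lies in `J`.
      have h3 : curvatureDefect M T i ϑ S n m l h h' ≫ d S l (l - 1) (by omega) =
          diff M S n m h ≫ curvatureDefect M T i ϑ S m l (l - 1) h' (by omega) := by
        rw [curvatureDefect, curvatureDefect, Preadditive.sub_comp, Preadditive.comp_sub,
          Category.assoc, Category.assoc, Category.assoc, hi,
          hd.bracket (by decide) ϑ hϑ S (n' := m) _ h, ← Category.assoc (at_ i S n), hi,
          Category.assoc]
      rw [h3]
      exact factors_comp_left _ h2
  obtain rfl : m = n - 1 := by omega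
  exact (hK.1 (Subobject.factors_of_le _ (h1 (.of S) n) hx)).2

end Ideals

/-! ### Quotients by ideals as completions. -/

section Quotients

variable {A : Type u} [Category.{v} A] [Abelian A] [MonoidalCategory A] [SymmetricCategory A]

open FilteredGr

/-- A quotient by an ideal, which is also a quotient for maps of any degree and for morphisms of
operads. -/
structure IsStrongQuotient {T Q : CompleteOperad A} (J : SubFamily T.mod) (π : T ⟶ Q) : Prop where
  isQuotient : IsQuotient J π
  hom_ext : ∀ {S : Type} [Finite S] {W : CompleteGr A} {n m : ℤ} {f g : ev Q.mod S n ⟶ W.X m},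
    IsFiltered (V := (Q.mod.obj (fin S)).toFilteredGr) (W := W.toFilteredGr) f →
    IsFiltered (V := (Q.mod.obj (fin S)).toFilteredGr) (W := W.toFilteredGr) g →
    at_ π.hom S n ≫ f = at_ π.hom S n ≫ g → f = g
  exists_hom : ∀ {O : CompleteOperad A} (g : T ⟶ O),
    (∀ (S : Type) [Finite S] (n : ℤ), (J (.of S) n).arrow ≫ at_ g.hom S n = 0) →
      ∃ k : Q ⟶ O, π ≫ k = g

theorem sup_arrow_comp_factors_iff {X Y : A} {P P' : Subobject X} {Q : Subobject Y} {f : X ⟶ Y} :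
    Q.Factors ((P ⊔ P').arrow ≫ f) ↔ Q.Factors (P.arrow ≫ f) ∧ Q.Factors (P'.arrow ≫ f) := by
  rw [factors_arrow_comp_iff_le, factors_arrow_comp_iff_le, factors_arrow_comp_iff_le, sup_le_iff]

variable [MonoidalClosed A]

/-- A map out of `X ⊗ Y` sends `(P ⊔ P') ⊗ (Q ⊔ Q')` to `R` if it does so on the four pieces. -/
theorem sup_tensor_factors {X Y W : A} {P P' : Subobject X} {Q Q' : Subobject Y} {R : Subobject W}
    {f : X ⊗ Y ⟶ W} (h₁ : R.Factors ((P.arrow ⊗ₘ Q.arrow) ≫ f))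
    (h₂ : R.Factors ((P.arrow ⊗ₘ Q'.arrow) ≫ f)) (h₃ : R.Factors ((P'.arrow ⊗ₘ Q.arrow) ≫ f))
    (h₄ : R.Factors ((P'.arrow ⊗ₘ Q'.arrow) ≫ f)) :
    R.Factors (((P ⊔ P').arrow ⊗ₘ (Q ⊔ Q').arrow) ≫ f) := by
  rw [factors_iff_comp_cokernel, Category.assoc] at *
  have key : ∀ B : Subobject X, (B.arrow ⊗ₘ Q.arrow) ≫ f ≫ cokernel.π R.arrow = 0 →
      (B.arrow ⊗ₘ Q'.arrow) ≫ f ≫ cokernel.π R.arrow = 0 →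
      (B.arrow ⊗ₘ (Q ⊔ Q').arrow) ≫ f ≫ cokernel.π R.arrow = 0 := by
    intro B hB hB'
    rw [MonoidalCategory.tensorHom_def', Category.assoc] at hB hB' ⊢
    exact sup_arrow_whiskerLeft_comp_eq_zero hB hB'
  have k₁ := key P h₁ h₂
  have k₂ := key P' h₃ h₄
  rw [MonoidalCategory.tensorHom_def, Category.assoc] at k₁ k₂ ⊢
  exact sup_arrow_whiskerRight_comp_eq_zero k₁ k₂

/-- The filtration of a complete operad, enlarged by an ideal. -/
abbrev IsIdeal.filtration {T : CompleteOperad A} {J : SubFamily T.mod} (hJ : IsIdeal T J) :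
    OperadFiltration T.str.raw where
  F S _ n p := fil T.mod S n p ⊔ J (.of S) n
  F_zero S _ n := by rw [fil, (T.mod.obj (fin S)).F_zero n, top_sup_eq]
  anti S _ n p p' h := sup_le_sup_right ((T.mod.obj (fin S)).anti n h) _
  rel {S S'} _ _ e n p := sup_arrow_comp_factors_iff.2
    ⟨Subobject.factors_of_le _ le_sup_left ((T.mod.map (bij e)).filt n p),
      Subobject.factors_of_le _ le_sup_right (hJ.rel S S' e n)⟩
  mul {S S'} _ _ p q r h a b Z Z' x y hx hy := by
    -- Of the four products, `F_a ∘ F_b` lies in `F_(a+b)`, and the three which involve `J` lie in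
    -- `J`.
    have key := sup_tensor_factors (P := fil T.mod (Option S) p a) (P' := J (.of (Option S)) p)
      (Q := fil T.mod S' q b) (Q' := J (.of S') q) (R := fil T.mod (S ⊕ S') r (a + b) ⊔
      J (.of (S ⊕ S')) r) (f := T.str.comp S S' p q r h)
      (Subobject.factors_of_le _ le_sup_left (T.str.comp_filt S S' p q r h a b))
      (Subobject.factors_of_le _ le_sup_right
        (hJ.mul_right_factors h _ (Subobject.factors_self _)))
      (Subobject.factors_of_le _ le_sup_right
        (hJ.mul_left_factors h (Subobject.factors_self _) _))
      (Subobject.factors_of_le _ le_sup_right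
        (hJ.mul_left_factors h (Subobject.factors_self _) _))
    have := factors_comp_left (Subobject.factorThru _ x hx ⊗ₘ Subobject.factorThru _ y hy) key
    rw [MonoidalCategory.tensorHom_comp_tensorHom_assoc, Subobject.factorThru_arrow,
      Subobject.factorThru_arrow] at this
    exact this
  laws a := by
    have := T.str.laws.comp (fun S _ n => cokernel.π (fil T.mod S n a ⊔ J (.of S) n).arrow)
    simp only [Category.id_comp] at this
    exact this

variable [HasLimitsOfShape ℕᵒᵖ A]

/-- Quotients by ideals exist. -/
theorem IsIdeal.exists_isStrongQuotient {T : CompleteOperad A} {J : SubFamily T.mod}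
    (hJ : IsIdeal T J) : ∃ (Q : CompleteOperad A) (π : T ⟶ Q), IsStrongQuotient J π := by
  have hπ : ∀ (S : Type) [Finite S] (n : ℤ), IsFiltered (V := (T.mod.obj (fin S)).toFilteredGr)
      (W := (hJ.filtration.completion.mod.obj (fin S)).toFilteredGr)
      ((hJ.filtration.V S).toLim n) := fun S _ n p =>
    IsFiltered.factors (V := hJ.filtration.V S)
      (W := (hJ.filtration.completion.mod.obj (fin S)).toFilteredGr) (toLim_isFiltered _ n)
      (Subobject.factors_of_le _ le_sup_left (Subobject.factors_self _))
  let π : T ⟶ hJ.filtration.completion := RawHom.toHom (P := T) hJ.filtration.toCompletion hπ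
  -- A filtered map which kills `J` is filtered for `F_p + J`, hence extends to the completion. This
  -- gives existence in both universal properties, for complete objects and for operads.
  have hW : ∀ {S : Type} [Finite S] {W : CompleteGr A} {n m : ℤ} {f : ev T.mod S n ⟶ W.X m},
      IsFiltered (V := (T.mod.obj (fin S)).toFilteredGr) (W := W.toFilteredGr) f →
      (J (.of S) n).arrow ≫ f = 0 →
      IsFiltered (V := hJ.filtration.V S) (W := W.toFilteredGr) f := by
    intro S _ W n m f hf h0 p
    refine sup_arrow_comp_factors_iff.2 ⟨hf p, ?_⟩
    rw [h0]
    exact Subobject.factors_zero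
  refine ⟨_, π, ⟨⟨?_, ?_⟩, ?_, ?_⟩⟩
  -- `J` lies in every step of the enlarged filtration, so it dies at every level of the completion.
  · intro S _ n
    refine lim_hom_ext (hJ.filtration.V S) fun a => ?_
    rw [zero_comp]
    refine (Category.assoc _ _ _).trans ?_
    change (J (.of S) n).arrow ≫ (hJ.filtration.V S).toLim n ≫ (hJ.filtration.V S).limProj n a = 0
    rw [toLim_limProj]
    refine (factors_iff (hJ.filtration.V S) n a _).1 ?_
    exact Subobject.factors_of_le _ le_sup_right (Subobject.factors_self _)
  · intro S _ W g hg
    refine ⟨⟨fun n => completionExt (V := hJ.filtration.V S) (W := W) (g.f n)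
      (hW (g.filt n) (hg n)), fun n => completionExt_isFiltered _ _⟩, ?_, ?_⟩
    · exact CompleteGr.Hom.ext (funext fun n =>
        toLim_completionExt (V := hJ.filtration.V S) (W := W) (g.f n) (hW (g.filt n) (hg n)))
    · intro k hk
      refine CompleteGr.Hom.ext (funext fun n => ?_)
      refine completion_hom_ext (V := hJ.filtration.V S) (W := W) (k.filt n)
        (completionExt_isFiltered (V := hJ.filtration.V S) (W := W) (g.f n)
          (hW (g.filt n) (hg n))) ?_
      refine Eq.trans ?_ (toLim_completionExt (V := hJ.filtration.V S) (W := W) (g.f n)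
        (hW (g.filt n) (hg n))).symm
      exact congrFun (congrArg CompleteGr.Hom.f hk) n
  · intro S _ W n m f g hf hg h
    exact completion_hom_ext (V := hJ.filtration.V S) (W := W) hf hg h
  · intro O g hg
    have hh : OperadFiltration.PreservesFilt hJ.filtration O.filtration g.isHom.rawHom :=
      fun S _ n => hW (W := O.mod.obj (fin S)) ((g.hom.app (fin S)).filt n) (hg S n)
    refine ⟨OperadFiltration.desc hh, ?_⟩
    exact CompleteOperad.Hom.ext (smod_hom_ext fun S _ n => OperadFiltration.toLim_desc hh S n)

end Quotients

/-! ### Maps out of `ϑI` and coproducts of symmetric modules -/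

section VarthetaMaps

variable {A : Type u} [Category.{v} A] [Abelian A] [MonoidalCategory A] [SymmetricCategory A]

theorem nonempty_unit_equiv {S : Type} (h : Nat.card S = 1) : Nonempty (Unit ≃ S) := by
  obtain ⟨h1, ⟨a⟩⟩ := Nat.card_eq_one_iff_unique.1 h
  exact ⟨⟨fun _ => a, fun _ => (), fun _ => rfl, fun _ => Subsingleton.elim _ _⟩⟩

theorem unit_equiv_eq {S : Type} (e e' : Unit ≃ S) : e = e' :=
  Equiv.ext fun _ => e.symm.injective (Subsingleton.elim _ _)

theorem varthetaGen_rel {S : Type} [Finite S] (e : Unit ≃ S) (hS : Nat.card S = 1) :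
    varthetaGen A ≫ rel (vartheta A) e (-2) =
      Sigma.ι (fun _ : PLift ((-2 : ℤ) = -2 ∧ Nat.card (FintypeCat.of S) = 1) => 𝟙_ A) ⟨rfl, hS⟩ :=
  Sigma.ι_desc _ _

/-- The component is zero unless `n = -2` and `S` is a point; then it is the unit object, spanned by
the transport of `ϑ` along the bijection `Unit ≃ S`. -/
theorem vartheta_ext {S : Type} [Finite S] {n : ℤ} {Y : A} {f g : ev (vartheta A) S n ⟶ Y}
    (H : ∀ (e : Unit ≃ S) (hn : -2 = n), (varthetaGen A ≫ rel (vartheta A) e (-2)) ≫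
        eqToHom (congrArg (ev (vartheta A) S) hn) ≫ f =
      (varthetaGen A ≫ rel (vartheta A) e (-2)) ≫
        eqToHom (congrArg (ev (vartheta A) S) hn) ≫ g) : f = g := by
  refine Sigma.hom_ext _ _ fun ⟨hn, hS⟩ => ?_
  subst hn
  obtain ⟨e⟩ := nonempty_unit_equiv hS
  have h2 := H e rfl
  rw [eqToHom_refl, Category.id_comp, Category.id_comp, varthetaGen_rel e hS] at h2
  exact h2

/-- The map out of a component of `ϑI` given by the image of `ϑ`. -/
def varthetaDesc {S : Type} [Finite S] {n : ℤ} {Y : A}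
    (y : n = -2 ∧ Nat.card S = 1 → (𝟙_ A ⟶ Y)) : ev (vartheta A) S n ⟶ Y :=
  Sigma.desc fun j => y j.down

theorem varthetaGen_rel_desc {S : Type} [Finite S] {Y : A} (e : Unit ≃ S)
    (y : (-2 : ℤ) = -2 ∧ Nat.card S = 1 → (𝟙_ A ⟶ Y)) :
    (varthetaGen A ≫ rel (vartheta A) e (-2)) ≫ varthetaDesc y =
      y ⟨rfl, (Nat.card_congr e).symm.trans Nat.card_unique⟩ := by
  rw [varthetaGen_rel e ((Nat.card_congr e).symm.trans Nat.card_unique)]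
  exact Sigma.ι_desc _ _

/-- The morphism `ϑI ⟶ P` given by an element of `P({*})` of degree `-2`, at a finite set. -/
def varthetaHomAt {P : SMod (CompleteGr A)} (θ : 𝟙_ A ⟶ ev P Unit (-2)) (S : Type) [Finite S]
    (n : ℤ) : ev (vartheta A) S n ⟶ ev P S n :=
  varthetaDesc fun h => θ ≫ rel P (nonempty_unit_equiv h.2).some (-2) ≫
    eqToHom (congrArg (ev P S) h.1.symm)

theorem varthetaGen_rel_homAt {P : SMod (CompleteGr A)} (θ : 𝟙_ A ⟶ ev P Unit (-2)) {S : Type}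
    [Finite S] (e : Unit ≃ S) :
    (varthetaGen A ≫ rel (vartheta A) e (-2)) ≫ varthetaHomAt θ S (-2) = θ ≫ rel P e (-2) := by
  rw [varthetaHomAt, varthetaGen_rel_desc, eqToHom_refl, Category.comp_id,
    unit_equiv_eq (Nonempty.some _) e]

/-- The morphism `ϑI ⟶ P` given by an element of `F_1 P({*})` of degree `-2`. -/
def varthetaHom {P : SMod (CompleteGr A)} (θ : 𝟙_ A ⟶ ev P Unit (-2))
    (hθ : (fil P Unit (-2) 1).Factors θ) : vartheta A ⟶ P :=
  smodHom (varthetaHomAt θ)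
    (fun S _ n p => by
      -- For `p ≤ 1` the image lies in `F_1 ⊆ F_p` because `θ` does; for `p ≥ 2` the source is zero.
      by_cases hp : p ≤ 1
      · refine factors_comp_left _ (Subobject.factors_of_le _ ((P.obj (fin S)).anti n hp) ?_)
        rw [FilteredGr.factors_iff]
        refine vartheta_ext fun e hn => ?_
        subst hn
        rw [comp_zero, comp_zero, eqToHom_refl, Category.id_comp, ← Category.assoc,
          varthetaGen_rel_homAt, ← FilteredGr.factors_iff]
        exact factors_comp_of_factors ((P.map (bij _)).filt (-2) 1) hθ
      · exact factors_arrow_of_eq_bot _ _ (if_neg hp) _)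
    (fun {S T} _ _ e n => by
      refine vartheta_ext fun e' hn => ?_
      subst hn
      rw [eqToHom_refl, Category.id_comp, Category.id_comp,
        ← Category.assoc _ (varthetaHomAt θ S _),
        varthetaGen_rel_homAt, Category.assoc, rel_rel_assoc, ← Category.assoc,
        varthetaGen_rel_homAt, Category.assoc, rel_rel])

theorem varthetaGen_varthetaHom {P : SMod (CompleteGr A)} (θ : 𝟙_ A ⟶ ev P Unit (-2))
    (hθ : (fil P Unit (-2) 1).Factors θ) :
    varthetaGen A ≫ at_ (varthetaHom θ hθ) Unit (-2) = θ := by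
  have := varthetaGen_rel_homAt θ (Equiv.refl Unit)
  rw [rel_refl, rel_refl, Category.comp_id, Category.comp_id] at this
  exact this

theorem varthetaHom_ext {P : SMod (CompleteGr A)} {f g : vartheta A ⟶ P}
    (h : varthetaGen A ≫ at_ f Unit (-2) = varthetaGen A ≫ at_ g Unit (-2)) : f = g := by
  refine smod_hom_ext fun S _ n => vartheta_ext fun e hn => ?_
  subst hn
  rw [eqToHom_refl, Category.id_comp, Category.id_comp, Category.assoc, Category.assoc, rel_at,
    rel_at, reassoc_of% h]

theorem varthetaGen_factors : (fil (vartheta A) Unit (-2) 1).Factors (varthetaGen A) :=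
  factors_of_eq_top _ rfl

end VarthetaMaps

/-! ### Coproducts of symmetric modules, computed degreewise as biproducts. -/

section Coproduct

variable {A : Type u} [Category.{v} A] [Abelian A]

open FilteredGr

namespace CompleteGr

variable {V W U : CompleteGr A}

/-- The first inclusion. -/
def inl (V W : CompleteGr A) : V ⟶ V.prod W where
  f n := pair (V := V.toFilteredGr) (W := W.toFilteredGr) (𝟙 _) 0
  filt n p := by
    rw [prod_factors_iff, Category.assoc, Category.assoc, pair_fst, pair_snd, comp_zero,
      Category.comp_id]
    exact ⟨Subobject.factors_self _, Subobject.factors_zero⟩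

/-- The second inclusion. -/
def inr (V W : CompleteGr A) : W ⟶ V.prod W where
  f n := pair (V := V.toFilteredGr) (W := W.toFilteredGr) 0 (𝟙 _)
  filt n p := by
    rw [prod_factors_iff, Category.assoc, Category.assoc, pair_fst, pair_snd, comp_zero,
      Category.comp_id]
    exact ⟨Subobject.factors_zero, Subobject.factors_self _⟩

/-- The morphism out of a biproduct with given components. -/
def desc (f : V ⟶ U) (g : W ⟶ U) : V.prod W ⟶ U where
  f n := fst V.toFilteredGr W.toFilteredGr n ≫ f.f n + snd V.toFilteredGr W.toFilteredGr n ≫ g.f n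
  filt n p := IsFiltered.add (V := (V.prod W).toFilteredGr) (W := U.toFilteredGr)
    (IsFiltered.comp (V := (V.prod W).toFilteredGr) (W := V.toFilteredGr) (U := U.toFilteredGr)
      (fst_isFiltered n) (f.filt n))
    (IsFiltered.comp (V := (V.prod W).toFilteredGr) (W := W.toFilteredGr) (U := U.toFilteredGr)
      (snd_isFiltered n) (g.filt n)) p

theorem inl_desc (f : V ⟶ U) (g : W ⟶ U) : inl V W ≫ desc f g = f :=
  CompleteGr.Hom.ext (funext fun n => by
    change pair (𝟙 _) 0 ≫ (fst V.toFilteredGr W.toFilteredGr n ≫ _ + _) = _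
    rw [Preadditive.comp_add, pair_fst_assoc, pair_snd_assoc, zero_comp, add_zero,
      Category.id_comp])

theorem inr_desc (f : V ⟶ U) (g : W ⟶ U) : inr V W ≫ desc f g = g :=
  CompleteGr.Hom.ext (funext fun n => by
    change pair 0 (𝟙 _) ≫ (fst V.toFilteredGr W.toFilteredGr n ≫ _ + _) = _
    rw [Preadditive.comp_add, pair_fst_assoc, pair_snd_assoc, zero_comp, zero_add,
      Category.id_comp])

theorem prod_ext {k k' : V.prod W ⟶ U} (h₁ : inl V W ≫ k = inl V W ≫ k')
    (h₂ : inr V W ≫ k = inr V W ≫ k') : k = k' :=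
  CompleteGr.Hom.ext (funext fun n => prod_hom_ext'
    (congrFun (congrArg CompleteGr.Hom.f h₁) n) (congrFun (congrArg CompleteGr.Hom.f h₂) n))

end CompleteGr

variable (P Q : SMod (CompleteGr A))

/-- The coproduct of two symmetric modules. -/
abbrev coprodMod : SMod (CompleteGr A) where
  obj S := (P.obj S).prod (Q.obj S)
  map {S S'} e := CompleteGr.desc (P.map e ≫ CompleteGr.inl (P.obj S') (Q.obj S'))
    (Q.map e ≫ CompleteGr.inr (P.obj S') (Q.obj S'))
  map_id S := by
    refine CompleteGr.prod_ext ?_ ?_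
    · rw [CompleteGr.inl_desc, P.map_id, Category.id_comp, Category.comp_id]
    · rw [CompleteGr.inr_desc, Q.map_id, Category.id_comp, Category.comp_id]
  map_comp e e' := by
    refine CompleteGr.prod_ext ?_ ?_
    · rw [CompleteGr.inl_desc, ← Category.assoc, CompleteGr.inl_desc, Category.assoc,
        CompleteGr.inl_desc, P.map_comp, Category.assoc]
    · rw [CompleteGr.inr_desc, ← Category.assoc, CompleteGr.inr_desc, Category.assoc,
        CompleteGr.inr_desc, Q.map_comp, Category.assoc]

/-- The first inclusion. -/
def coprodInl : P ⟶ coprodMod P Q where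
  app S := CompleteGr.inl (P.obj S) (Q.obj S)
  naturality _ _ _ := (CompleteGr.inl_desc _ _).symm

/-- The second inclusion. -/
def coprodInr : Q ⟶ coprodMod P Q where
  app S := CompleteGr.inr (P.obj S) (Q.obj S)
  naturality _ _ _ := (CompleteGr.inr_desc _ _).symm

variable {P Q} in
/-- The morphism out of a coproduct with given components. -/
def coprodDesc {R : SMod (CompleteGr A)} (f : P ⟶ R) (g : Q ⟶ R) : coprodMod P Q ⟶ R where
  app S := CompleteGr.desc (f.app S) (g.app S)
  naturality S S' e := by
    refine CompleteGr.prod_ext ?_ ?_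
    · refine (Category.assoc _ _ _).symm.trans ((CompleteGr.inl_desc _ _ =≫ _).trans ?_)
      rw [Category.assoc, CompleteGr.inl_desc, ← Category.assoc, CompleteGr.inl_desc, f.naturality]
    · refine (Category.assoc _ _ _).symm.trans ((CompleteGr.inr_desc _ _ =≫ _).trans ?_)
      rw [Category.assoc, CompleteGr.inr_desc, ← Category.assoc, CompleteGr.inr_desc, g.naturality]

/-- The universal property of the coproduct. -/
def coprodIsColimit : IsColimit (BinaryCofan.mk (coprodInl P Q) (coprodInr P Q)) :=
  BinaryCofan.isColimitMk (fun s => coprodDesc s.inl s.inr)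
    (fun _ => NatTrans.ext (funext fun _ => CompleteGr.inl_desc _ _))
    (fun _ => NatTrans.ext (funext fun _ => CompleteGr.inr_desc _ _))
    (fun _ _ h₁ h₂ => NatTrans.ext (funext fun S => CompleteGr.prod_ext
      ((congrArg (fun k => NatTrans.app k S) h₁).trans (CompleteGr.inl_desc _ _).symm)
      ((congrArg (fun k => NatTrans.app k S) h₂).trans (CompleteGr.inr_desc _ _).symm)))

theorem coprod_hom_ext {S : Type} [Finite S] {n : ℤ} {Y : A} {f g : ev (coprodMod P Q) S n ⟶ Y}
    (h₁ : at_ (coprodInl P Q) S n ≫ f = at_ (coprodInl P Q) S n ≫ g)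
    (h₂ : at_ (coprodInr P Q) S n ≫ f = at_ (coprodInr P Q) S n ≫ g) : f = g :=
  prod_hom_ext' h₁ h₂

end Coproduct

/-! ### The free curved operad -/

section FreeCurved

variable {A : Type u} [Category.{v} A] [Abelian A] [MonoidalCategory A] [SymmetricCategory A]

open FilteredGr

/-- The predifferential of a curved operad is a derivation. -/
theorem CurvedOperad.isDerivation (O : CurvedOperad A) :
    IsDerivation O.toOperad (diff O.mod) where
  filt S _ n m h p := (O.mod.obj (fin S)).d_filt n m h p
  equivariant _ _ _ _ e n m h := (O.mod.map (bij e)).comm n m h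
  leibniz := O.leibniz

/-- The constituents of the construction of the free curved operad. -/
structure CurvedData (M : SMod (CompleteGrDg A)) where
  N : SMod (CompleteGr A)
  inM : gr M ⟶ N
  inϑ : vartheta A ⟶ N
  T : CompleteOperad A
  j : N ⟶ T.mod
  d : DegNegOne T.mod
  J : SubFamily T.mod
  Q : CompleteOperad A
  π : T ⟶ Q
  isColimit : IsColimit (BinaryCofan.mk inM inϑ)
  -- Joint epimorphy in a single degree, for arbitrary maps of `A`; `isColimit` only tests filtered
  -- morphisms of degree `0`.
  coprod_ext : ∀ {S : Type} [Finite S] {n : ℤ} {Y : A} {f g : ev N S n ⟶ Y},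
    at_ inM S n ≫ f = at_ inM S n ≫ g → at_ inϑ S n ≫ f = at_ inϑ S n ≫ g → f = g
  isFree : IsFreeOperad T j
  -- Unlike the uniqueness in `isFree`, this applies to families of nonzero degree which are not
  -- morphisms of operads, such as `d² - [ϑ, -]` followed by `π`.
  isGenerated : IsGeneratedBy T j
  isDerivation : IsDerivation T d
  extendsDiff : ExtendsDiff M T (inM ≫ j) (inϑ ≫ j) d
  isCurvatureIdeal : IsCurvatureIdeal M T (inM ≫ j)
    (varthetaGen A ≫ at_ (inϑ ≫ j) Unit (-2)) J
  isStrongQuotient : IsStrongQuotient J π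

namespace CurvedData

variable {M : SMod (CompleteGrDg A)} (X : CurvedData M)

/-- The map from `M` to the free operad. -/
abbrev i : gr M ⟶ X.T.mod := X.inM ≫ X.j

/-- The element `ϑ` of the free operad. -/
abbrev ϑ : 𝟙_ A ⟶ ev X.T.mod Unit (-2) := varthetaGen A ≫ at_ (X.inϑ ≫ X.j) Unit (-2)

theorem i_d (S : Type) [Finite S] (n m : ℤ) (h : m + 1 = n) :
    at_ X.i S n ≫ X.d S n m h = diff M S n m h ≫ at_ X.i S m :=
  (X.extendsDiff S n m h).1

theorem ϑ_d (m : ℤ) (h : m + 1 = -2) : X.ϑ ≫ X.d Unit (-2) m h = 0 := by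
  rw [ϑ, Category.assoc, (X.extendsDiff Unit (-2) m h).2, comp_zero]

theorem ϑ_factors : (fil X.T.mod Unit (-2) 1).Factors X.ϑ :=
  factors_comp_of_factors (((X.inϑ ≫ X.j).app (fin Unit)).filt (-2) 1) varthetaGen_factors

/-- A family of filtered maps out of the free operad vanishes if it vanishes on `M`, on `ϑ` and on
the identity, and is compatible with relabelling and compositions. -/
theorem eq_zero {W : ∀ (S : Type) [Finite S], CompleteGr A} {k : ℤ → ℤ}
    (D : ∀ (S : Type) [Finite S] (n : ℤ), ev X.T.mod S n ⟶ (W S).X (k n))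
    (hD : ∀ (S : Type) [Finite S] (n : ℤ), IsFiltered
      (V := (X.T.mod.obj (fin S)).toFilteredGr) (W := (W S).toFilteredGr) (D S n))
    (hM : ∀ (S : Type) [Finite S] (n : ℤ), at_ X.i S n ≫ D S n = 0)
    (hϑ : X.ϑ ≫ D Unit (-2) = 0)
    (hunit : X.T.str.unit ≫ D Unit 0 = 0)
    (hrel : ∀ {S S' : Type} [Finite S] [Finite S'] (e : S ≃ S') (n : ℤ) {Z : A}
      (x : Z ⟶ ev X.T.mod S n), x ≫ D S n = 0 → (x ≫ rel X.T.mod e n) ≫ D S' n = 0)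
    (hmul : ∀ {S S' : Type} [Finite S] [Finite S'] {p q r : ℤ} (h : p + q = r) {Z Z' : A}
      (x : Z ⟶ ev X.T.mod (Option S) p) (y : Z' ⟶ ev X.T.mod S' q),
      x ≫ D (Option S) p = 0 → y ≫ D S' q = 0 → X.T.str.raw.mul x y h ≫ D (S ⊕ S') r = 0)
    (S : Type) [Finite S] (n : ℤ) : D S n = 0 := by
  refine X.isGenerated D hD (fun S _ n => ?_) hunit hrel hmul S n
  refine X.coprod_ext ?_ ?_
  · rw [comp_zero, ← Category.assoc]
    exact hM S n
  · rw [comp_zero, ← Category.assoc]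
    change at_ (X.inϑ ≫ X.j) S n ≫ D S n = 0
    -- Compatibility with relabelling spreads the vanishing on `ϑ` to all of `ϑI`.
    refine vartheta_ext fun e hn => ?_
    subst hn
    have h1 := hrel e (-2) _ hϑ
    have h2 := rel_at (X.inϑ ≫ X.j) e (-2)
    rw [comp_zero, comp_zero, eqToHom_refl, Category.id_comp, Category.assoc, ← Category.assoc
      (rel (vartheta A) e (-2)), h2, Category.assoc, ← Category.assoc, ← Category.assoc]
    exact h1

section Linear

variable [MonoidalPreadditive A]

/-- Both sides are derivations followed by `π`, so their difference is tested on generators. On `M`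
it is the defect, which lies in `J`; on `ϑ` both sides vanish, since `d ϑ = 0` and `[ϑ, ϑ] = 0`. -/
theorem d_d_π (S : Type) [Finite S] (n m l : ℤ) (h : m + 1 = n) (h' : l + 1 = m) :
    X.d S n m h ≫ X.d S m l h' ≫ at_ X.π.hom S l =
      bracket X.T.str (-2) X.ϑ S n l (by omega) ≫ at_ X.π.hom S l := by
  obtain rfl : m = n - 1 := by omega
  obtain rfl : l = n - 1 - 1 := by omega
  rw [← sub_eq_zero]
  have key : ∀ {S : Type} [Finite S] {n : ℤ} {Z : A} (x : Z ⟶ ev X.T.mod S n),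
      x ≫ (X.d S n (n - 1) (by omega) ≫ X.d S (n - 1) (n - 1 - 1) (by omega) ≫
        at_ X.π.hom S (n - 1 - 1) -
      bracket X.T.str (-2) X.ϑ S n (n - 1 - 1) (by omega) ≫ at_ X.π.hom S (n - 1 - 1)) =
      (x ≫ X.d S n (n - 1) (by omega) ≫ X.d S (n - 1) (n - 1 - 1) (by omega) -
        x ≫ bracket X.T.str (-2) X.ϑ S n (n - 1 - 1) (by omega)) ≫
        at_ X.π.hom S (n - 1 - 1) := by
    intro S _ n Z x
    rw [Preadditive.comp_sub, Preadditive.sub_comp]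
    simp only [Category.assoc]
  refine X.eq_zero (W := fun S _ => X.Q.mod.obj (fin S)) (k := fun n => n - 1 - 1)
    (fun S _ n => X.d S n (n - 1) (by omega) ≫ X.d S (n - 1) (n - 1 - 1) (by omega) ≫
        at_ X.π.hom S (n - 1 - 1) -
      bracket X.T.str (-2) X.ϑ S n (n - 1 - 1) (by omega) ≫ at_ X.π.hom S (n - 1 - 1))
    ?_ ?_ ?_ ?_ ?_ ?_ S n
  · intro S _ n
    refine IsFiltered.sub (V := (X.T.mod.obj (fin S)).toFilteredGr)
      (W := (X.Q.mod.obj (fin S)).toFilteredGr) ?_ ?_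
    · exact IsFiltered.comp (V := (X.T.mod.obj (fin S)).toFilteredGr)
        (W := (X.T.mod.obj (fin S)).toFilteredGr) (U := (X.Q.mod.obj (fin S)).toFilteredGr)
        (X.isDerivation.filt S n _ _) (IsFiltered.comp (V := (X.T.mod.obj (fin S)).toFilteredGr)
        (W := (X.T.mod.obj (fin S)).toFilteredGr) (U := (X.Q.mod.obj (fin S)).toFilteredGr)
        (X.isDerivation.filt S _ _ _) ((X.π.hom.app (fin S)).filt _))
    · exact IsFiltered.comp (V := (X.T.mod.obj (fin S)).toFilteredGr)
        (W := (X.T.mod.obj (fin S)).toFilteredGr) (U := (X.Q.mod.obj (fin S)).toFilteredGr)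
        (bracket_isFiltered _) ((X.π.hom.app (fin S)).filt _)
  · intro S _ n
    rw [key]
    have h1 : at_ X.i S n ≫ X.d S n (n - 1) (by omega) ≫ X.d S (n - 1) (n - 1 - 1) (by omega) -
        at_ X.i S n ≫ bracket X.T.str (-2) X.ϑ S n (n - 1 - 1) (by omega) =
        curvatureDefect M X.T X.i X.ϑ S n (n - 1) (n - 1 - 1) (by omega) (by omega) := by
      rw [curvatureDefect, ← Category.assoc (at_ X.i S n), i_d, Category.assoc, i_d]
    rw [h1]
    have h2 := X.isCurvatureIdeal.1.2 S n (n - 1) (n - 1 - 1) (by omega) (by omega)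
    rw [← Subobject.factorThru_arrow _ _ h2, Category.assoc, X.isStrongQuotient.isQuotient.zero,
      comp_zero]
  · rw [key, bracket_self (hk := show Even (-2 : ℤ) by decide), ← Category.assoc X.ϑ, ϑ_d,
      zero_comp, sub_zero,
      zero_comp]
  · rw [key, unit_bracket, ← Category.assoc X.T.str.unit, X.isDerivation.unit, zero_comp, sub_zero,
      zero_comp]
  · intro S S' _ _ e n Z x hx
    rw [key] at hx ⊢
    rw [Category.assoc, Category.assoc, rel_bracket, ← Category.assoc (rel X.T.mod e n),
      X.isDerivation.equivariant, Category.assoc, X.isDerivation.equivariant, ← Category.assoc,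
      ← Category.assoc, ← Category.assoc, ← Preadditive.sub_comp, Category.assoc, rel_at,
      ← Category.assoc, Category.assoc x, hx, zero_comp]
  · intro S S' _ _ p q r h Z Z' x y hx hy
    rw [key] at hx hy ⊢
    have hd := X.isDerivation.leibniz
    have h1 := X.π.isHom.rawHom.mul
      (x ≫ X.d _ p (p - 1) (by omega) ≫ X.d _ (p - 1) (p - 1 - 1) (by omega) -
        x ≫ bracket X.T.str (-2) X.ϑ _ p (p - 1 - 1) (by omega)) y
        (show p - 1 - 1 + q = r - 1 - 1 by omega)
    have h2 := X.π.isHom.rawHom.mul x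
      (y ≫ X.d _ q (q - 1) (by omega) ≫ X.d _ (q - 1) (q - 1 - 1) (by omega) -
        y ≫ bracket X.T.str (-2) X.ϑ _ q (q - 1 - 1) (by omega))
        (show p + (q - 1 - 1) = r - 1 - 1 by omega)
    rw [hx, Raw.zero_mul] at h1
    rw [hy, Raw.mul_zero] at h2
    -- In `d² (x ∘ y)` the two terms `d x ∘ d y` have signs `(-1) ^ (p - 1)` and `(-1) ^ p` and
    -- cancel. So `d²` satisfies the Leibniz rule without sign, like `[ϑ, -]`.
    rw [mul_bracket _ _ x y (by decide) (p' := p - 1 - 1) (q' := q - 1 - 1) (by omega) (by omega),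
      ← Category.assoc (X.T.str.raw.mul x y h),
      hd.mul (p' := p - 1) (q' := q - 1) (by omega) (by omega), Preadditive.add_comp,
      units_smul_comp, hd.mul (p' := p - 1 - 1) (q' := q - 1) (by omega) (by omega),
      hd.mul (p' := p - 1) (q' := q - 1 - 1) (by omega) (by omega), smul_add, smul_smul,
      ← Int.negOnePow_add, Int.negOnePow_even (p + p) (Even.add_self p), one_smul,
      Int.negOnePow_sub, Int.negOnePow_one]
    rw [Raw.sub_mul, Preadditive.sub_comp] at h1
    rw [Raw.mul_sub, Preadditive.sub_comp] at h2
    rw [sub_eq_zero] at h1 h2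
    rw [Preadditive.sub_comp, sub_eq_zero, Preadditive.add_comp, Preadditive.add_comp,
      Preadditive.add_comp, Preadditive.add_comp, mul_neg_one, Units.neg_smul, Category.assoc x,
      Category.assoc y, Preadditive.neg_comp]
    refine Eq.trans ?_ (congrArg₂ (· + ·) h1 h2)
    change _ = _ ≫ at_ X.π.hom _ _ + _ ≫ at_ X.π.hom _ _
    abel

end Linear

end CurvedData

end FreeCurved

/-! ### The curved structure on the quotient. -/

section FreeCurved

variable {A : Type u} [Category.{v} A] [Abelian A] [MonoidalCategory A] [SymmetricCategory A]

open FilteredGr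

/-- A complete operad with a derivation whose square is the bracket with a closed element of
filtration degree one, as a curved operad. -/
abbrev CurvedOperad.ofDerivation [MonoidalPreadditive A] (Q : CompleteOperad A)
    (d : DegNegOne Q.mod) (hd : IsDerivation Q d) (θ : 𝟙_ A ⟶ ev Q.mod Unit (-2))
    (hθ : (fil Q.mod Unit (-2) 1).Factors θ)
    (hc : θ ≫ d Unit (-2) (-3) (by norm_num) = 0)
    (hs : ∀ (S : Type) [Finite S] (n m l : ℤ) (h : m + 1 = n) (h' : l + 1 = m),
      d S n m h ≫ d S m l h' = bracket Q.str (-2) θ S n l (by omega)) : CurvedOperad A where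
  mod :=
    { obj := fun S =>
        { toCompleteGr := Q.mod.obj S
          d := fun n m h => d S.of n m h
          d_filt := fun n m h p => hd.filt S.of n m h p
          -- The square is the bracket with `θ ∈ F_1`, which raises the filtration by one.
          d_sq_filt := fun n m l h h' p => by
            have h1 := hs S.of n m l h h'
            have h2 := bracket_factors (o := Q.str) hθ (show -2 + n = l by omega)
              (Subobject.factors_self (fil Q.mod S.of n p))
            rw [← h1] at h2
            exact h2 }
      map := fun {S T} e =>
        { hom := Q.mod.map e
          comm := fun n m h =>
            hd.equivariant S.of T.of (FintypeCat.equivEquivIso.symm e.iso) n m h }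
      map_id := fun S => CompleteGrDg.Hom.ext (Q.mod.map_id S)
      map_comp := fun e e' => CompleteGrDg.Hom.ext (Q.mod.map_comp e e') }
  str := Q.str
  leibniz := hd.leibniz
  θ := θ
  θ_filt := hθ
  θ_closed := hc
  d_sq := hs

/-- A morphism of symmetric modules which commutes with the predifferentials. -/
abbrev grDgHom {M N : SMod (CompleteGrDg A)} (f : gr M ⟶ gr N)
    (hf : ∀ (S : Type) [Finite S] (n m : ℤ) (h : m + 1 = n),
      at_ f S n ≫ diff N S n m h = diff M S n m h ≫ at_ f S m) : M ⟶ N where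
  app S := ⟨f.app S, fun n m h => hf S.of n m h⟩
  naturality _ _ e := CompleteGrDg.Hom.ext (f.naturality e)

namespace CurvedData

variable [MonoidalPreadditive A] {M : SMod (CompleteGrDg A)} (X : CurvedData M)

/-- The derivation of the free operad induces a derivation of the quotient. -/
theorem exists_derivation_quotient : ∃ d : DegNegOne X.Q.mod, IsDerivation X.Q d ∧
    ∀ (S : Type) [Finite S] (n m : ℤ) (h : m + 1 = n),
      at_ X.π.hom S n ≫ d S n m h = X.d S n m h ≫ at_ X.π.hom S m := by
  have hφ1 : ∀ (S : Type) [Finite S] (n : ℤ),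
      at_ (X.isDerivation.dualHom X.π).hom S n ≫ dualFst X.Q S n = at_ X.π.hom S n :=
    fun S _ n => pair_fst _ _
  have hφ2 : ∀ (S : Type) [Finite S] (n : ℤ),
      at_ (X.isDerivation.dualHom X.π).hom S n ≫ dualSnd X.Q S n =
        X.d S n (n - 1) (by omega) ≫ at_ X.π.hom S (n - 1) :=
    fun S _ n => pair_snd _ _
  have hπ : ∀ {S : Type} [Finite S] {n : ℤ} {Z : A} {x : Z ⟶ ev X.T.mod S n},
      (X.J (.of S) n).Factors x → x ≫ at_ X.π.hom S n = 0 := by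
    intro S _ n Z x hx
    rw [← Subobject.factorThru_arrow _ x hx, Category.assoc, X.isStrongQuotient.isQuotient.zero,
      comp_zero]
  -- The morphism to the dual numbers of `Q` with components `π` and `d` followed by `π` kills `J`,
  -- because `J` is stable under `d`; so it descends to `Q`.
  obtain ⟨k, hk⟩ := X.isStrongQuotient.exists_hom (X.isDerivation.dualHom X.π) (by
    intro S _ n
    refine prod_hom_ext ?_ ?_
    · refine (Category.assoc _ _ _).trans ((_ ≫= hφ1 S n).trans ?_)
      rw [zero_comp]
      exact hπ (Subobject.factors_self _)
    · refine (Category.assoc _ _ _).trans ((_ ≫= hφ2 S n).trans ?_)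
      rw [zero_comp, ← Category.assoc]
      exact hπ (X.isCurvatureIdeal.derivation_factors X.isDerivation X.i_d X.ϑ_d S n (n - 1)
        (by omega) (Subobject.factors_self _)))
  have hk' : ∀ (S : Type) [Finite S] (n : ℤ), at_ X.π.hom S n ≫ at_ k.hom S n =
      at_ (X.isDerivation.dualHom X.π).hom S n := fun S _ n =>
    congrArg (fun k : X.T ⟶ _ => at_ k.hom S n) hk
  -- That the descended morphism is a section is checked after `π`.
  obtain ⟨d, hd, hd'⟩ := exists_derivation_of_section k (by
    refine CompleteOperad.Hom.ext (smod_hom_ext fun S _ n => ?_)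
    refine X.isStrongQuotient.hom_ext (W := X.Q.mod.obj (fin S))
      (((k ≫ dualProj X.Q).hom.app (fin S)).filt n)
      (((𝟙 X.Q : X.Q ⟶ X.Q).hom.app (fin S)).filt n) ?_
    refine (Category.assoc _ _ _).symm.trans ((hk' S n =≫ _).trans ((hφ1 S n).trans ?_))
    exact (Category.comp_id _).symm)
  refine ⟨d, hd, fun S _ n m h => ?_⟩
  obtain rfl : m = n - 1 := by omega
  rw [hd', ← Category.assoc, hk', hφ2]

/-- The derivation of the quotient. -/
def dbar : DegNegOne X.Q.mod := X.exists_derivation_quotient.choose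

theorem isDerivation_dbar : IsDerivation X.Q X.dbar :=
  X.exists_derivation_quotient.choose_spec.1

theorem π_dbar (S : Type) [Finite S] (n m : ℤ) (h : m + 1 = n) :
    at_ X.π.hom S n ≫ X.dbar S n m h = X.d S n m h ≫ at_ X.π.hom S m :=
  X.exists_derivation_quotient.choose_spec.2 S n m h

/-- The curvature of the quotient. -/
abbrev θ : 𝟙_ A ⟶ ev X.Q.mod Unit (-2) := X.ϑ ≫ at_ X.π.hom Unit (-2)

/-- Both sides are filtered, so they may be compared after `π`, where naturality of the bracket
reduces the claim to `d_d_π`. -/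
theorem dbar_dbar (S : Type) [Finite S] (n m l : ℤ) (h : m + 1 = n) (h' : l + 1 = m) :
    X.dbar S n m h ≫ X.dbar S m l h' = bracket X.Q.str (-2) X.θ S n l (by omega) := by
  refine X.isStrongQuotient.hom_ext (W := X.Q.mod.obj (fin S)) ?_ (bracket_isFiltered _) ?_
  · exact IsFiltered.comp (V := (X.Q.mod.obj (fin S)).toFilteredGr)
      (W := (X.Q.mod.obj (fin S)).toFilteredGr) (U := (X.Q.mod.obj (fin S)).toFilteredGr)
      (X.isDerivation_dbar.filt S n m h) (X.isDerivation_dbar.filt S m l h')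
  · rw [← bracket_at X.ϑ X.π.isHom, ← d_d_π X S n m l h h', ← Category.assoc, π_dbar,
      Category.assoc, π_dbar]

/-- The free curved operad. -/
abbrev curved : CurvedOperad A :=
  CurvedOperad.ofDerivation X.Q X.dbar X.isDerivation_dbar X.θ
    (factors_comp_of_factors ((X.π.hom.app (fin Unit)).filt (-2) 1) X.ϑ_factors)
    (by rw [θ, Category.assoc, π_dbar, ← Category.assoc, ϑ_d, zero_comp])
    X.dbar_dbar

/-- The canonical map to the free curved operad. -/
abbrev toCurved : M ⟶ X.curved.mod :=
  grDgHom (N := X.curved.mod) (X.i ≫ X.π.hom) fun S _ n m h => by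
    change (at_ X.i S n ≫ at_ X.π.hom S n) ≫ X.dbar S n m h =
      diff M S n m h ≫ at_ X.i S m ≫ at_ X.π.hom S m
    rw [Category.assoc, π_dbar, ← Category.assoc, i_d, Category.assoc]

theorem isFreeCurvedQuotient : IsFreeCurvedQuotient M X.curved X.toCurved := by
  refine ⟨X.N, X.inM, X.inϑ, X.T, X.j, X.d, X.J, X.π, ⟨X.isColimit⟩, X.isFree,
    ⟨X.isDerivation, X.extendsDiff⟩, ?_, X.isCurvatureIdeal, ?_, X.π_dbar, rfl, ?_⟩
  -- Both derivations have the prescribed values on `M` and on `ϑI`, hence agree on `M ⨿ ϑI`, which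
  -- generates `T`.
  · intro d' hd' he S _ n m h
    refine IsGeneratedBy.derivation_ext X.isGenerated hd' X.isDerivation
      (fun S _ n m h => ?_) S n m h
    refine X.coprod_ext ?_ ?_
    · exact (Category.assoc _ _ _).symm.trans ((he S n m h).1.trans
        ((X.extendsDiff S n m h).1.symm.trans (Category.assoc _ _ _)))
    · exact (Category.assoc _ _ _).symm.trans ((he S n m h).2.trans
        ((X.extendsDiff S n m h).2.symm.trans (Category.assoc _ _ _)))
  · exact X.isStrongQuotient.isQuotient
  · exact smod_hom_ext fun S _ n => Category.assoc (at_ X.inM S n) (at_ X.j S n) (at_ X.π.hom S n)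

end CurvedData

end FreeCurved

/-! ### The universal property of the quotient among curved operads. -/

section FreeCurved

variable {A : Type u} [Category.{v} A] [Abelian A] [MonoidalCategory A] [SymmetricCategory A]
  [MonoidalPreadditive A]

open FilteredGr

namespace CurvedData

variable {M : SMod (CompleteGrDg A)} (X : CurvedData M)

/-- A morphism of operads to a curved operad commutes with the derivations if it does so on `M` and
sends `ϑ` to the curvature. -/
theorem comm_of_comm {O : CurvedOperad A} (g : X.T ⟶ O.toOperad)
    (hM : ∀ (S : Type) [Finite S] (n m : ℤ) (h : m + 1 = n),
      at_ X.i S n ≫ at_ g.hom S n ≫ diff O.mod S n m h =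
        diff M S n m h ≫ at_ X.i S m ≫ at_ g.hom S m)
    (hϑ : X.ϑ ≫ at_ g.hom Unit (-2) = O.θ) (S : Type) [Finite S] (n m : ℤ) (h : m + 1 = n) :
    at_ g.hom S n ≫ diff O.mod S n m h = X.d S n m h ≫ at_ g.hom S m := by
  obtain rfl : m = n - 1 := by omega
  have hO := O.isDerivation
  rw [← sub_eq_zero]
  -- Both composites satisfy the Leibniz rule along `g` and vanish on the identity, so `M` and `ϑ`
  -- suffice. On `ϑ` both are zero, since `ϑ` and the curvature of `O` are closed.
  refine X.eq_zero (W := fun S _ => (gr O.mod).obj (fin S)) (k := fun n => n - 1)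
    (fun S _ n => at_ g.hom S n ≫ diff O.mod S n (n - 1) (by omega) -
      X.d S n (n - 1) (by omega) ≫ at_ g.hom S (n - 1)) ?_ ?_ ?_ ?_ ?_ ?_ S n
  · intro S _ n
    refine IsFiltered.sub (V := (X.T.mod.obj (fin S)).toFilteredGr)
      (W := ((gr O.mod).obj (fin S)).toFilteredGr) ?_ ?_
    · exact IsFiltered.comp (V := (X.T.mod.obj (fin S)).toFilteredGr)
        (W := ((gr O.mod).obj (fin S)).toFilteredGr) (U := ((gr O.mod).obj (fin S)).toFilteredGr)
        ((g.hom.app (fin S)).filt n) (hO.filt S n _ _)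
    · exact IsFiltered.comp (V := (X.T.mod.obj (fin S)).toFilteredGr)
        (W := (X.T.mod.obj (fin S)).toFilteredGr) (U := ((gr O.mod).obj (fin S)).toFilteredGr)
        (X.isDerivation.filt S n _ _) ((g.hom.app (fin S)).filt _)
  · intro S _ n
    rw [Preadditive.comp_sub, sub_eq_zero, hM, ← Category.assoc (at_ X.i S n), i_d, Category.assoc]
  · rw [Preadditive.comp_sub, sub_eq_zero, ← Category.assoc, hϑ, ← Category.assoc X.ϑ, ϑ_d,
      zero_comp]
    exact O.θ_closed
  · rw [Preadditive.comp_sub, sub_eq_zero, ← Category.assoc, g.isHom.unit, ← Category.assoc _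
      (X.d _ _ _ _), X.isDerivation.unit, zero_comp]
    exact hO.unit _ _
  · intro S S' _ _ e n Z x hx
    rw [Preadditive.comp_sub, sub_eq_zero] at hx ⊢
    have h1 := rel_at g.hom e n
    have h2 := rel_at g.hom e (n - 1)
    have h3 := hO.equivariant S S' e n (n - 1) (by omega)
    rw [Category.assoc, Category.assoc, ← Category.assoc (rel X.T.mod e n),
      ← Category.assoc (rel X.T.mod e n), X.isDerivation.equivariant, h1, Category.assoc,
      Category.assoc, h2, h3, reassoc_of% hx]
  · intro S S' _ _ p q r h Z Z' x y hx hy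
    rw [Preadditive.comp_sub, sub_eq_zero] at hx hy ⊢
    have h1 := g.isHom.rawHom.mul x y h
    have h2 := g.isHom.rawHom.mul (x ≫ X.d (Option S) p (p - 1) (by omega)) y
      (show p - 1 + q = r - 1 by omega)
    have h3 := g.isHom.rawHom.mul x (y ≫ X.d S' q (q - 1) (by omega))
      (show p + (q - 1) = r - 1 by omega)
    have h4 := hO.leibniz.mul (p' := p - 1) (q' := q - 1) (r' := r - 1) (by omega) (by omega)
      (by omega) h (x ≫ at_ g.hom _ p) (y ≫ at_ g.hom _ q)
    rw [← Category.assoc, ← Category.assoc,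
      X.isDerivation.leibniz.mul (p' := p - 1) (q' := q - 1) (by omega) (by omega),
      Preadditive.add_comp, units_smul_comp]
    refine (h1 =≫ _).trans (h4.trans ?_)
    refine Eq.trans ?_ (congrArg₂ (fun a b => a + p.negOnePow • b) h2 h3).symm
    rw [Category.assoc, Category.assoc, hx, hy, Category.assoc, Category.assoc]

/-- In `O` the square of the predifferential is `[θ, -]`, so `g` kills the defect. Its kernel is an
ideal, hence contains `J`, the smallest ideal containing the defect. -/
theorem arrow_comp_eq_zero {O : CurvedOperad A} (g : X.T ⟶ O.toOperad)
    (hM : ∀ (S : Type) [Finite S] (n m : ℤ) (h : m + 1 = n),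
      at_ X.i S n ≫ at_ g.hom S n ≫ diff O.mod S n m h =
        diff M S n m h ≫ at_ X.i S m ≫ at_ g.hom S m)
    (hϑ : X.ϑ ≫ at_ g.hom Unit (-2) = O.θ) (S : Type) [Finite S] (n : ℤ) :
    (X.J (.of S) n).arrow ≫ at_ g.hom S n = 0 := by
  have h1 : X.J ≤ (fun S n => kernelSubobject (at_ g.hom S n) : SubFamily X.T.mod) := by
    refine X.isCurvatureIdeal.2 ⟨isIdeal_kernel g, fun S _ n m l h h' => ?_⟩
    rw [kernelSubobject_factors_iff, curvatureDefect, Preadditive.sub_comp, sub_eq_zero]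
    have h2 := bracket_at X.ϑ g.isHom (S := S) (show -2 + n = l by omega)
    have h3 := O.d_sq S n m l h h'
    rw [Category.assoc, Category.assoc, Category.assoc, ← hM, ← Category.assoc (at_ X.i S m),
      ← Category.assoc (diff M S n m h), ← hM, h2, hϑ, ← h3]
    simp only [Category.assoc]
  rw [← kernelSubobject_factors_iff]
  exact Subobject.factors_of_le _ (h1 (.of S) n) (Subobject.factors_self _)

/-- The universal property of the free curved operad. -/
theorem existsUnique_hom (O : CurvedOperad A) (f : M ⟶ O.mod) :
    ∃! g : X.curved ⟶ O, X.toCurved ≫ g.hom = f := by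
  -- The values on generators are forced: `f` on `M`, and the curvature of `O` on `ϑ`.
  obtain ⟨l, hl₁, hl₂⟩ := BinaryCofan.IsColimit.desc' X.isColimit (grMap f)
    (varthetaHom O.θ O.θ_filt)
  obtain ⟨g, hg, -⟩ := X.isFree O.toOperad l
  have hgi : X.i ≫ g.hom = grMap f := by
    rw [Category.assoc, hg]
    exact hl₁
  have hgi' : ∀ (S : Type) [Finite S] (n : ℤ), at_ X.i S n ≫ at_ g.hom S n = at_ (grMap f) S n :=
    fun S _ n => congrArg (fun k => at_ k S n) hgi
  have hgt : (X.inϑ ≫ X.j) ≫ g.hom = varthetaHom O.θ O.θ_filt := by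
    rw [Category.assoc, hg]
    exact hl₂
  have hgϑ : X.ϑ ≫ at_ g.hom Unit (-2) = O.θ := by
    refine (Category.assoc _ _ _).trans ?_
    refine (_ ≫= congrArg (fun k => at_ k Unit (-2)) hgt).trans ?_
    exact varthetaGen_varthetaHom _ _
  have hM : ∀ (S : Type) [Finite S] (n m : ℤ) (h : m + 1 = n),
      at_ X.i S n ≫ at_ g.hom S n ≫ diff O.mod S n m h =
        diff M S n m h ≫ at_ X.i S m ≫ at_ g.hom S m := fun S _ n m h => by
    rw [← Category.assoc, hgi', hgi']
    exact (f.app (fin S)).comm n m h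
  obtain ⟨k, hk⟩ := X.isStrongQuotient.exists_hom g (X.arrow_comp_eq_zero g hM hgϑ)
  have hk' : ∀ (S : Type) [Finite S] (n : ℤ), at_ X.π.hom S n ≫ at_ k.hom S n = at_ g.hom S n :=
    fun S _ n => congrArg (fun k : X.T ⟶ _ => at_ k.hom S n) hk
  -- Filtered maps out of the quotient are determined after `π`, so commutation with the
  -- predifferentials descends from `T`.
  have hkd : ∀ (S : Type) [Finite S] (n m : ℤ) (h : m + 1 = n),
      at_ k.hom S n ≫ diff O.mod S n m h = X.dbar S n m h ≫ at_ k.hom S m := by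
    intro S _ n m h
    refine X.isStrongQuotient.hom_ext (W := (gr O.mod).obj (fin S)) ?_ ?_ ?_
    · exact IsFiltered.comp (V := (X.Q.mod.obj (fin S)).toFilteredGr)
        (W := ((gr O.mod).obj (fin S)).toFilteredGr) (U := ((gr O.mod).obj (fin S)).toFilteredGr)
        ((k.hom.app (fin S)).filt n) (O.isDerivation.filt S n m h)
    · exact IsFiltered.comp (V := (X.Q.mod.obj (fin S)).toFilteredGr)
        (W := (X.Q.mod.obj (fin S)).toFilteredGr) (U := ((gr O.mod).obj (fin S)).toFilteredGr)
        (X.isDerivation_dbar.filt S n m h) ((k.hom.app (fin S)).filt m)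
    · rw [← Category.assoc, hk', X.comm_of_comm g hM hgϑ, ← Category.assoc, π_dbar, Category.assoc,
        hk']
  refine ⟨⟨grDgHom (M := X.curved.mod) k.hom hkd, k.isHom, ?_⟩, ?_, ?_⟩
  · exact (Category.assoc _ _ _).trans ((_ ≫= hk' Unit (-2)).trans hgϑ)
  · refine NatTrans.ext (funext fun S => CompleteGrDg.Hom.ext (CompleteGr.Hom.ext (funext fun n =>
      ?_)))
    exact (Category.assoc _ _ _).trans ((_ ≫= hk' S.of n).trans (hgi' S.of n))
  · intro g' hg'
    -- Since `g'` extends `f` and preserves curvatures, its composite with `π` has the forced values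
    -- on generators; freeness of `T` and cancellation of `π` then determine it.
    have h1 : X.j ≫ X.π.hom ≫ grMap g'.hom = l := by
      refine BinaryCofan.IsColimit.hom_ext X.isColimit ?_ ?_
      · refine Eq.trans ?_ hl₁.symm
        have := congrArg grMap hg'
        refine Eq.trans ?_ this
        refine smod_hom_ext fun S _ n => ?_
        exact ((Category.assoc (at_ X.inM S n ≫ at_ X.j S n) _ _).trans (Category.assoc _ _ _)).symm
      · refine Eq.trans ?_ hl₂.symm
        refine varthetaHom_ext (Eq.trans ?_ (varthetaGen_varthetaHom O.θ O.θ_filt).symm)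
        refine Eq.trans ?_ g'.map_θ
        exact (_ ≫= (Category.assoc _ _ _).symm).trans
          ((_ ≫= (Category.assoc _ _ _).symm).trans ((Category.assoc _ _ _).symm.trans
            ((Category.assoc _ _ _).symm =≫ _)))
    have h2 : X.π ≫ (⟨grMap g'.hom, g'.isHom⟩ : X.Q ⟶ O.toOperad) = g :=
      (X.isFree O.toOperad l).unique h1 hg
    refine CurvedOperad.Hom.ext (NatTrans.ext (funext fun S => CompleteGrDg.Hom.ext
      (CompleteGr.Hom.ext (funext fun n => ?_))))
    refine X.isStrongQuotient.hom_ext (S := S.of) (W := (gr O.mod).obj S)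
      ((grMap g'.hom).app S |>.filt n) ((k.hom.app S).filt n) ?_
    exact (congrArg (fun k : X.T ⟶ _ => at_ k.hom S.of n) h2).trans (hk' S.of n).symm

end CurvedData

end FreeCurved

/-! ### Existence of the constituents of the construction. -/

section Existence

variable {A : Type u} [Category.{v} A] [Abelian A] [MonoidalCategory A] [SymmetricCategory A]
  [MonoidalClosed A] [HasCoproducts.{0} A] [HasSubobjectInter A] [HasLimitsOfShape ℕᵒᵖ A]

open FilteredGr

/-- The constituents of the construction of the free curved operad exist. -/
theorem nonempty_curvedData (M : SMod (CompleteGrDg A)) : Nonempty (CurvedData M) := by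
  let N := coprodMod (gr M) (vartheta A)
  let T := freeOperad N
  let j : N ⟶ T.mod := freeIncl N
  -- The projection of `M ⨿ ϑI` to `M`. The map to be extended to a derivation is `p`, then `d_M`,
  -- then the inclusion in `T`; it is zero on `ϑI`.
  let p : ∀ (S : Type) [Finite S] (n : ℤ), ev N S n ⟶ ev (gr M) S n := fun S _ n =>
    fst ((gr M).obj (fin S)).toFilteredGr ((vartheta A).obj (fin S)).toFilteredGr n
  have hp₁ : ∀ (S : Type) [Finite S] (n : ℤ),
      at_ (coprodInl (gr M) (vartheta A)) S n ≫ p S n = 𝟙 _ := fun S _ n => pair_fst _ _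
  have hp₂ : ∀ (S : Type) [Finite S] (n : ℤ),
      at_ (coprodInr (gr M) (vartheta A)) S n ≫ p S n = 0 := fun S _ n => pair_fst _ _
  have hp : ∀ {S S' : Type} [Finite S] [Finite S'] (e : S ≃ S') (n : ℤ),
      rel N e n ≫ p S' n = p S n ≫ rel (gr M) e n := by
    intro S S' _ _ e n
    have h1 := rel_at (coprodInl (gr M) (vartheta A)) e n
    have h2 := rel_at (coprodInr (gr M) (vartheta A)) e n
    refine coprod_hom_ext (P := gr M) (Q := vartheta A) (S := S) ?_ ?_
    · rw [← Category.assoc, ← h1, Category.assoc, hp₁, ← Category.assoc, hp₁, Category.comp_id,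
        Category.id_comp]
    · rw [← Category.assoc, ← h2, Category.assoc, hp₂, ← Category.assoc, hp₂, zero_comp, comp_zero]
  obtain ⟨d, hd, hjd⟩ := IsFreeOperad.exists_derivation (isFreeOperad_freeOperad (N := N))
    (fun S _ n m h => p S n ≫ diff M S n m h ≫ at_ (coprodInl (gr M) (vartheta A) ≫ j) S m)
    (fun S _ n m h => by
      refine IsFiltered.comp (V := (N.obj (fin S)).toFilteredGr)
        (W := ((gr M).obj (fin S)).toFilteredGr) (U := (T.mod.obj (fin S)).toFilteredGr)
        (fst_isFiltered n) ?_
      exact IsFiltered.comp (V := ((gr M).obj (fin S)).toFilteredGr)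
        (W := ((gr M).obj (fin S)).toFilteredGr) (U := (T.mod.obj (fin S)).toFilteredGr)
        ((M.obj (fin S)).d_filt n m h)
        (((coprodInl (gr M) (vartheta A) ≫ j).app (fin S)).filt m))
    (fun {S S'} _ _ e n m h => by
      have h1 := (M.map (bij e)).comm n m h
      have h2 := rel_at (coprodInl (gr M) (vartheta A) ≫ j) e m
      rw [← Category.assoc, hp, Category.assoc, Category.assoc, Category.assoc, ← h2,
        ← Category.assoc (diff M S n m h)]
      exact _ ≫= ((Category.assoc _ _ _).symm.trans (h1 =≫ _)))
  obtain ⟨J, hJ⟩ := exists_isCurvatureIdeal M (coprodInl (gr M) (vartheta A) ≫ j)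
    (varthetaGen A ≫ at_ (coprodInr (gr M) (vartheta A) ≫ j) Unit (-2))
  obtain ⟨Q, π, hπ⟩ := hJ.1.1.exists_isStrongQuotient
  exact ⟨{
    N := N
    inM := coprodInl _ _
    inϑ := coprodInr _ _
    T := T
    j := j
    d := d
    J := J
    Q := Q
    π := π
    isColimit := coprodIsColimit _ _
    coprod_ext := coprod_hom_ext _ _
    isFree := isFreeOperad_freeOperad
    isGenerated := freeOperad_eq_zero
    isDerivation := hd
    extendsDiff := fun S _ n m h => by
      refine ⟨(Category.assoc _ _ _).trans ((_ ≫= hjd S n m h).trans ?_),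
        (Category.assoc _ _ _).trans ((_ ≫= hjd S n m h).trans ?_)⟩
      · rw [← Category.assoc, hp₁, Category.id_comp]
      · rw [← Category.assoc, hp₂, zero_comp]
    isCurvatureIdeal := hJ
    isStrongQuotient := hπ }⟩

end Existence

/-! ### From universal morphisms to a left adjoint. -/

section Adjunction

/-- A functor to which there are universal morphisms from all objects is a right adjoint, and the
universal morphisms are the components of the unit. -/
theorem exists_adjunction_of_existsUnique {C : Type*} [Category* C] {D : Type*} [Category* D]
    (G : D ⥤ C) (F : C → D) (η : ∀ X, X ⟶ G.obj (F X))
    (h : ∀ (X : C) (Y : D) (f : X ⟶ G.obj Y), ∃! g : F X ⟶ Y, η X ≫ G.map g = f)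
    (p : ∀ (X : C) (Y : D), (X ⟶ G.obj Y) → Prop) (hp : ∀ X, p X (F X) (η X)) :
    ∃ (L : C ⥤ D) (adj : L ⊣ G), ∀ X, p X (L.obj X) (adj.unit.app X) := by
  let E : ∀ X Y, (F X ⟶ Y) ≃ (X ⟶ G.obj Y) := fun X Y =>
    { toFun := fun g => η X ≫ G.map g
      invFun := fun f => (h X Y f).choose
      left_inv := fun g => ((h X Y _).choose_spec.2 g rfl).symm
      right_inv := fun f => (h X Y f).choose_spec.1 }
  have he : ∀ X Y Y' (g : Y ⟶ Y') (k : F X ⟶ Y), E X Y' (k ≫ g) = E X Y k ≫ G.map g := by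
    intro X Y Y' g k
    change η X ≫ G.map (k ≫ g) = (η X ≫ G.map k) ≫ G.map g
    rw [G.map_comp, Category.assoc]
  refine ⟨Adjunction.leftAdjointOfEquiv E he, Adjunction.adjunctionOfEquivLeft E he, fun X => ?_⟩
  -- The unit is the image of the identity under the bijection of hom-sets. The predicate `p`
  -- carries what is known of `F X` and `η X` over to the adjunction, which is only asserted to
  -- exist.
  have h1 : (Adjunction.adjunctionOfEquivLeft E he).unit.app X = η X := by
    change η X ≫ G.map (𝟙 (F X)) = η X
    rw [G.map_id, Category.comp_id]
  rw [h1]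
  exact hp X

end Adjunction

end

end FreeCurvedOperad

/-- The free curved operad functor, its description, its adjunction with the forgetful functor, and
the universal property of its values. -/
theorem mainTheorem12 {A : Type u} [Category.{v} A] [Abelian A] [IsGrothendieckAbelian.{w} A]
    [MonoidalCategory A] [SymmetricCategory A] [MonoidalClosed A] :
    ∃ (cT : SMod (CompleteGrDg A) ⥤ CurvedOperad A) (adj : cT ⊣ CurvedOperad.forget A),
      (∀ M : SMod (CompleteGrDg A), IsFreeCurvedQuotient M (cT.obj M) (adj.unit.app M)) ∧
      (∀ (M : SMod (CompleteGrDg A)) (O : CurvedOperad A) (f : M ⟶ (CurvedOperad.forget A).obj O),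
        ∃! g : cT.obj M ⟶ O, adj.unit.app M ≫ (CurvedOperad.forget A).map g = f) := by
  have := hasSubobjectInter.{w} (A := A)
  -- The towers and the coproducts over terms are indexed by types in the lowest universe, whatever
  -- the universe `w` of the Grothendieck structure.
  have : HasLimitsOfSize.{0, 0} A := hasLimitsOfSizeShrink.{0, 0, w, w} A
  have : HasCoproducts.{0} A := by
    have : HasColimitsOfSize.{0, 0} A := hasColimitsOfSizeShrink.{0, 0, w, w} A
    infer_instance
  have X := fun M : SMod (CompleteGrDg A) => (nonempty_curvedData M).some
  have H : ∀ (M : SMod (CompleteGrDg A)) (O : CurvedOperad A)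
      (f : M ⟶ (CurvedOperad.forget A).obj O), ∃! g : (X M).curved ⟶ O,
        (X M).toCurved ≫ (CurvedOperad.forget A).map g = f := fun M O f =>
    (X M).existsUnique_hom O f
  obtain ⟨cT, adj, h⟩ := exists_adjunction_of_existsUnique (CurvedOperad.forget A)
    (fun M => (X M).curved) (fun M => (X M).toCurved) H
    (fun M C u => IsFreeCurvedQuotient M C u ∧ ∀ (O : CurvedOperad A)
      (f : M ⟶ (CurvedOperad.forget A).obj O), ∃! g : C ⟶ O,
        u ≫ (CurvedOperad.forget A).map g = f)
    (fun M => ⟨(X M).isFreeCurvedQuotient, H M⟩)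
  exact ⟨cT, adj, fun M => (h M).1, fun M => (h M).2⟩
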